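/- Let $G$ be a finite connected plane graph with at least one edge (multiple edges are allowed), given by the cyclic counterclockwise order of the edges around each vertex and by its outer face. Let every edge have a positive length, and let every angle of $G$ (a pair of consecutive edges at a vertex, belonging to the face between them) be assigned one of the values $0$, $180^\circ$, $360^\circ$, such that the angles at each vertex sum to $360^\circ$. A *flat folding* of $G$ is a one-dimensional self-touching configuration on a line that realizes $G$. It consists of a path $H$ with vertices $0,\dots,n$ placed on the real line at increasing positions; a map that sends each vertex of $G$ to a vertex of $H$ and each edge of $G$ to the path of $H$ between the images of its ends, such that the length of this path is the given length of the edge and every edge of $H$ is used; for each edge of $H$, a linear order from bottom to top of the edges of $G$ mapped onto it (its *magnified view*); and, for each vertex of $H$, a planar embedding into a disk of the part of $G$ near its preimage (the vertices of $G$ mapped to it with their incident edges, and the edges that pass through it), up to isotopy, where the edges cross the boundary of the disk in the orders given by the magnified views of the edges of $H$ to the right and to the left. The plane drawing that arises in this way must have the given cyclic order of edges around each vertex and the given outer face. Moreover the angle between two consecutive edges at a vertex must be the assigned one, where this angle is $180^\circ$ if the two edges extend in opposite directions and, if they extend in the same direction, $0$ if the face lies between them and $360^\circ$ if the face goes around the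 vertex (in particular if the two edges coincide). Two edges of $G$ form a *touching pair* of a flat folding if they are consecutive in the magnified view of at least one edge of $H$. A touching pair is recorded as the unordered pair of the two sides of edges that face each other; it belongs to the face that lies between them. The *face cycle* of a face $f$ is the plane cycle whose edges are the sides of edges of $G$ in the order met by the boundary walk of $f$ (a vertex or an edge that is met repeatedly is replaced by copies), with the induced lengths. The side of the cycle corresponding to $f$ has the angles of $f$, the other side has the complementary angles ($360^\circ$ minus the angle), and the side corresponding to $f$ is the outer face exactly if $f$ is the outer face of $G$. Then $G$ has a flat folding if and only if the face cycle of every face of $G$ has a flat folding. More strongly, for every choice of a flat folding $\Phi_f$ of the face cycle of each face $f$ of $G$, there is a flat folding of $G$ such that two sides of edges of $G$ touch in it if and only if they belong to a common face $f$ and touch in $\Phi_f$ on the side of the cycle corresponding to $f$. -/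

import Mathlib

/-- A finite graph drawn on a closed oriented surface, given by its rotation system. `D` is the
set of darts (edges with a direction; multiple edges are allowed). `rot d` is the dart that
follows `d` counterclockwise around the starting vertex of `d`, and `opp d` is the same edge in the
other direction. Vertices, edges and faces are the orbits of `rot`, `opp` and `faceNext`. -/
structure EmbeddedGraph (D : Type*) where
  rot : Equiv.Perm D
  opp : Equiv.Perm D
  opp_opp : ∀ d, opp (opp d) = d
  opp_ne : ∀ d, opp d ≠ d

namespace EmbeddedGraph

variable {D : Type*} (G : EmbeddedGraph D)

/-- The dart after `d` in the walk along the boundary of the face to the left of `d`. -/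
def faceNext : Equiv.Perm D := G.opp.trans G.rot.symm

/-- The vertices (each one is incident to some edge). -/
abbrev Vertex : Type _ := Quotient (Equiv.Perm.SameCycle.setoid G.rot)

/-- The undirected edges. -/
abbrev Edge : Type _ := Quotient (Equiv.Perm.SameCycle.setoid G.opp)

/-- The faces. -/
abbrev Face : Type _ := Quotient (Equiv.Perm.SameCycle.setoid G.faceNext)

/-- The starting vertex of a dart. -/
def vertex (d : D) : G.Vertex := Quotient.mk _ d

/-- The face to the left of a dart. -/
def face (d : D) : G.Face := Quotient.mk _ d

/-- The underlying graph is connected. -/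
def Connected : Prop :=
  ∀ d e : D, ∃ g ∈ Subgroup.closure ({G.rot, G.opp} : Set (Equiv.Perm D)), g d = e

/-- The graph is a nonempty connected graph embedded in the sphere: Euler's formula holds. -/
def IsPlane : Prop :=
  G.Connected ∧ Nat.card G.Vertex + Nat.card G.Face = Nat.card G.Edge + 2

theorem face_faceNext (d : D) : G.face (G.faceNext d) = G.face d :=
  Quotient.sound (Equiv.Perm.sameCycle_apply_left.2 (Equiv.Perm.SameCycle.refl _ d))

end EmbeddedGraph

/-- The three possible angles of a flat folding. -/
inductive FoldAngle
  | valley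
  | flat
  | mountain

namespace FoldAngle

/-- The size of the angle, in degrees. -/
def degrees : FoldAngle → ℕ
  | valley => 0
  | flat => 180
  | mountain => 360

/-- The complementary angle, `360°` minus the given one. -/
def compl : FoldAngle → FoldAngle
  | valley => mountain
  | flat => flat
  | mountain => valley

end FoldAngle

/-- An embedded graph with a choice of the outer face, with edge lengths, and with an angle
assignment: `angle d` is the angle between the consecutive edges `d` and `rot d` at the starting
vertex of `d`, which is an angle of the face to the left of `d`. -/
structure FoldingInput (D : Type*) extends EmbeddedGraph D where
  outer : toEmbeddedGraph.Face
  length : D → ℝ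
  length_pos : ∀ d, 0 < length d
  length_opp : ∀ d, length (opp d) = length d
  angle : D → FoldAngle

namespace FoldingInput

variable {D : Type*} (G : FoldingInput D)

open Classical in
/-- The angles at each vertex sum to `360°`. -/
def Consistent [Fintype D] : Prop :=
  ∀ v : G.Vertex, ∑ d : D with G.vertex d = v, (G.angle d).degrees = 360

/-- The walk along the boundary of a face, as a permutation of the darts of that face. -/
def boundaryNext (f : G.Face) : Equiv.Perm {d : D // G.face d = f} :=
  G.faceNext.subtypePerm fun d => by rw [G.face_faceNext]

open Classical in
/-- The cycle around the face `f`, with the induced lengths and angles. Its edges are the darts of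
`f`, that is, the sides of edges met in the walk around `f`, so that it is a cycle even if an edge
or a vertex is met more than once. The dart `(d, true)` is the side `d` in the direction of the
walk, with `f` to its left, and `(d, false)` is its reverse, with the complement of `f` to its
left. The outer face is the one corresponding to `f` exactly if `f` is the outer face of `G`. -/
noncomputable def faceCycle (f : G.Face) : FoldingInput ({d : D // G.face d = f} × Bool) where
  rot :=
    { toFun := fun x =>
        if x.2 then ((G.boundaryNext f).symm x.1, false) else (G.boundaryNext f x.1, true)
      invFun := fun x =>
        if x.2 then ((G.boundaryNext f).symm x.1, false) else (G.boundaryNext f x.1, true)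
      left_inv := by rintro ⟨d, _ | _⟩ <;> simp
      right_inv := by rintro ⟨d, _ | _⟩ <;> simp }
  opp := Equiv.prodCongr (Equiv.refl _) Equiv.boolNot
  opp_opp := by rintro ⟨d, _ | _⟩ <;> rfl
  opp_ne := by rintro ⟨d, _ | _⟩ <;> simp
  outer := Quotient.mk _ (⟨f.out, Quotient.out_eq f⟩, decide (f = G.outer))
  length := fun x => G.length x.1
  length_pos := fun x => G.length_pos x.1
  length_opp := fun _ => rfl
  angle := fun x =>
    if x.2 then G.angle x.1 else (G.angle (G.boundaryNext f x.1)).compl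

end FoldingInput

/-- In the cyclic order of the list `l`, a walk that starts at `a` meets `b` before `c`
(for distinct entries of a list without repetitions). -/
def CyclicBetween {α : Type*} (l : List α) (a b c : α) : Prop :=
  List.Sublist [a, b, c] l ∨ List.Sublist [b, c, a] l ∨ List.Sublist [c, a, b] l

/-- The map to the line and the linear orders of a self-touching configuration.

The path graph `H` has the vertices `0, …, n`, placed on the line at `pos 0 < … < pos n`, and the
edges `i` from `i` to `i + 1` for `i < n`. The starting vertex of `d` is mapped to the vertex
`level d` of `H`, and the edge of `d` to the path between the images of its ends.
`view i` is the magnified view of the edge `i` of `H`: it lists the edges of `G` that are mapped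
onto it from bottom to top, each one as its dart that goes to the right. -/
structure LineConfiguration {D : Type*} (G : FoldingInput D) where
  n : ℕ
  pos : ℕ → ℝ
  pos_lt : ∀ i j, i < j → j ≤ n → pos i < pos j
  level : D → ℕ
  level_le : ∀ d, level d ≤ n
  level_rot : ∀ d, level (G.rot d) = level d
  length_eq : ∀ d, |pos (level (G.opp d)) - pos (level d)| = G.length d
  view : ℕ → List D
  nodup_view : ∀ i, (view i).Nodup
  mem_view : ∀ i d, d ∈ view i ↔ level d ≤ i ∧ i < level (G.opp d)
  view_ne_nil : ∀ i, i < n → view i ≠ []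

namespace LineConfiguration

variable {D : Type*} {G : FoldingInput D} (F : LineConfiguration G)

/-- The places where the edges of `G` cross the boundary of the disk of the magnified view of the
vertex `i` of `H`, counterclockwise: the right side from bottom to top, then the left side from top
to bottom. Each edge is listed as the dart that leaves the disk there; an edge that passes through
the disk is listed once in each direction. -/
def rim : ℕ → List D
  | 0 => F.view 0
  | i + 1 => F.view (i + 1) ++ ((F.view i).reverse.map G.opp)

/-- Two places on the boundary of the disk of the vertex `i` of `H` belong to the same component
of the part of `G` in this disk: such a component is a vertex of `G` mapped to `i` with its
incident edges, or an edge that passes through. -/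
def Joined (i : ℕ) (a b : D) : Prop :=
  (F.level a = i ∧ G.vertex a = G.vertex b) ∨ (F.level a ≠ i ∧ (b = a ∨ b = G.opp a))

/-- The dart goes to the right. -/
def GoesRight (d : D) : Prop := F.level d < F.level (G.opp d)

open Classical in
/-- The angle between `d` and `rot d`, on the side to the left of `d`: it is `180°` if the two
edges extend in opposite directions. Otherwise they are on the same side of the disk, and it is `0`
or `360°` according to whether the counterclockwise arc from `d` to `rot d` stays on this side
or goes all the way around (this includes the case `rot d = d`). -/
noncomputable def cornerAngle (d : D) : FoldAngle :=
  if F.GoesRight d ↔ F.GoesRight (G.rot d) then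
    if List.Sublist [d, G.rot d] (F.rim (F.level d)) then .valley else .mountain
  else .flat

end LineConfiguration

/-- A flat folding of `G`: a self-touching configuration on a line that realizes the embedding,
the outer face, the edge lengths and the angle assignment of `G`. The magnified view of the vertex
`i` of `H` is an embedding in a disk of the disjoint stars and arcs described by `Joined i`, with
ends on the boundary in the order `rim i`: it exists if no two components cross (`noncrossing`),
is then unique up to isotopy, and has to induce the given cyclic order at each vertex of `G`
(`rotation`). -/
structure FlatFolding {D : Type*} (G : FoldingInput D) extends LineConfiguration G where
  noncrossing : ∀ i a b c d, List.Sublist [a, b, c, d] (toLineConfiguration.rim i) →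
    toLineConfiguration.Joined i a c → toLineConfiguration.Joined i b d →
    toLineConfiguration.Joined i a b
  rotation : ∀ a b, G.vertex a = G.vertex b →
    ¬ CyclicBetween (toLineConfiguration.rim (level a)) a b (G.rot a)
  angle_eq : ∀ d, toLineConfiguration.cornerAngle d = G.angle d
  outer_bottom : ∀ i, ∀ d ∈ (view i).head?, G.face (G.opp d) = G.outer
  outer_top : ∀ i, ∀ d ∈ (view i).getLast?, G.face d = G.outer

namespace FlatFolding

variable {D : Type*} {G : FoldingInput D}

/-- Two edges form a touching pair if they are consecutive in some magnified view. The pair is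
recorded by the sides of the two edges that face each other, as the darts having these sides to
their left, so that it lies in the face to the left of these darts. -/
def Touching (F : FlatFolding G) (a b : D) : Prop :=
  ∃ i, List.IsInfix [a, G.opp b] (F.view i) ∨ List.IsInfix [b, G.opp a] (F.view i)

end FlatFolding

/-!
A flat folding is encoded as a *layering*: the vertices get levels, and over each interval between
two levels the edges get integer heights. On the rim of the disk around a level the places of the
edges are linearly ordered, first the right side upwards and then the left side downwards, and
`turn` takes a place to the next one in its component. The angles say at which places `turn` goes
forward in the order of the rim.

A flat folding of the graph restricts to every face cycle by keeping the sides of edges that belong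
to the face (`Layering.split`). The only point that needs an argument is that the lowest and the
highest remaining sides are as required: consecutive edges of a magnified view face each other in
the same face (`Layering.Consecutive.face_eq`). This is a discrete version of Jordan's theorem: the
jumps of a function of the faces across the edges, summed from below, recover the function.

Conversely, let a flat folding of each face cycle be given. The reflections and the translations
that make the foldings agree on the positions are a function of the faces with prescribed
differences across the edges. It exists because the prescribed differences sum to zero around each
vertex and the graph is plane (`IsPlane.exists_faceShift`). The exactness used here is linear
algebra: for two permutations `a`, `b` generating a transitive group, Euler's inequality
`numCycles_add_le` holds, and in the case of equality the functions orthogonal to the invariants of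
`a` and of `b` are the differences `u - u ∘ b` with `u` invariant under `b * a`
(`exists_invariant_sub`), with a dual statement `exists_invariant_add`.

Then the orders have to be glued. The face foldings say for each edge over an interval which edge is
next above it, and this gives a permutation `edgeNext` of the edges over the interval together with
an additional line above everything. It has to be shown that this permutation is a single cycle, and
that the resulting order has no crossings and the right angles. In the disk of a level, consider the
permutation `σ` given by `turn`, the permutation `R` given by `edgeNext`, and `φ = σ⁻¹ R`, whose
orbits are the pieces into which the components cut the disk. In each orbit of `φ` at most one place
goes forward, since the components do not cross in the folding of the face (`eq_of_forward`), and in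
each orbit of `σ` at most one place does not, since the angles at a vertex sum to `360°`
(`eq_of_not_forward`). Hence `σ` and `φ` together have at least as many orbits as there are places,
and Euler's inequality leaves room for only two orbits of `R` in each orbit of the group generated
by `σ` and `R` in which one of them has this property (`sameCycle_or_sameCycle`). For the orbit of
the line these are its two sides, so the edges in the cycles of the line are closed under `turn`,
and by connectedness all edges are among them. Now equality holds in Euler's inequality, and
exactness shows that the prescribed forward places are the actual ones (`IsSlitRim.forward_iff`) and
that the components do not cross (`IsSlitRim.noncrossing`).
-/


/-! ### Functions invariant under a pair of permutations -/

section PermutationPairs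

open Equiv.Perm

variable {X : Type*}

/-- The number of orbits of a permutation, fixed points included. -/
noncomputable def numCycles (a : Equiv.Perm X) : ℕ := Nat.card (Quotient (SameCycle.setoid a))

/-- The functions that are constant on the orbits of a permutation. -/
def invariantFunctions (K : Type*) [Field K] (a : Equiv.Perm X) : Submodule K (X → K) where
  carrier := {g | ∀ x, g (a x) = g x}
  add_mem' := fun {g h} hg hh x => by simp [hg x, hh x]
  zero_mem' := fun _ => rfl
  smul_mem' := fun c g hg x => by simp [hg x]

/-- The group generated by two permutations is transitive. -/
def JointlyTransitive (a b : Equiv.Perm X) : Prop :=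
  ∀ x y, ∃ g ∈ Subgroup.closure ({a, b} : Set (Equiv.Perm X)), g x = y

theorem eq_of_jointlyTransitive {α : Type*} {a b : Equiv.Perm X} (h : JointlyTransitive a b)
    {g : X → α} (ha : ∀ x, g (a x) = g x) (hb : ∀ x, g (b x) = g x) (x y : X) : g x = g y := by
  obtain ⟨p, hp, rfl⟩ := h x y
  induction hp using Subgroup.closure_induction generalizing x with
  | mem p hp =>
    rcases hp with rfl | rfl
    · exact (ha x).symm
    · exact (hb x).symm
  | one => rfl
  | mul p q _ _ ihp ihq => rw [Equiv.Perm.mul_apply, ← ihp, ← ihq]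
  | inv p _ ih => simpa using (ih (p⁻¹ x)).symm

theorem SameCycle.apply_eq {α : Type*} {a : Equiv.Perm X} {g : X → α} (h : ∀ x, g (a x) = g x)
    {x y : X} (hxy : a.SameCycle x y) : g x = g y := by
  obtain ⟨n, rfl⟩ := hxy
  have hinv : ∀ z, g (a⁻¹ z) = g z := fun z => by simpa using (h (a⁻¹ z)).symm
  induction n using Int.induction_on generalizing x with
  | zero => rfl
  | succ n ih => rw [zpow_add_one, Equiv.Perm.mul_apply, ← ih, h]
  | pred n ih => rw [zpow_sub_one, Equiv.Perm.mul_apply, ← ih, hinv]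

variable {K : Type*} [Field K] {a b : Equiv.Perm X}

/-- For an invariant function `f` of `b * a`, the difference of `f` and `f ∘ b`. -/
def shiftDifferences (K : Type*) [Field K] (a b : Equiv.Perm X) : Submodule K (X → K) :=
  (invariantFunctions K (b * a)).map (LinearMap.id - LinearMap.funLeft K K b)

theorem finrank_inf_invariantFunctions [Nonempty X] (h : JointlyTransitive a b) :
    Module.finrank K ↥(invariantFunctions K a ⊓ invariantFunctions K b) = 1 := by
  have : invariantFunctions K a ⊓ invariantFunctions K b = K ∙ (1 : X → K) := by
    ext g
    rw [Submodule.mem_inf, Submodule.mem_span_singleton]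
    constructor
    · rintro ⟨ha, hb⟩
      refine ⟨g (Classical.arbitrary X), ?_⟩
      ext x
      simpa using eq_of_jointlyTransitive h ha hb _ x
    · rintro ⟨c, rfl⟩
      exact ⟨fun _ => rfl, fun _ => rfl⟩
  rw [this]
  exact finrank_span_singleton one_ne_zero

variable [Fintype X]

theorem finrank_invariantFunctions (a : Equiv.Perm X) :
    Module.finrank K (invariantFunctions K a) = numCycles a := by
  classical
  have : invariantFunctions K a = LinearMap.range
      (LinearMap.funLeft K K (Quotient.mk (SameCycle.setoid a))) := by
    ext g
    constructor
    · intro hg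
      exact ⟨Quotient.lift g fun x y hxy => SameCycle.apply_eq hg hxy, rfl⟩
    · rintro ⟨h, rfl⟩ x
      exact congrArg h (Quotient.sound (sameCycle_apply_left.2 (SameCycle.refl _ _)))
  rw [this, LinearMap.finrank_range_of_inj
    (LinearMap.funLeft_injective_of_surjective _ _ _ Quotient.mk_surjective), numCycles,
    Module.finrank_fintype_fun_eq_card, Nat.card_eq_fintype_card]

theorem finrank_shiftDifferences [Nonempty X] (h : JointlyTransitive a b) :
    Module.finrank K (shiftDifferences K a b) + 1 = numCycles (b * a) := by
  rw [← finrank_invariantFunctions (K := K), ← finrank_inf_invariantFunctions (K := K) h]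
  have key := LinearMap.finrank_range_add_finrank_ker
    ((LinearMap.id - LinearMap.funLeft K K b).domRestrict (invariantFunctions K (b * a)))
  rw [LinearMap.range_domRestrict] at key
  rw [← key, shiftDifferences]
  congr 1
  have hker : ((LinearMap.id - LinearMap.funLeft K K b).domRestrict
      (invariantFunctions K (b * a))).ker =
      (invariantFunctions K a ⊓ invariantFunctions K b).comap
        (invariantFunctions K (b * a)).subtype := by
    ext ⟨g, hg⟩
    simp only [LinearMap.mem_ker, Submodule.mem_comap, Submodule.subtype_apply,
      Submodule.mem_inf, LinearMap.domRestrict_apply, LinearMap.sub_apply, LinearMap.id_apply]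
    constructor
    · intro h0
      have hb : ∀ x, g (b x) = g x := fun x => (sub_eq_zero.1 (congrFun h0 x)).symm
      exact ⟨fun x => by rw [← hb (a x)]; exact hg x, hb⟩
    · rintro ⟨-, hb⟩
      ext x
      exact sub_eq_zero.2 (hb x).symm
  rw [hker]
  have hle : invariantFunctions K a ⊓ invariantFunctions K b ≤ invariantFunctions K (b * a) :=
    fun g hg x => (hg.2 (a x)).trans (hg.1 x)
  exact (Submodule.comapSubtypeEquivOfLe hle).finrank_eq.symm

/-- The orthogonal complement for the standard dot product. -/
abbrev dotComplement (U : Submodule K (X → K)) : Submodule K (X → K) :=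
  LinearMap.BilinForm.orthogonal (dotProductBilin K K) U

theorem mem_dotComplement {U : Submodule K (X → K)} {g : X → K} :
    g ∈ dotComplement U ↔ ∀ u ∈ U, ∑ x, u x * g x = 0 := Iff.rfl

theorem nondegenerate_dotProductBilin :
    LinearMap.BilinForm.Nondegenerate (dotProductBilin K K : LinearMap.BilinForm K (X → K)) := by
  classical
  constructor
  · intro g hg
    exact dotProduct_eq_zero_iff.1 hg
  · intro g hg
    refine dotProduct_eq_zero_iff.1 fun w => ?_
    rw [dotProduct_comm]
    exact hg w

theorem finrank_dotComplement (U : Submodule K (X → K)) :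
    Module.finrank K (dotComplement U) + Module.finrank K U = Fintype.card X := by
  have h1 := LinearMap.BilinForm.finrank_orthogonal (nondegenerate_dotProductBilin (K := K)) U
  have h2 := U.finrank_le
  rw [Module.finrank_fintype_fun_eq_card] at h1 h2
  unfold dotComplement
  omega

theorem sup_invariantFunctions_le (a b : Equiv.Perm X) :
    invariantFunctions K a ⊔ invariantFunctions K b ≤ dotComplement (shiftDifferences K a b) := by
  refine sup_le (fun g hg => ?_) (fun g hg => ?_) <;> rw [mem_dotComplement] <;>
    rintro _ ⟨u, hu, rfl⟩ <;> simp only [LinearMap.sub_apply, LinearMap.id_apply, Pi.sub_apply,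
      LinearMap.funLeft_apply, sub_mul, Finset.sum_sub_distrib]
  · rw [sub_eq_zero, ← Equiv.sum_comp a (fun x => u (b x) * g x)]
    exact Finset.sum_congr rfl fun x _ => by rw [hg x]; congr 1; exact (hu x).symm
  · rw [sub_eq_zero, ← Equiv.sum_comp b (fun x => u x * g x)]
    exact Finset.sum_congr rfl fun x _ => by rw [hg x]

theorem finrank_sup_invariantFunctions [Nonempty X] (h : JointlyTransitive a b) :
    Module.finrank K ↥(invariantFunctions K a ⊔ invariantFunctions K b) + 1 =
      numCycles a + numCycles b := by
  rw [← finrank_inf_invariantFunctions (K := K) h, Submodule.finrank_sup_add_finrank_inf_eq,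
    finrank_invariantFunctions, finrank_invariantFunctions]

/-- The inequality `V - E + F ≤ 2`, for the hypermap given by two permutations. -/
theorem numCycles_add_le [Nonempty X] (h : JointlyTransitive a b) :
    numCycles a + numCycles b + numCycles (b * a) ≤ Fintype.card X + 2 := by
  have h1 := finrank_sup_invariantFunctions (K := ℚ) h
  have h2 := finrank_shiftDifferences (K := ℚ) h
  have h3 := Submodule.finrank_mono (sup_invariantFunctions_le (K := ℚ) a b)
  have h4 := finrank_dotComplement (shiftDifferences ℚ a b)
  omega

theorem sup_invariantFunctions_eq [Nonempty X] (h : JointlyTransitive a b)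
    (hc : numCycles a + numCycles b + numCycles (b * a) = Fintype.card X + 2) :
    invariantFunctions K a ⊔ invariantFunctions K b = dotComplement (shiftDifferences K a b) := by
  have h1 := finrank_sup_invariantFunctions (K := K) h
  have h2 := finrank_shiftDifferences (K := K) h
  have h4 := finrank_dotComplement (shiftDifferences K a b)
  exact Submodule.eq_of_le_of_finrank_le (sup_invariantFunctions_le a b) (by omega)

/-- In genus zero the first cohomology vanishes. -/
theorem exists_invariant_add [Nonempty X] (h : JointlyTransitive a b)
    (hc : numCycles a + numCycles b + numCycles (b * a) = Fintype.card X + 2) (g : X → K)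
    (hg : ∀ u : X → K, (∀ x, u (b (a x)) = u x) → ∑ x, (u x - u (b x)) * g x = 0) :
    ∃ α β : X → K, (∀ x, α (a x) = α x) ∧ (∀ x, β (b x) = β x) ∧ ∀ x, g x = α x + β x := by
  have : g ∈ invariantFunctions K a ⊔ invariantFunctions K b := by
    rw [sup_invariantFunctions_eq h hc, mem_dotComplement]
    rintro _ ⟨u, hu, rfl⟩
    exact hg u hu
  obtain ⟨α, hα, β, hβ, rfl⟩ := Submodule.mem_sup.1 this
  exact ⟨α, β, hα, hβ, fun _ => rfl⟩

/-- In genus zero the first homology vanishes. -/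
theorem exists_invariant_sub [Nonempty X] (h : JointlyTransitive a b)
    (hc : numCycles a + numCycles b + numCycles (b * a) = Fintype.card X + 2) (g : X → K)
    (ha : ∀ u : X → K, (∀ x, u (a x) = u x) → ∑ x, u x * g x = 0)
    (hb : ∀ u : X → K, (∀ x, u (b x) = u x) → ∑ x, u x * g x = 0) :
    ∃ u : X → K, (∀ x, u (b (a x)) = u x) ∧ ∀ x, g x = u x - u (b x) := by
  have hg : g ∈ dotComplement (invariantFunctions K a ⊔ invariantFunctions K b) := by
    rw [mem_dotComplement]
    intro v hv
    obtain ⟨α, hα, β, hβ, rfl⟩ := Submodule.mem_sup.1 hv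
    simp only [Pi.add_apply, add_mul, Finset.sum_add_distrib]
    rw [ha α hα, hb β hβ, add_zero]
  have hrefl : (dotProductBilin K K : LinearMap.BilinForm K (X → K)).IsRefl := by
    intro u v huv
    simpa [dotProductBilin, dotProduct_comm] using huv
  rw [sup_invariantFunctions_eq h hc, dotComplement, dotComplement,
    LinearMap.BilinForm.orthogonal_orthogonal nondegenerate_dotProductBilin hrefl] at hg
  obtain ⟨u, hu, rfl⟩ := hg
  exact ⟨u, hu, fun _ => rfl⟩

end PermutationPairs


/-! ### Noncrossing orders -/

section NoncrossingOrders

variable {Y A : Type*} [LinearOrder A] {s : Equiv.Perm Y} {p : Y → A}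

theorem of_sameCycle [Finite Y] {S : Y → Prop} (hS : ∀ y, S y → S (s y)) {x y : Y}
    (hxy : s.SameCycle x y) (hx : S x) : S y := by
  obtain ⟨n, rfl⟩ := hxy.exists_nat_pow_eq
  clear hxy
  induction n with
  | zero => exact hx
  | succ n ih => rw [pow_succ', Equiv.Perm.mul_apply]; exact hS _ ih

/-- A cycle that meets a set and its complement leaves the set somewhere. -/
theorem exists_exit [Finite Y] (S : Y → Prop) {x y : Y} (hxy : s.SameCycle x y) (hx : S x)
    (hy : ¬ S y) : ∃ z, s.SameCycle x z ∧ S z ∧ ¬ S (s z) := by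
  by_contra! h
  have := of_sameCycle (S := fun z => s.SameCycle x z ∧ S z)
    (fun z hz => ⟨Equiv.Perm.sameCycle_apply_right.2 hz.1, h z hz.1 hz.2⟩) hxy
    ⟨Equiv.Perm.SameCycle.refl _ _, hx⟩
  exact hy this.2

variable (hNC : ∀ x y, p x < p y → p y < p (s x) → p x < p (s y) ∧ p (s y) < p (s x))

include hNC

theorem noncrossing_orbit [Finite Y] {x y z : Y} (hyz : s.SameCycle y z) (h1 : p x < p y)
    (h2 : p y < p (s x)) : p x < p z ∧ p z < p (s x) :=
  of_sameCycle (S := fun z => p x < p z ∧ p z < p (s x)) (fun y hy => hNC x y hy.1 hy.2) hyz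
    ⟨h1, h2⟩

/-- If the permutation steps back from `x` to `s x`, then the interval between the two is a union
of orbits, like the intervals over which it steps forward. -/
theorem noncrossing_back [Finite Y] (hp : Function.Injective p) {x y : Y} (hx : p (s x) ≤ p x)
    (h1 : p (s x) ≤ p y) (h2 : p y ≤ p x) : p (s x) ≤ p (s y) ∧ p (s y) ≤ p x := by
  rcases eq_or_ne y x with rfl | hne
  · exact ⟨le_rfl, hx⟩
  have hlt : p y < p x := lt_of_le_of_ne h2 (hp.ne hne)
  refine ⟨?_, ?_⟩ <;> by_contra! hcon
  · obtain ⟨z, hyz, hz1, hz2⟩ := exists_exit (s := s) (fun z => p z < p (s x)) (x := s y) (y := y)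
      (Equiv.Perm.sameCycle_apply_left.2 (Equiv.Perm.SameCycle.refl _ _)) hcon (not_lt.2 h1)
    have hyz' : s.SameCycle y z := Equiv.Perm.sameCycle_apply_left.1 hyz
    have hzx : z ≠ x := by rintro rfl; exact absurd hx (not_le.2 hz1)
    have hz3 : p (s x) < p (s z) :=
      lt_of_le_of_ne (not_lt.1 hz2) (hp.ne (s.injective.ne hzx.symm))
    have hxI := noncrossing_orbit hNC (z := x)
      (Equiv.Perm.sameCycle_apply_left.2 (Equiv.Perm.SameCycle.refl _ _)) hz1 hz3
    have := noncrossing_orbit hNC hyz' (lt_of_lt_of_le hz1 h1) (lt_of_le_of_lt h2 hxI.2)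
    exact lt_irrefl _ this.1
  · exact absurd h1 (not_le.2 (hNC y x hlt hcon).1)

end NoncrossingOrders

/-! ### Levels -/

namespace EmbeddedGraph

variable {D : Type*} (G : EmbeddedGraph D) (lev : D → ℕ)

/-- `lev` is constant on the vertices, and it differs at the two ends of each edge. -/
structure IsLevel : Prop where
  rot : ∀ d, lev (G.rot d) = lev d
  ne : ∀ d, lev (G.opp d) ≠ lev d

/-- The dart goes to the right and its edge lies over the interval from `i` to `i + 1`. -/
def Crosses (i : ℕ) (d : D) : Prop := lev d ≤ i ∧ i < lev (G.opp d)

/-- The dart leaves the disk of the magnified view of the level `j + 1`, on the right side or on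
the left side. The darts with this property are the places on the boundary of the disk. -/
def Leaves (j : ℕ) (d : D) : Prop := G.Crosses lev (j + 1) d ∨ G.Crosses lev j (G.opp d)

open Classical in
/-- The next dart, counterclockwise, in the same component of the disk of the level `j + 1`. -/
noncomputable def turn (j : ℕ) (d : D) : D := if lev d = j + 1 then G.rot d else G.opp d

variable {G lev}

theorem IsLevel.leaves_turn (hl : G.IsLevel lev) {j : ℕ} {d : D} (h : G.Leaves lev j d) :
    G.Leaves lev j (G.turn lev j d) := by
  unfold Leaves Crosses turn at *
  have h1 := hl.ne d
  have h2 := hl.ne (G.rot d)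
  have h3 := hl.rot d
  have h4 := G.opp_opp d
  have h5 := G.opp_opp (G.rot d)
  split_ifs with h0 <;> simp only [h4, h5] at * <;> omega

theorem IsLevel.turn_injective (hl : G.IsLevel lev) {j : ℕ} {d e : D} (hd : G.Leaves lev j d)
    (he : G.Leaves lev j e) (h : G.turn lev j d = G.turn lev j e) : d = e := by
  unfold Leaves Crosses turn at *
  have h3 := hl.rot d
  have h4 := G.opp_opp d
  have h5 := G.opp_opp e
  have h6 := hl.rot e
  simp only [h4, h5] at *
  split_ifs at h with h0 h1 h1
  · exact G.rot.injective h
  · have := congrArg lev h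
    omega
  · have := congrArg lev h
    omega
  · exact G.opp.injective h

/-- `turn` as a permutation of the places on the boundary of the disk. -/
noncomputable def IsLevel.turnPerm [Finite D] (hl : G.IsLevel lev) (j : ℕ) :
    Equiv.Perm {d : D // G.Leaves lev j d} :=
  Equiv.ofBijective (fun d => ⟨G.turn lev j d, hl.leaves_turn d.2⟩)
    (Finite.injective_iff_bijective.1 fun d e h =>
      Subtype.ext (hl.turn_injective d.2 e.2 (congrArg Subtype.val h)))

@[simp]
theorem IsLevel.turnPerm_apply [Finite D] (hl : G.IsLevel lev) (j : ℕ)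
    (d : {d : D // G.Leaves lev j d}) : (hl.turnPerm j d : D) = G.turn lev j d := rfl

theorem face_opp_turn (j : ℕ) (d : D) : G.face (G.opp (G.turn lev j d)) = G.face d := by
  unfold turn
  split_ifs
  · rw [← G.face_faceNext]
    congr 1
    simp [faceNext, G.opp_opp]
  · rw [G.opp_opp]

theorem IsLevel.leaves_of_level_eq (hl : G.IsLevel lev) {j : ℕ} {d : D} (h : lev d = j + 1) :
    G.Leaves lev j d := by
  have h1 := hl.ne d
  have h4 := G.opp_opp d
  unfold Leaves Crosses
  rw [h4]
  omega

/-- A quantity that is defined for each edge over each interval, and which agrees for the places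
on the boundary of a disk that belong to the same component, is the same everywhere. -/
theorem eq_of_turn_eq (hG : G.Connected) (hl : G.IsLevel lev) (hpos : ∀ d, 0 < lev d)
    {α : Type*} (val : ℕ → D → α) (pval : ℕ → D → α)
    (hright : ∀ j d, G.Crosses lev (j + 1) d → pval j d = val (j + 1) d)
    (hleft : ∀ j d, G.Crosses lev j (G.opp d) → pval j d = val j (G.opp d))
    (h : ∀ j d, G.Leaves lev j d → pval j (G.turn lev j d) = pval j d)
    {i i' : ℕ} {d d' : D} (hd : G.Crosses lev i d) (hd' : G.Crosses lev i' d') :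
    val i d = val i' d' := by
  have hopp := G.opp_opp
  have key : ∀ d k, G.Crosses lev (lev d + k) d → val (lev d + k) d = val (lev d) d := by
    intro d k hk
    induction k with
    | zero => rfl
    | succ k ih =>
      have hk' : G.Crosses lev (lev d + k) d := ⟨by omega, by have := hk.2; omega⟩
      have hr : pval (lev d + k) d = val (lev d + (k + 1)) d := hright (lev d + k) d hk
      have ht := h (lev d + k) d (Or.inl hk)
      rw [turn, if_neg (by omega), hleft _ _ (by rwa [hopp]), hopp] at ht
      rw [← ih hk', ← hr, ht]
  have key' : ∀ i d, G.Crosses lev i d → val i d = val (lev d) d := by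
    intro i d hi
    obtain ⟨k, rfl⟩ := Nat.exists_eq_add_of_le hi.1
    exact key d k hi
  have hR : ∀ d, lev d < lev (G.opp d) → pval (lev d - 1) d = val (lev d) d := by
    intro d hlt
    have h0 := hpos d
    rw [hright _ _ ⟨by omega, by omega⟩]
    congr 1
    omega
  have hL : ∀ d, lev (G.opp d) < lev d → pval (lev d - 1) d = val (lev (G.opp d)) (G.opp d) := by
    intro d hlt
    have hc : G.Crosses lev (lev d - 1) (G.opp d) := ⟨by omega, by rw [hopp]; omega⟩
    rw [hleft _ _ hc, key' _ _ hc]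
  have all : ∀ d d', pval (lev d - 1) d = pval (lev d' - 1) d' := by
    refine eq_of_jointlyTransitive (g := fun d => pval (lev d - 1) d) hG ?_ ?_
    · intro d
      have h0 := hpos d
      have h1 : lev d = (lev d - 1) + 1 := by omega
      have := h (lev d - 1) d (hl.leaves_of_level_eq h1)
      rw [turn, if_pos h1] at this
      rw [hl.rot, this]
    · intro d
      rcases lt_or_gt_of_ne (hl.ne d) with hlt | hlt
      · rw [hL d hlt, hR _ (by rwa [hopp])]
      · rw [hR d hlt, hL _ (by rwa [hopp]), hopp]
  rw [key' _ _ hd, key' _ _ hd', ← hR d (lt_of_le_of_lt hd.1 hd.2),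
    ← hR d' (lt_of_le_of_lt hd'.1 hd'.2)]
  exact all _ _

open Classical in
/-- The position of a place on the boundary of the disk of the level `j + 1`, where the edges over
each interval are ordered by `height`: the right side from bottom to top, then the left side from
top to bottom. The first coordinates `1` and `2` stay free for the ends of a line above all
edges. -/
noncomputable def rimPos (G : EmbeddedGraph D) (lev : D → ℕ) (height : ℕ → D → ℤ) (j : ℕ) (d : D) :
    ℤ ×ₗ ℤ :=
  if G.Crosses lev (j + 1) d then toLex (0, height (j + 1) d) else toLex (3, -height j (G.opp d))

variable {height : ℕ → D → ℤ}

theorem rimPos_right {j : ℕ} {d : D} (h : G.Crosses lev (j + 1) d) :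
    G.rimPos lev height j d = toLex (0, height (j + 1) d) := if_pos h

theorem not_crosses_of_crosses_opp {i j : ℕ} {d : D} (h : G.Crosses lev j (G.opp d)) :
    ¬ G.Crosses lev i d := by
  unfold Crosses at *
  rw [G.opp_opp] at h
  omega

theorem rimPos_left {j : ℕ} {d : D} (h : G.Crosses lev j (G.opp d)) :
    G.rimPos lev height j d = toLex (3, -height j (G.opp d)) :=
  if_neg (not_crosses_of_crosses_opp h)

theorem rimPos_injective
    (hinj : ∀ i a b, G.Crosses lev i a → G.Crosses lev i b → height i a = height i b → a = b)
    {j : ℕ} {a b : D} (ha : G.Leaves lev j a) (hb : G.Leaves lev j b)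
    (h : G.rimPos lev height j a = G.rimPos lev height j b) : a = b := by
  rcases ha with ha | ha <;> rcases hb with hb | hb
  · rw [rimPos_right ha, rimPos_right hb] at h
    simp at h
    exact hinj _ _ _ ha hb h
  · rw [rimPos_right ha, rimPos_left hb] at h
    simp at h
  · rw [rimPos_left ha, rimPos_right hb] at h
    simp at h
  · rw [rimPos_left ha, rimPos_left hb] at h
    simp at h
    exact G.opp.injective (hinj _ _ _ ha hb h)

end EmbeddedGraph

open EmbeddedGraph

/-- A flat folding with the levels of the vertices given, where the orders of the magnified views
are recorded by integer heights. The condition `noncrossing` says that the places between a place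
`d` and the next place `turn d` of its component, when the latter comes later on the rim, form a
union of components. -/
structure Layering {D : Type*} (G : FoldingInput D) (lev : D → ℕ) where
  isLevel : G.IsLevel lev
  pos : ∀ d, 0 < lev d
  height : ℕ → D → ℤ
  height_inj : ∀ i a b, G.Crosses lev i a → G.Crosses lev i b → height i a = height i b → a = b
  noncrossing : ∀ j d y, G.Leaves lev j d → G.Leaves lev j y →
    G.rimPos lev height j d < G.rimPos lev height j y →
    G.rimPos lev height j y < G.rimPos lev height j (G.turn lev j d) →
    G.rimPos lev height j d < G.rimPos lev height j (G.turn lev j y) ∧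
      G.rimPos lev height j (G.turn lev j y) < G.rimPos lev height j (G.turn lev j d)
  flat_iff : ∀ d, G.angle d = .flat ↔
    ¬ (lev d < lev (G.opp d) ↔ lev (G.rot d) < lev (G.opp (G.rot d)))
  valley_iff : ∀ j d, lev d = j + 1 →
    (lev d < lev (G.opp d) ↔ lev (G.rot d) < lev (G.opp (G.rot d))) →
    (G.angle d = .valley ↔ G.rimPos lev height j d < G.rimPos lev height j (G.rot d))
  outer_bottom : ∀ i d, G.Crosses lev i d → (∀ e, G.Crosses lev i e → height i d ≤ height i e) →
    G.face (G.opp d) = G.outer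
  outer_top : ∀ i d, G.Crosses lev i d → (∀ e, G.Crosses lev i e → height i e ≤ height i d) →
    G.face d = G.outer

namespace Layering

variable {D : Type*} {G : FoldingInput D} {lev : D → ℕ} (L : Layering G lev)

/-- The edge of `b` is the next one above the edge of `a` over the interval `i`. -/
def Consecutive (i : ℕ) (a b : D) : Prop :=
  G.Crosses lev i a ∧ G.Crosses lev i b ∧ L.height i a < L.height i b ∧
    ∀ e, G.Crosses lev i e → L.height i a < L.height i e → L.height i b ≤ L.height i e

/-- The touching pairs, as in a flat folding. -/
def Touching (a b : D) : Prop :=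
  ∃ i, L.Consecutive i a (G.opp b) ∨ L.Consecutive i b (G.opp a)

theorem rimPos_injective {j : ℕ} {a b : D} (ha : G.Leaves lev j a) (hb : G.Leaves lev j b)
    (h : G.rimPos lev L.height j a = G.rimPos lev L.height j b) : a = b :=
  EmbeddedGraph.rimPos_injective L.height_inj ha hb h

theorem rimPos_injective' (j : ℕ) : Function.Injective
    fun d : {d : D // G.Leaves lev j d} => G.rimPos lev L.height j d :=
  fun a b h => Subtype.ext (L.rimPos_injective a.2 b.2 h)

theorem noncrossing' [Finite D] (j : ℕ) (d y : {d : D // G.Leaves lev j d}) :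
    G.rimPos lev L.height j d < G.rimPos lev L.height j y →
    G.rimPos lev L.height j y < G.rimPos lev L.height j (L.isLevel.turnPerm j d) →
    G.rimPos lev L.height j d < G.rimPos lev L.height j (L.isLevel.turnPerm j y) ∧
      G.rimPos lev L.height j (L.isLevel.turnPerm j y) <
        G.rimPos lev L.height j (L.isLevel.turnPerm j d) :=
  L.noncrossing j d y d.2 y.2

open Classical in
/-- The change of a function of the faces across the edges sums to zero over every union of
components of a disk. -/
theorem sum_sub_eq_zero (L : Layering G lev) (u : G.Face → ℤ) (j : ℕ) (S : Finset D)
    (hS : ∀ d ∈ S, G.Leaves lev j d)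
    (hturn : ∀ d ∈ S, G.turn lev j d ∈ S) :
    ∑ d ∈ S, (u (G.face d) - u (G.face (G.opp d))) = 0 := by
  have hinj : Set.InjOn (G.turn lev j) S := fun d hd e he h =>
    L.isLevel.turn_injective (hS d hd) (hS e he) h
  have h1 : ∑ d ∈ S, (u (G.face d) - u (G.face (G.opp d))) =
      ∑ d ∈ S, (u (G.face (G.turn lev j d)) - u (G.face d)) := by
    symm
    refine Finset.sum_nbij (G.turn lev j) hturn hinj
      (Finset.surjOn_of_injOn_of_card_le _ hturn hinj le_rfl) fun d _ => ?_
    rw [G.face_opp_turn]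
  have h2 : ∑ d ∈ S, u (G.face (G.turn lev j d)) = ∑ d ∈ S, u (G.face d) :=
    Finset.sum_nbij (G.turn lev j) hturn hinj
      (Finset.surjOn_of_injOn_of_card_le _ hturn hinj le_rfl) fun d _ => rfl
  rw [h1, Finset.sum_sub_distrib, h2, sub_self]

variable [Fintype D]

open Classical in
/-- The sum of the changes of `u` up to the edge `a` gives the value of `u` above `a` if all
magnified views are drawn consistently with the faces; this is the difference of the two. -/
noncomputable def defect (u : G.Face → ℤ) (i : ℕ) (a : D) : ℤ :=
  u G.outer + ∑ e with G.Crosses lev i e ∧ L.height i e ≤ L.height i a,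
    (u (G.face e) - u (G.face (G.opp e))) - u (G.face a)

open Classical in
/-- The defect at a place on the boundary of a disk. -/
noncomputable def rimDefect (u : G.Face → ℤ) (j : ℕ) (a : D) : ℤ :=
  u G.outer + ∑ e with G.Leaves lev j e ∧ G.rimPos lev L.height j e ≤ G.rimPos lev L.height j a,
    (u (G.face e) - u (G.face (G.opp e))) - u (G.face a)

theorem rimDefect_right (u : G.Face → ℤ) {j : ℕ} {a : D} (ha : G.Crosses lev (j + 1) a) :
    L.rimDefect u j a = L.defect u (j + 1) a := by
  classical
  unfold rimDefect defect
  congr 2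
  refine Finset.sum_congr (Finset.filter_congr fun e _ => ?_) fun _ _ => rfl
  rw [rimPos_right ha]
  constructor
  · rintro ⟨he | he, hle⟩
    · rw [rimPos_right he] at hle
      exact ⟨he, by simpa [Prod.Lex.toLex_le_toLex] using hle⟩
    · rw [rimPos_left he] at hle
      simp [Prod.Lex.toLex_le_toLex] at hle
  · rintro ⟨he, hle⟩
    refine ⟨Or.inl he, ?_⟩
    rw [rimPos_right he]
    simpa [Prod.Lex.toLex_le_toLex] using hle

theorem rimDefect_left (u : G.Face → ℤ) {j : ℕ} {a : D} (ha : G.Crosses lev j (G.opp a)) :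
    L.rimDefect u j a = L.defect u j (G.opp a) := by
  classical
  unfold rimDefect defect
  set c : D → ℤ := fun e => u (G.face e) - u (G.face (G.opp e)) with hc
  have htot : ∑ e with G.Leaves lev j e, c e = 0 :=
    L.sum_sub_eq_zero u j _ (fun d hd => (Finset.mem_filter.1 hd).2) fun d hd => by
      simp only [Finset.mem_filter, Finset.mem_univ, true_and] at hd ⊢
      exact L.isLevel.leaves_turn hd
  have hsplit := Finset.sum_filter_add_sum_filter_not (Finset.univ.filter (G.Leaves lev j))
    (fun e => G.rimPos lev L.height j e ≤ G.rimPos lev L.height j a) c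
  rw [Finset.filter_filter, Finset.filter_filter, htot] at hsplit
  have hrest : ∑ e with G.Leaves lev j e ∧
      ¬ G.rimPos lev L.height j e ≤ G.rimPos lev L.height j a, c e =
      - ∑ e with G.Crosses lev j e ∧ L.height j e < L.height j (G.opp a), c e := by
    rw [← Finset.sum_neg_distrib]
    refine Finset.sum_nbij' G.opp G.opp ?_ ?_ (fun _ _ => G.opp_opp _) (fun _ _ => G.opp_opp _) ?_
    · intro e he
      simp only [Finset.mem_filter, Finset.mem_univ, true_and, not_le] at he ⊢
      rw [rimPos_left ha] at he
      obtain ⟨he | he, hlt⟩ := he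
      · rw [rimPos_right he] at hlt
        simp [Prod.Lex.toLex_lt_toLex] at hlt
      · rw [rimPos_left he] at hlt
        exact ⟨he, by simpa [Prod.Lex.toLex_lt_toLex] using hlt⟩
    · intro e he
      simp only [Finset.mem_filter, Finset.mem_univ, true_and, not_le] at he ⊢
      have he' : G.Crosses lev j (G.opp (G.opp e)) := by rw [G.opp_opp]; exact he.1
      refine ⟨Or.inr he', ?_⟩
      rw [rimPos_left ha, rimPos_left he', G.opp_opp]
      simpa [Prod.Lex.toLex_lt_toLex] using he.2
    · intro e _
      simp [hc, G.opp_opp]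
  have hle : ∑ e with G.Crosses lev j e ∧ L.height j e ≤ L.height j (G.opp a), c e =
      ∑ e with G.Crosses lev j e ∧ L.height j e < L.height j (G.opp a), c e + c (G.opp a) := by
    have : (Finset.univ.filter fun e => G.Crosses lev j e ∧ L.height j e ≤ L.height j (G.opp a)) =
        insert (G.opp a) (Finset.univ.filter fun e =>
          G.Crosses lev j e ∧ L.height j e < L.height j (G.opp a)) := by
      ext e
      simp only [Finset.mem_filter, Finset.mem_univ, true_and, Finset.mem_insert]
      constructor
      · rintro ⟨he, hle⟩
        rcases hle.lt_or_eq with hlt | heq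
        · exact Or.inr ⟨he, hlt⟩
        · exact Or.inl (L.height_inj _ _ _ he ha heq)
      · rintro (rfl | ⟨he, hlt⟩)
        · exact ⟨ha, le_rfl⟩
        · exact ⟨he, hlt.le⟩
    rw [this, Finset.sum_insert (by simp)]
    ring
  rw [hle]
  have hca : c (G.opp a) = u (G.face (G.opp a)) - u (G.face a) := by simp [hc, G.opp_opp]
  linarith

theorem rimDefect_turn (u : G.Face → ℤ) {j : ℕ} {a : D} (ha : G.Leaves lev j a) :
    L.rimDefect u j (G.turn lev j a) = L.rimDefect u j a := by
  classical
  unfold rimDefect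
  set c : D → ℤ := fun e => u (G.face e) - u (G.face (G.opp e)) with hc
  set p := G.rimPos lev L.height j with hp
  set b := G.turn lev j a with hb
  have hbl : G.Leaves lev j b := L.isLevel.leaves_turn ha
  have hcb : c b = u (G.face b) - u (G.face a) := by simp only [c, b, G.face_opp_turn]
  let a' : {d : D // G.Leaves lev j d} := ⟨a, ha⟩
  rcases lt_or_ge (p a) (p b) with hlt | hge
  · have h0 : ∑ e with G.Leaves lev j e ∧ p a < p e ∧ p e < p b, c e = 0 := by
      refine L.sum_sub_eq_zero u j _ (fun d hd => (Finset.mem_filter.1 hd).2.1) fun d hd => ?_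
      simp only [Finset.mem_filter, Finset.mem_univ, true_and] at hd ⊢
      exact ⟨L.isLevel.leaves_turn hd.1, L.noncrossing j a d ha hd.1 hd.2.1 hd.2.2⟩
    have hset : (Finset.univ.filter fun e => G.Leaves lev j e ∧ p e ≤ p b) =
        insert b ((Finset.univ.filter fun e => G.Leaves lev j e ∧ p e ≤ p a) ∪
          (Finset.univ.filter fun e => G.Leaves lev j e ∧ p a < p e ∧ p e < p b)) := by
      ext e
      simp only [Finset.mem_filter, Finset.mem_univ, true_and, Finset.mem_insert, Finset.mem_union]
      constructor
      · rintro ⟨he, hle⟩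
        rcases hle.lt_or_eq with h1 | h1
        · rcases le_or_gt (p e) (p a) with h2 | h2
          · exact Or.inr (Or.inl ⟨he, h2⟩)
          · exact Or.inr (Or.inr ⟨he, h2, h1⟩)
        · exact Or.inl (L.rimPos_injective he hbl h1)
      · rintro (rfl | ⟨he, h1⟩ | ⟨he, h1, h2⟩)
        · exact ⟨hbl, le_rfl⟩
        · exact ⟨he, h1.trans hlt.le⟩
        · exact ⟨he, h2.le⟩
    rw [hset, Finset.sum_insert, Finset.sum_union, h0]
    · change u G.outer + (c b + (_ + 0)) - _ = _
      rw [hcb]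
      ring
    · rw [Finset.disjoint_filter]
      rintro e - ⟨-, h1⟩ ⟨-, h2, -⟩
      exact absurd h1 (not_le.2 h2)
    · simp only [Finset.mem_filter, Finset.mem_univ, true_and, Finset.mem_union, not_or, not_and]
      exact ⟨fun _ => not_le.2 hlt, fun _ _ => lt_irrefl _⟩
  · have h0 : ∑ e with G.Leaves lev j e ∧ p b ≤ p e ∧ p e ≤ p a, c e = 0 := by
      refine L.sum_sub_eq_zero u j _ (fun d hd => (Finset.mem_filter.1 hd).2.1) fun d hd => ?_
      simp only [Finset.mem_filter, Finset.mem_univ, true_and] at hd ⊢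
      exact ⟨L.isLevel.leaves_turn hd.1, noncrossing_back (L.noncrossing' j)
        (L.rimPos_injective' j) (x := a') (y := ⟨d, hd.1⟩) hge hd.2.1 hd.2.2⟩
    have hset : insert b (Finset.univ.filter fun e => G.Leaves lev j e ∧ p e ≤ p a) =
        (Finset.univ.filter fun e => G.Leaves lev j e ∧ p e < p b) ∪
          (Finset.univ.filter fun e => G.Leaves lev j e ∧ p b ≤ p e ∧ p e ≤ p a) := by
      ext e
      simp only [Finset.mem_filter, Finset.mem_univ, true_and, Finset.mem_insert, Finset.mem_union]
      constructor
      · rintro (rfl | ⟨he, hle⟩)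
        · exact Or.inr ⟨hbl, le_rfl, hge⟩
        rcases lt_or_ge (p e) (p b) with h1 | h1
        · exact Or.inl ⟨he, h1⟩
        · exact Or.inr ⟨he, h1, hle⟩
      · rintro (⟨he, h1⟩ | ⟨he, h1, h2⟩)
        · exact Or.inr ⟨he, h1.le.trans hge⟩
        · exact Or.inr ⟨he, h2⟩
    rw [Finset.insert_eq_of_mem (by simp [hbl, hge])] at hset
    have hset' : (Finset.univ.filter fun e => G.Leaves lev j e ∧ p e ≤ p b) =
        insert b (Finset.univ.filter fun e => G.Leaves lev j e ∧ p e < p b) := by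
      ext e
      simp only [Finset.mem_filter, Finset.mem_univ, true_and, Finset.mem_insert]
      constructor
      · rintro ⟨he, hle⟩
        rcases hle.lt_or_eq with h1 | h1
        · exact Or.inr ⟨he, h1⟩
        · exact Or.inl (L.rimPos_injective he hbl h1)
      · rintro (rfl | ⟨he, h1⟩)
        · exact ⟨hbl, le_rfl⟩
        · exact ⟨he, h1.le⟩
    rw [hset, hset', Finset.sum_insert (by simp), Finset.sum_union, h0]
    · change u G.outer + (c b + _) - _ = _
      rw [hcb]
      ring
    · rw [Finset.disjoint_filter]
      rintro e - ⟨-, h1⟩ ⟨-, h2, -⟩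
      exact absurd h1 (not_lt.2 h2)

theorem exists_bottom {i : ℕ} {d : D} (hd : G.Crosses lev i d) :
    ∃ a, G.Crosses lev i a ∧ ∀ e, G.Crosses lev i e → L.height i a ≤ L.height i e := by
  classical
  obtain ⟨a, ha, hmin⟩ := Finset.exists_min_image (Finset.univ.filter (G.Crosses lev i))
    (L.height i) ⟨d, by simpa using hd⟩
  exact ⟨a, by simpa using ha, fun e he => hmin e (by simpa using he)⟩

theorem defect_eq_zero (hG : G.Connected) (u : G.Face → ℤ) {i : ℕ} {d : D}
    (hd : G.Crosses lev i d) : L.defect u i d = 0 := by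
  classical
  obtain ⟨a, ha, hmin⟩ := L.exists_bottom hd
  rw [EmbeddedGraph.eq_of_turn_eq hG L.isLevel L.pos (L.defect u) (L.rimDefect u)
    (fun _ _ => L.rimDefect_right u) (fun _ _ => L.rimDefect_left u)
    (fun _ _ => L.rimDefect_turn u) hd ha]
  have : (Finset.univ.filter fun e => G.Crosses lev i e ∧ L.height i e ≤ L.height i a) = {a} := by
    ext e
    simp only [Finset.mem_filter, Finset.mem_univ, true_and, Finset.mem_singleton]
    constructor
    · rintro ⟨he, hle⟩
      exact L.height_inj _ _ _ he ha (le_antisymm hle (hmin e he))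
    · rintro rfl
      exact ⟨ha, le_rfl⟩
  rw [defect, this, Finset.sum_singleton, L.outer_bottom i a ha hmin]
  ring

/-- The two sides that face each other in a magnified view belong to the same face. -/
theorem Consecutive.face_eq (hG : G.Connected) {L : Layering G lev} {i : ℕ} {a b : D}
    (h : L.Consecutive i a b) : G.face a = G.face (G.opp b) := by
  classical
  obtain ⟨ha, hb, hlt, hnext⟩ := h
  let u : G.Face → ℤ := fun f => if f = G.face a then 1 else 0
  have h1 := L.defect_eq_zero hG u ha
  have h2 := L.defect_eq_zero hG u hb
  have hset : (Finset.univ.filter fun e => G.Crosses lev i e ∧ L.height i e ≤ L.height i b) =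
      insert b (Finset.univ.filter fun e => G.Crosses lev i e ∧ L.height i e ≤ L.height i a) := by
    ext e
    simp only [Finset.mem_filter, Finset.mem_univ, true_and, Finset.mem_insert]
    constructor
    · rintro ⟨he, hle⟩
      rcases le_or_gt (L.height i e) (L.height i a) with h3 | h3
      · exact Or.inr ⟨he, h3⟩
      · exact Or.inl (L.height_inj _ _ _ he hb (le_antisymm hle (hnext e he h3)))
    · rintro (rfl | ⟨he, h3⟩)
      · exact ⟨hb, le_rfl⟩
      · exact ⟨he, h3.trans hlt.le⟩
  unfold defect at h1 h2
  rw [hset, Finset.sum_insert (by simp [not_le.2 hlt])] at h2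
  have h3 : u (G.face (G.opp b)) = u (G.face a) := by linarith
  by_contra hne
  simp [u, Ne.symm hne] at h3

end Layering


/-! ### Sorted lists -/

section SortedLists

variable {α A : Type*} [LinearOrder A] {p : α → A}

theorem sublist_of_sorted {l l' : List α} (h' : l'.Pairwise (p · < p ·))
    (h : l.Pairwise (p · < p ·)) (hsub : l' ⊆ l) : l'.Sublist l := by
  have hanti : Std.Antisymm (fun a b : α => p a < p b) :=
    ⟨fun a b hab hba => absurd hab hba.asymm⟩
  refine List.sublist_of_subperm_of_pairwise (r := fun a b => p a < p b)
    (List.subperm_of_subset ?_ hsub) h' h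
  exact h'.imp fun hab => fun h => absurd (h ▸ hab) (lt_irrefl _)

theorem pair_sublist_iff {l : List α} (h : l.Pairwise (p · < p ·)) {a b : α} :
    List.Sublist [a, b] l ↔ a ∈ l ∧ b ∈ l ∧ p a < p b := by
  constructor
  · intro hs
    exact ⟨hs.subset (by simp), hs.subset (by simp), by simpa using h.sublist hs⟩
  · rintro ⟨ha, hb, hab⟩
    exact sublist_of_sorted (by simpa using hab) h (by simp [ha, hb])

theorem pair_infix_iff {l : List α} (h : l.Pairwise (p · < p ·)) {a b : α} :
    List.IsInfix [a, b] l ↔ a ∈ l ∧ b ∈ l ∧ p a < p b ∧ ∀ e ∈ l, p a < p e → p b ≤ p e := by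
  constructor
  · rintro ⟨s, t, rfl⟩
    simp only [List.append_assoc, List.cons_append, List.nil_append, List.pairwise_append,
      List.pairwise_cons, List.mem_cons] at h
    obtain ⟨-, ⟨hab, hb, -⟩, hs⟩ := h
    refine ⟨by simp, by simp, hab b (Or.inl rfl), fun e he hae => ?_⟩
    simp only [List.append_assoc, List.cons_append, List.nil_append, List.mem_append,
      List.mem_cons] at he
    rcases he with he | rfl | rfl | he
    · exact absurd hae (hs e he a (Or.inl rfl)).asymm
    · exact absurd hae (lt_irrefl _)
    · exact le_rfl
    · exact (hb e he).le
  · rintro ⟨ha, hb, hab, hnext⟩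
    obtain ⟨s, t, rfl⟩ := List.append_of_mem ha
    simp only [List.pairwise_append, List.pairwise_cons, List.mem_cons, List.mem_append]
      at h hb hnext
    obtain ⟨-, ⟨hat, ht⟩, hs⟩ := h
    rcases hb with hb | rfl | hb
    · exact absurd hab (hs b hb a (Or.inl rfl)).asymm
    · exact absurd hab (lt_irrefl _)
    cases t with
    | nil => simp at hb
    | cons c t =>
      rcases List.mem_cons.1 hb with rfl | hb
      · exact ⟨s, t, by simp⟩
      · rw [List.pairwise_cons] at ht
        exact absurd (ht.1 b hb) (not_lt.2 (hnext c (by simp) (hat c (by simp))))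

theorem exists_sorted (S : Finset α) (hinj : ∀ a ∈ S, ∀ b ∈ S, p a = p b → a = b) :
    ∃ l : List α, (∀ a, a ∈ l ↔ a ∈ S) ∧ l.Pairwise (p · < p ·) := by
  classical
  have htot : Std.Total (fun a b : α => p a ≤ p b) := ⟨fun a b => le_total _ _⟩
  have htr : IsTrans α (fun a b : α => p a ≤ p b) := ⟨fun a b c => le_trans⟩
  have hperm := List.perm_insertionSort (fun a b : α => p a ≤ p b) S.toList
  have hs := List.pairwise_insertionSort (fun a b : α => p a ≤ p b) S.toList
  set l := S.toList.insertionSort (fun a b : α => p a ≤ p b)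
  have hmem : ∀ a, a ∈ l ↔ a ∈ S := fun a => by rw [hperm.mem_iff, Finset.mem_toList]
  refine ⟨l, hmem, ?_⟩
  have hnd : l.Nodup := hperm.nodup_iff.2 S.nodup_toList
  refine (hs.and hnd).imp_of_mem fun {a b} ha hb hab => lt_of_le_of_ne hab.1 fun h => ?_
  exact hab.2 (hinj a ((hmem a).1 ha) b ((hmem b).1 hb) h)

theorem pairwise_idxOf [DecidableEq α] {l : List α} (h : l.Nodup) :
    l.Pairwise (fun a b => (l.idxOf a : ℤ) < l.idxOf b) := by
  rw [List.pairwise_iff_getElem]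
  intro i j hi hj hij
  rw [h.idxOf_getElem, h.idxOf_getElem]
  exact_mod_cast hij

end SortedLists

/-! ### Flat foldings as layerings -/

/-- The heights and the magnified views describe the same orders; the levels of the configuration
are shifted by `m + 1`. -/
structure LineConfiguration.Encodes {D : Type*} {G : FoldingInput D} (F : LineConfiguration G)
    (lev : D → ℕ) (height : ℕ → D → ℤ) (m : ℕ) : Prop where
  lev_eq : ∀ d, lev d = F.level d + m + 1
  sorted : ∀ i, (F.view i).Pairwise fun a b => height (i + m + 1) a < height (i + m + 1) b

namespace LineConfiguration

variable {D : Type*} {G : FoldingInput D} {F : LineConfiguration G} {lev : D → ℕ}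
  {height : ℕ → D → ℤ} {m : ℕ}

theorem level_opp_ne (F : LineConfiguration G) (d : D) : F.level (G.opp d) ≠ F.level d := by
  intro h
  have := F.length_eq d
  rw [h, sub_self, abs_zero] at this
  exact absurd (G.length_pos d) (by rw [← this]; exact lt_irrefl _)

namespace Encodes

variable (h : F.Encodes lev height m)

include h

theorem isLevel : G.IsLevel lev where
  rot d := by rw [h.lev_eq, h.lev_eq, F.level_rot]
  ne d := by
    rw [h.lev_eq, h.lev_eq]
    have := F.level_opp_ne d
    omega

theorem crosses_iff (i : ℕ) (d : D) : G.Crosses lev (i + m + 1) d ↔ d ∈ F.view i := by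
  rw [F.mem_view, EmbeddedGraph.Crosses, h.lev_eq, h.lev_eq]
  omega

theorem not_crosses {i : ℕ} (hi : i ≤ m) (d : D) : ¬ G.Crosses lev i d := by
  rw [EmbeddedGraph.Crosses, h.lev_eq, h.lev_eq]
  omega

theorem mem_rim (j : ℕ) (d : D) : d ∈ F.rim j ↔ G.Leaves lev (j + m) d := by
  cases j with
  | zero =>
    rw [EmbeddedGraph.Leaves, or_iff_left (h.not_crosses (by omega) _), rim, ← h.crosses_iff]
  | succ j =>
    rw [rim, EmbeddedGraph.Leaves, List.mem_append, List.mem_map, ← h.crosses_iff,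
      show j + 1 + m = j + m + 1 by omega, h.crosses_iff j]
    refine or_congr Iff.rfl ⟨?_, fun hd => ⟨_, by simpa using hd, G.opp_opp d⟩⟩
    rintro ⟨e, he, rfl⟩
    simpa [G.opp_opp] using he

theorem rim_sorted (j : ℕ) :
    (F.rim j).Pairwise fun a b =>
      G.rimPos lev height (j + m) a < G.rimPos lev height (j + m) b := by
  have hR : (F.view j).Pairwise fun a b =>
      G.rimPos lev height (j + m) a < G.rimPos lev height (j + m) b := by
    refine (h.sorted j).imp_of_mem fun {a b} ha hb hab => ?_
    rw [← h.crosses_iff] at ha hb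
    rw [EmbeddedGraph.rimPos_right ha, EmbeddedGraph.rimPos_right hb, Prod.Lex.toLex_lt_toLex]
    exact Or.inr ⟨rfl, hab⟩
  cases j with
  | zero => exact hR
  | succ j =>
    have hleft : ∀ e ∈ F.view j, G.Crosses lev (j + 1 + m) (G.opp (G.opp e)) := by
      intro e he
      rw [G.opp_opp, show j + 1 + m = j + m + 1 by omega, h.crosses_iff]
      exact he
    rw [rim, List.pairwise_append, List.pairwise_map, List.pairwise_reverse]
    refine ⟨hR, (h.sorted j).imp_of_mem fun {a b} ha hb hab => ?_, fun a ha b hb => ?_⟩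
    · rw [EmbeddedGraph.rimPos_left (hleft a ha), EmbeddedGraph.rimPos_left (hleft b hb),
        Prod.Lex.toLex_lt_toLex, G.opp_opp, G.opp_opp]
      refine Or.inr ⟨rfl, ?_⟩
      rw [show j + 1 + m = j + m + 1 by omega]
      simpa using hab
    · obtain ⟨e, he, rfl⟩ := List.mem_map.1 hb
      rw [← h.crosses_iff] at ha
      rw [EmbeddedGraph.rimPos_right ha,
        EmbeddedGraph.rimPos_left (hleft e (List.mem_reverse.1 he)), Prod.Lex.toLex_lt_toLex]
      exact Or.inl (by norm_num)

theorem infix_iff (i : ℕ) (a b : D) : List.IsInfix [a, b] (F.view i) ↔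
    G.Crosses lev (i + m + 1) a ∧ G.Crosses lev (i + m + 1) b ∧
      height (i + m + 1) a < height (i + m + 1) b ∧ ∀ e, G.Crosses lev (i + m + 1) e →
        height (i + m + 1) a < height (i + m + 1) e →
          height (i + m + 1) b ≤ height (i + m + 1) e := by
  rw [pair_infix_iff (h.sorted i)]
  simp only [h.crosses_iff]

theorem head_iff (i : ℕ) (d : D) : d ∈ (F.view i).head? ↔ G.Crosses lev (i + m + 1) d ∧
    ∀ e, G.Crosses lev (i + m + 1) e → height (i + m + 1) d ≤ height (i + m + 1) e := by
  simp only [h.crosses_iff]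
  have hs := h.sorted i
  cases hl : F.view i with
  | nil => simp
  | cons a l =>
    rw [hl, List.pairwise_cons] at hs
    simp only [List.head?_cons, Option.mem_def, Option.some.injEq, List.mem_cons]
    constructor
    · rintro rfl
      refine ⟨Or.inl rfl, ?_⟩
      rintro e (rfl | he)
      · exact le_rfl
      · exact (hs.1 e he).le
    · rintro ⟨rfl | hd, hmin⟩
      · rfl
      · exact absurd (hs.1 d hd) (not_lt.2 (hmin a (Or.inl rfl)))

theorem getLast_iff (i : ℕ) (d : D) : d ∈ (F.view i).getLast? ↔ G.Crosses lev (i + m + 1) d ∧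
    ∀ e, G.Crosses lev (i + m + 1) e → height (i + m + 1) e ≤ height (i + m + 1) d := by
  simp only [h.crosses_iff]
  have hs := h.sorted i
  rcases List.eq_nil_or_concat (F.view i) with hl | ⟨l, a, hl⟩
  · simp [hl]
  · rw [List.concat_eq_append] at hl
    rw [hl, List.pairwise_append] at hs
    have hs' : ∀ e ∈ l, height (i + m + 1) e < height (i + m + 1) a := by simpa using hs.2.2
    rw [hl]
    simp only [List.getLast?_append, List.getLast?_singleton, Option.some_or, Option.mem_def,
      Option.some.injEq, List.mem_append, List.mem_singleton]
    constructor
    · rintro rfl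
      refine ⟨Or.inr rfl, ?_⟩
      rintro e (he | rfl)
      · exact (hs' e he).le
      · exact le_rfl
    · rintro ⟨hd | rfl, hmax⟩
      · exact absurd (hs' d hd) (not_lt.2 (hmax a (Or.inr rfl)))
      · rfl

theorem joined_iff [Finite D] (j : ℕ) (a b : {d : D // G.Leaves lev (j + m) d}) :
    F.Joined j a b ↔ (h.isLevel.turnPerm (j + m)).SameCycle a b := by
  have hlev : ∀ d, F.level d = j ↔ lev d = j + m + 1 := fun d => by rw [h.lev_eq]; omega
  constructor
  · obtain ⟨a, ha⟩ := a
    rintro (⟨h1, h2⟩ | ⟨h1, h2⟩)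
    · obtain ⟨n, hn⟩ := Equiv.Perm.SameCycle.exists_nat_pow_eq (Quotient.exact h2)
      refine ⟨n, Subtype.ext ?_⟩
      rw [zpow_natCast, ← hn]
      clear h2 hn
      suffices h3 : (((h.isLevel.turnPerm (j + m)) ^ n) ⟨a, ha⟩ : D) = (G.rot ^ n) a ∧
          lev ((G.rot ^ n) a) = j + m + 1 from h3.1
      induction n with
      | zero => exact ⟨rfl, (hlev _).1 h1⟩
      | succ n ih =>
        rw [pow_succ', pow_succ', Equiv.Perm.mul_apply, Equiv.Perm.mul_apply,
          EmbeddedGraph.IsLevel.turnPerm_apply, ih.1, EmbeddedGraph.turn, if_pos ih.2]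
        exact ⟨rfl, by rw [h.isLevel.rot, ih.2]⟩
    · rcases h2 with h2 | h2
      · exact (Subtype.ext h2 : b = ⟨a, ha⟩) ▸ Equiv.Perm.SameCycle.refl _ _
      · have : b = h.isLevel.turnPerm (j + m) ⟨a, ha⟩ := by
          apply Subtype.ext
          rw [EmbeddedGraph.IsLevel.turnPerm_apply, EmbeddedGraph.turn, if_neg (by rwa [← hlev])]
          exact h2
        rw [this]
        exact Equiv.Perm.sameCycle_apply_right.2 (Equiv.Perm.SameCycle.refl _ _)
  · intro hab
    refine of_sameCycle (S := fun y : {d : D // G.Leaves lev (j + m) d} => F.Joined j a y)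
      (fun y hy => ?_) hab ?_
    · rcases hy with ⟨h1, h2⟩ | ⟨h1, h2⟩
      · have hy : F.level y = j := by
          have h3 := SameCycle.apply_eq F.level_rot (Quotient.exact h2)
          exact h3.symm.trans h1
        refine Or.inl ⟨h1, ?_⟩
        rw [EmbeddedGraph.IsLevel.turnPerm_apply, EmbeddedGraph.turn, if_pos (by rwa [← hlev]), h2]
        exact Quotient.sound (Equiv.Perm.sameCycle_apply_right.2 (Equiv.Perm.SameCycle.refl _ _))
      · have hy : lev y ≠ j + m + 1 := by
          have h3 := a.2
          have h4 := G.opp_opp a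
          have h5 := h.lev_eq a
          rcases h2 with h2 | h2 <;> rw [h2]
          · omega
          · unfold EmbeddedGraph.Leaves EmbeddedGraph.Crosses at h3
            rw [h4] at h3
            omega
        refine Or.inr ⟨h1, ?_⟩
        rw [EmbeddedGraph.IsLevel.turnPerm_apply, EmbeddedGraph.turn, if_neg hy]
        rcases h2 with h2 | h2
        · exact Or.inr (by rw [h2])
        · exact Or.inl (by rw [h2, G.opp_opp])
    · by_cases h1 : F.level a = j
      · exact Or.inl ⟨h1, rfl⟩
      · exact Or.inr ⟨h1, Or.inl rfl⟩

theorem goesRight_iff (d : D) : F.GoesRight d ↔ lev d < lev (G.opp d) := by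
  rw [GoesRight, h.lev_eq, h.lev_eq]
  omega

theorem height_inj (i : ℕ) (a b : D) (ha : G.Crosses lev i a) (hb : G.Crosses lev i b)
    (hab : height i a = height i b) : a = b := by
  rcases le_or_gt i m with hi | hi
  · exact absurd ha (h.not_crosses hi _)
  obtain ⟨k, rfl⟩ := Nat.exists_eq_add_of_le' hi
  rw [Nat.succ_eq_add_one, ← add_assoc] at *
  rw [h.crosses_iff] at ha hb
  by_contra hne
  rcases List.pairwise_iff_getElem.1 (h.sorted k), List.getElem_of_mem ha,
    List.getElem_of_mem hb with ⟨hs, ⟨x, hx, rfl⟩, ⟨y, hy, rfl⟩⟩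
  rcases lt_trichotomy x y with hxy | rfl | hxy
  · exact absurd hab (hs x y hx hy hxy).ne
  · exact hne rfl
  · exact absurd hab (hs y x hy hx hxy).ne'

theorem cornerAngle_eq (d : D) : F.cornerAngle d =
    open Classical in if lev d < lev (G.opp d) ↔ lev (G.rot d) < lev (G.opp (G.rot d)) then
      if G.rimPos lev height (F.level d + m) d < G.rimPos lev height (F.level d + m) (G.rot d)
        then .valley else .mountain
      else .flat := by
  classical
  have h1 : d ∈ F.rim (F.level d) := by
    rw [h.mem_rim]
    exact h.isLevel.leaves_of_level_eq (h.lev_eq d)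
  have h2 : G.rot d ∈ F.rim (F.level d) := by
    rw [h.mem_rim]
    exact h.isLevel.leaves_of_level_eq (by rw [h.isLevel.rot, h.lev_eq d])
  simp only [cornerAngle, h.goesRight_iff, pair_sublist_iff (h.rim_sorted _), h1, h2, true_and]

end Encodes

end LineConfiguration

namespace FlatFolding

variable {D : Type*} {G : FoldingInput D}

open Classical in
/-- The index of an edge in the magnified view of the edge `i - 1` of the path. The shift is there
since the vertex `k` of the path gets the level `k + 1`. -/
noncomputable def viewHeight (F : FlatFolding G) (i : ℕ) (d : D) : ℤ := (F.view (i - 1)).idxOf d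

theorem encodes (F : FlatFolding G) : F.Encodes (fun d => F.level d + 1) F.viewHeight 0 where
  lev_eq _ := rfl
  sorted i := by classical exact pairwise_idxOf (F.nodup_view i)

/-- The layering given by a flat folding. -/
noncomputable def toLayering [Finite D] (F : FlatFolding G) :
    Layering G (fun d => F.level d + 1) where
  isLevel := F.encodes.isLevel
  pos _ := Nat.succ_pos _
  height := F.viewHeight
  height_inj := F.encodes.height_inj
  noncrossing := by
    intro j d y hd hy h1 h2
    have he := F.encodes
    set lev : D → ℕ := fun d => F.level d + 1
    have hs := he.rim_sorted j
    have hmem := he.mem_rim j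
    have hjoin := he.joined_iff j
    rw [add_zero] at hs hmem hjoin
    set p := G.rimPos lev F.viewHeight j
    have hinj : ∀ {a b : D}, G.Leaves lev j a → G.Leaves lev j b → p a = p b → a = b :=
      fun ha hb => EmbeddedGraph.rimPos_injective he.height_inj ha hb
    have hd' := he.isLevel.leaves_turn hd
    have hy' := he.isLevel.leaves_turn hy
    have hsub : ∀ l : List D, l.Pairwise (p · < p ·) → (∀ x ∈ l, G.Leaves lev j x) →
        l.Sublist (F.rim j) := fun l hl hx =>
      sublist_of_sorted hl hs fun x hxl => (hmem x).2 (hx x hxl)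
    have hturn : ∀ {a} (ha : G.Leaves lev j a), F.Joined j a (G.turn lev j a) := fun {a} ha =>
      (hjoin ⟨a, ha⟩ ⟨_, he.isLevel.leaves_turn ha⟩).2
        (Equiv.Perm.sameCycle_apply_right.2 (Equiv.Perm.SameCycle.refl _ _))
    have hsymm : ∀ {a b} (_ : G.Leaves lev j a) (_ : G.Leaves lev j b), F.Joined j a b →
        F.Joined j b a := fun {a b} ha hb hab =>
      (hjoin ⟨b, hb⟩ ⟨a, ha⟩).2 ((hjoin ⟨a, ha⟩ ⟨b, hb⟩).1 hab).symm
    have htrans : ∀ {a b c} (_ : G.Leaves lev j a) (_ : G.Leaves lev j b) (_ : G.Leaves lev j c),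
        F.Joined j a b → F.Joined j b c → F.Joined j a c := fun {a b c} ha hb hc hab hbc =>
      (hjoin ⟨a, ha⟩ ⟨c, hc⟩).2
        (((hjoin ⟨a, ha⟩ ⟨b, hb⟩).1 hab).trans ((hjoin ⟨b, hb⟩ ⟨c, hc⟩).1 hbc))
    by_contra hcon
    have hne : G.turn lev j y ≠ G.turn lev j d := fun h => by
      rw [he.isLevel.turn_injective hy hd h] at h1
      exact lt_irrefl _ h1
    -- if the next place after `y` lies outside the interval, then the two components cross
    have hdy : F.Joined j d y := by
      rcases lt_trichotomy (p (G.turn lev j y)) (p d) with h3 | h3 | h3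
      · have := F.noncrossing j _ _ _ _ (hsub [G.turn lev j y, d, y, G.turn lev j d]
          (by simp; exact ⟨⟨h3, h3.trans h1, (h3.trans h1).trans h2⟩, ⟨h1, h1.trans h2⟩, h2⟩)
          (by simp [hd, hy, hd', hy'])) (hsymm hy hy' (hturn hy)) (hturn hd)
        exact htrans hd hy' hy (hsymm hy' hd this) (hsymm hy hy' (hturn hy))
      · have := hinj hy' hd h3
        exact hsymm hy hd (this ▸ hturn hy)
      · have h4 : p (G.turn lev j d) < p (G.turn lev j y) := by
          refine lt_of_le_of_ne (not_lt.1 fun h => hcon ⟨h3, h⟩) fun h => ?_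
          exact hne (hinj hy' hd' h.symm)
        exact F.noncrossing j _ _ _ _ (hsub [d, y, G.turn lev j d, G.turn lev j y]
          (by simp; exact ⟨⟨h1, h1.trans h2, (h1.trans h2).trans h4⟩, ⟨h2, h2.trans h4⟩, h4⟩)
          (by simp [hd, hy, hd', hy'])) (hturn hd) (hturn hy)
    rcases hdy with ⟨h5, h6⟩ | ⟨h5, h6⟩
    · refine F.rotation d y h6 (Or.inl ?_)
      rw [h5]
      have h7 : G.turn lev j d = G.rot d := if_pos (by simp [lev, h5])
      rw [h7] at h2
      exact hsub _ (by simp; exact ⟨⟨h1, h1.trans h2⟩, h2⟩) (by simp [hd, hy, ← h7, hd'])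
    · rcases h6 with rfl | rfl
      · exact lt_irrefl _ h1
      · have h7 : G.turn lev j d = G.opp d := if_neg (by simpa [lev] using h5)
        rw [h7] at h2
        exact lt_irrefl _ h2
  flat_iff := by
    intro d
    rw [← F.angle_eq, F.encodes.cornerAngle_eq]
    split_ifs with h1 h2
    · simp only [false_iff, not_not]
      exact h1
    · simp only [false_iff, not_not]
      exact h1
    · simp only [true_iff]
      exact h1
  valley_iff := by
    intro j d hj hd
    rw [← F.angle_eq, F.encodes.cornerAngle_eq, if_pos hd]
    obtain rfl : F.level d = j := by omega
    rw [add_zero]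
    split_ifs <;> simp [*]
  outer_bottom := by
    intro i d hd hmin
    cases i with
    | zero => exact absurd hd (F.encodes.not_crosses (by omega) _)
    | succ i => exact F.outer_bottom i d ((F.encodes.head_iff i d).2 ⟨hd, hmin⟩)
  outer_top := by
    intro i d hd hmax
    cases i with
    | zero => exact absurd hd (F.encodes.not_crosses (by omega) _)
    | succ i => exact F.outer_top i d ((F.encodes.getLast_iff i d).2 ⟨hd, hmax⟩)

theorem toLayering_touching [Finite D] (F : FlatFolding G) (a b : D) :
    F.toLayering.Touching a b ↔ F.Touching a b := by
  have key : ∀ i a b, F.toLayering.Consecutive (i + 1) a b ↔ List.IsInfix [a, b] (F.view i) :=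
    fun i a b => (F.encodes.infix_iff i a b).symm
  constructor
  · rintro ⟨i, hi⟩
    cases i with
    | zero => rcases hi with hi | hi <;> exact absurd hi.1 (F.encodes.not_crosses (by omega) _)
    | succ i => exact ⟨i, by rwa [key, key] at hi⟩
  · rintro ⟨i, hi⟩
    exact ⟨i + 1, by rwa [key, key]⟩

end FlatFolding

namespace Layering

variable {D : Type*} {G : FoldingInput D} {lev : D → ℕ}

/-- A layering whose heights describe the views of a line configuration is a flat folding. -/
def toFlatFolding [Finite D] (L : Layering G lev) (F : LineConfiguration G) {m : ℕ}
    (h : F.Encodes lev L.height m) : FlatFolding G where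
  toLineConfiguration := F
  noncrossing := by
    intro i a b c d hsub hac hbd
    have hs := (h.rim_sorted i).sublist hsub
    have hmem : ∀ x ∈ [a, b, c, d], G.Leaves lev (i + m) x := fun x hx =>
      (h.mem_rim i x).1 (hsub.subset hx)
    have hab : G.rimPos lev L.height (i + m) a < G.rimPos lev L.height (i + m) b := by simp_all
    have hbc : G.rimPos lev L.height (i + m) b < G.rimPos lev L.height (i + m) c := by simp_all
    have hcd : G.rimPos lev L.height (i + m) c < G.rimPos lev L.height (i + m) d := by simp_all
    let a' : {d : D // G.Leaves lev (i + m) d} := ⟨a, hmem a (by simp)⟩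
    let b' : {d : D // G.Leaves lev (i + m) d} := ⟨b, hmem b (by simp)⟩
    let c' : {d : D // G.Leaves lev (i + m) d} := ⟨c, hmem c (by simp)⟩
    let d' : {d : D // G.Leaves lev (i + m) d} := ⟨d, hmem d (by simp)⟩
    have hac' := (h.joined_iff i a' c').1 hac
    have hbd' := (h.joined_iff i b' d').1 hbd
    refine (h.joined_iff i a' b').2 ?_
    obtain ⟨z, haz, hz1, hz2⟩ := exists_exit
      (fun z : {d : D // G.Leaves lev (i + m) d} =>
        G.rimPos lev L.height (i + m) z < G.rimPos lev L.height (i + m) b) hac' hab hbc.asymm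
    have hz2' := not_lt.1 hz2
    rcases hz2'.eq_or_lt with heq | hlt
    · rw [L.rimPos_injective' (i + m) (a₁ := b') heq]
      exact Equiv.Perm.sameCycle_apply_right.2 haz
    · have h1 := noncrossing_orbit (L.noncrossing' (i + m)) hbd' hz1 hlt
      have h2 := noncrossing_orbit (L.noncrossing' (i + m)) (hac'.symm.trans haz)
        (hz1.trans hbc) (hcd.trans h1.2)
      exact absurd h2.1 (lt_irrefl _)
  rotation := by
    intro a b hab hcyc
    have hs := h.rim_sorted (F.level a)
    have hlev : lev a = F.level a + m + 1 := h.lev_eq a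
    have hlevb : lev b = F.level a + m + 1 := by
      rw [← hlev]
      exact (SameCycle.apply_eq h.isLevel.rot (Quotient.exact hab)).symm
    let a' : {d : D // G.Leaves lev (F.level a + m) d} := ⟨a, h.isLevel.leaves_of_level_eq hlev⟩
    let b' : {d : D // G.Leaves lev (F.level a + m) d} := ⟨b, h.isLevel.leaves_of_level_eq hlevb⟩
    have hab' : (h.isLevel.turnPerm (F.level a + m)).SameCycle a' b' :=
      (h.joined_iff (F.level a) a' b').1 (Or.inl ⟨rfl, hab⟩)
    set p := G.rimPos lev L.height (F.level a + m) with hp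
    set s := L.isLevel.turnPerm (F.level a + m) with hsdef
    have hta : (s a' : D) = G.rot a := if_pos hlev
    have hsab : s.SameCycle (s a') b' := Equiv.Perm.sameCycle_apply_left.2 hab'
    have hNC := L.noncrossing' (F.level a + m)
    rcases hcyc with hsub | hsub | hsub
    · have h1 : p a < p b ∧ p b < p (G.rot a) := by
        have := hs.sublist hsub
        simp at this
        exact ⟨this.1.1, this.2⟩
      have := noncrossing_orbit hNC (x := a') hab'.symm h1.1 (by rw [← hsdef, hta]; exact h1.2)
      exact lt_irrefl _ this.1
    · have h1 : p b < p (G.rot a) ∧ p (G.rot a) < p a := by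
        have := hs.sublist hsub
        simp at this
        exact ⟨this.1.1, this.2⟩
      obtain ⟨z, hbz, hz1, hz2⟩ := exists_exit
        (fun z : {d : D // G.Leaves lev (F.level a + m) d} => p z < p (s a')) hab'.symm
        (by rw [hta]; exact h1.1) (by rw [hta]; exact h1.2.asymm)
      have hza : z ≠ a' := by
        rintro rfl
        rw [hta] at hz1
        exact hz1.asymm h1.2
      have hz3 : p (s a') < p (s z) := lt_of_le_of_ne (not_lt.1 hz2) fun heq =>
        hza (s.injective (L.rimPos_injective' _ heq)).symm
      have := noncrossing_orbit hNC (hsab.trans hbz) hz1 hz3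
      exact lt_irrefl _ this.1
    · have h1 : p (G.rot a) < p a ∧ p a < p b := by
        have := hs.sublist hsub
        simp at this
        exact ⟨this.1.1, this.2⟩
      obtain ⟨z, hbz, hz1, hz2⟩ := exists_exit
        (fun z : {d : D // G.Leaves lev (F.level a + m) d} => p z ≤ p a') hsab
        (by rw [hta]; exact h1.1.le) (not_le.2 h1.2)
      have hza : z ≠ a' := by
        rintro rfl
        rw [hta] at hz2
        exact hz2 h1.1.le
      have hz3 : p z < p a' := lt_of_le_of_ne hz1 fun heq => hza (L.rimPos_injective' _ heq)
      have := noncrossing_orbit hNC (Equiv.Perm.sameCycle_apply_left.1 hbz) hz3 (not_le.1 hz2)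
      exact lt_irrefl _ this.1
  angle_eq := by
    intro d
    rw [h.cornerAngle_eq]
    have h1 := L.flat_iff d
    have h2 := L.valley_iff _ d (h.lev_eq d)
    split_ifs with h3 h4
    · exact ((h2 h3).2 h4).symm
    · have h5 := mt (h2 h3).1 h4
      cases hG : G.angle d
      · exact absurd hG h5
      · exact absurd h3 (h1.1 hG)
      · rfl
    · exact (h1.2 h3).symm
  outer_bottom i d hd := by
    rw [h.head_iff] at hd
    exact L.outer_bottom _ d hd.1 hd.2
  outer_top i d hd := by
    rw [h.getLast_iff] at hd
    exact L.outer_top _ d hd.1 hd.2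

theorem toFlatFolding_touching [Finite D] (L : Layering G lev) (F : LineConfiguration G) {m : ℕ}
    (h : F.Encodes lev L.height m) (a b : D) :
    (L.toFlatFolding F h).Touching a b ↔ L.Touching a b := by
  have key : ∀ i a b, L.Consecutive (i + m + 1) a b ↔ List.IsInfix [a, b] (F.view i) :=
    fun i a b => (h.infix_iff i a b).symm
  constructor
  · rintro ⟨i, hi⟩
    exact ⟨i + m + 1, by rw [key, key]; exact hi⟩
  · rintro ⟨i, hi⟩
    rcases le_or_gt i m with him | him
    · rcases hi with hi | hi <;> exact absurd hi.1 (h.not_crosses him _)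
    · obtain ⟨k, rfl⟩ := Nat.exists_eq_add_of_le' him
      exact ⟨k, by rw [Nat.succ_eq_add_one, ← add_assoc, key, key] at hi; exact hi⟩

end Layering


/-! ### Reflecting and refining the levels -/

namespace Layering

open EmbeddedGraph

variable {D : Type*} {G : FoldingInput D} {lev : D → ℕ}

section Flip

variable {M : ℕ} (hpos : ∀ d, 0 < lev d) (hM : ∀ d, lev d ≤ M)

include hpos hM

theorem crosses_flip (i : ℕ) (d : D) : G.Crosses (fun d => M + 1 - lev d) i d ↔
    i ≤ M ∧ G.Crosses lev (M - i) (G.opp d) := by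
  have h1 := hpos d
  have h2 := hpos (G.opp d)
  have h3 := hM d
  have h4 := hM (G.opp d)
  unfold Crosses
  rw [G.opp_opp]
  beta_reduce
  omega

theorem leaves_flip (j : ℕ) (d : D) : G.Leaves (fun d => M + 1 - lev d) j d ↔
    j + 1 ≤ M ∧ G.Leaves lev (M - (j + 1)) d := by
  unfold Leaves
  rw [crosses_flip hpos hM, crosses_flip hpos hM, G.opp_opp]
  have h1 := hpos d
  unfold Crosses
  rw [G.opp_opp]
  omega

theorem turn_flip {j : ℕ} (hj : j + 1 ≤ M) (d : D) : G.turn (fun d => M + 1 - lev d) j d =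
    G.turn lev (M - (j + 1)) d := by
  have h1 := hpos d
  have h3 := hM d
  unfold turn
  congr 1
  simp only [eq_iff_iff]
  omega

theorem rimPos_flip (height : ℕ → D → ℤ) {j : ℕ} (hj : j + 1 ≤ M) {d : D}
    (hd : G.Leaves lev (M - (j + 1)) d) :
    ∃ a c : ℤ, (a = 0 ∨ a = 3) ∧ (a = 0 ↔ lev d < lev (G.opp d)) ∧
      G.rimPos lev height (M - (j + 1)) d = toLex (a, c) ∧
      G.rimPos (fun d => M + 1 - lev d) (fun i d => -height (M - i) (G.opp d)) j d =
        toLex (3 - a, c) := by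
  rcases hd with hd | hd
  · have h1 : G.Crosses (fun d => M + 1 - lev d) j (G.opp d) := by
      rw [crosses_flip hpos hM, G.opp_opp]
      exact ⟨by omega, by convert hd using 1; omega⟩
    refine ⟨_, _, Or.inl rfl, ?_, rimPos_right hd, ?_⟩
    · simpa using lt_of_le_of_lt hd.1 hd.2
    · rw [rimPos_left h1, G.opp_opp, neg_neg, show M - (j + 1) + 1 = M - j by omega]
      rfl
  · have h1 : G.Crosses (fun d => M + 1 - lev d) (j + 1) d := by
      rw [crosses_flip hpos hM]
      exact ⟨hj, hd⟩
    refine ⟨_, _, Or.inr rfl, ?_, rimPos_left hd, ?_⟩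
    · have := hd.1
      have := hd.2
      rw [G.opp_opp] at this
      simp
      omega
    · rw [rimPos_right h1]
      rfl

end Flip

/-- The layering turned by a half-turn. -/
def flip [Finite D] (L : Layering G lev) (M : ℕ) (hM : ∀ d, lev d ≤ M) :
    Layering G (fun d => M + 1 - lev d) where
  isLevel :=
    { rot := fun d => by rw [L.isLevel.rot]
      ne := fun d => by
        have := L.isLevel.ne d
        have := hM d
        have := hM (G.opp d)
        omega }
  pos d := by
    have := hM d
    omega
  height i d := -L.height (M - i) (G.opp d)
  height_inj i a b ha hb hab := by
    rw [crosses_flip L.pos hM] at ha hb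
    exact G.opp.injective (L.height_inj _ _ _ ha.2 hb.2 (neg_injective hab))
  noncrossing := by
    intro j d y hd hy h1 h2
    rw [leaves_flip L.pos hM] at hd hy
    obtain ⟨hj, hd⟩ := hd
    replace hy := hy.2
    rw [turn_flip L.pos hM hj] at h2 ⊢
    rw [turn_flip L.pos hM hj]
    have hd' := L.isLevel.leaves_turn hd
    have hy' := L.isLevel.leaves_turn hy
    have hNC := L.noncrossing _ d y hd hy
    have hback : G.rimPos lev L.height (M - (j + 1)) (G.turn lev (M - (j + 1)) d) ≤
        G.rimPos lev L.height (M - (j + 1)) d →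
        G.rimPos lev L.height (M - (j + 1)) (G.turn lev (M - (j + 1)) d) ≤
          G.rimPos lev L.height (M - (j + 1)) (G.turn lev (M - (j + 1)) y) ∧
        G.rimPos lev L.height (M - (j + 1)) (G.turn lev (M - (j + 1)) y) ≤
          G.rimPos lev L.height (M - (j + 1)) d →
        G.rimPos lev L.height (M - (j + 1)) (G.turn lev (M - (j + 1)) d) ≤
          G.rimPos lev L.height (M - (j + 1)) y ∧
        G.rimPos lev L.height (M - (j + 1)) y ≤ G.rimPos lev L.height (M - (j + 1)) d := by
      intro hle hin
      exact of_sameCycle (s := L.isLevel.turnPerm (M - (j + 1)))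
        (S := fun y => G.rimPos lev L.height (M - (j + 1)) (G.turn lev (M - (j + 1)) d) ≤
          G.rimPos lev L.height (M - (j + 1)) y ∧
          G.rimPos lev L.height (M - (j + 1)) y ≤ G.rimPos lev L.height (M - (j + 1)) d)
        (fun z hz => noncrossing_back (L.noncrossing' _) (L.rimPos_injective' _) (x := ⟨d, hd⟩)
          hle hz.1 hz.2) (x := L.isLevel.turnPerm _ ⟨y, hy⟩) (y := ⟨y, hy⟩)
        (Equiv.Perm.sameCycle_apply_left.2 (Equiv.Perm.SameCycle.refl _ _)) hin
    obtain ⟨a1, c1, ha1, -, e1, f1⟩ := rimPos_flip L.pos hM L.height hj hd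
    obtain ⟨a2, c2, ha2, -, e2, f2⟩ := rimPos_flip L.pos hM L.height hj hy
    obtain ⟨a3, c3, ha3, -, e3, f3⟩ := rimPos_flip L.pos hM L.height hj hd'
    obtain ⟨a4, c4, ha4, -, e4, f4⟩ := rimPos_flip L.pos hM L.height hj hy'
    rw [e1, e2, e3, e4] at hNC
    rw [e1, e2, e3, e4] at hback
    rw [f1, f2] at h1
    rw [f2, f3] at h2
    rw [f1, f3, f4]
    simp only [Prod.Lex.toLex_lt_toLex, Prod.Lex.toLex_le_toLex] at *
    rcases ha1 with rfl | rfl <;> rcases ha2 with rfl | rfl <;> rcases ha3 with rfl | rfl <;>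
      rcases ha4 with rfl | rfl <;> simp at * <;> omega
  flat_iff d := by
    rw [L.flat_iff]
    have h1 := L.isLevel.ne d
    have h2 := L.isLevel.ne (G.rot d)
    have h3 := hM d
    have h4 := hM (G.opp d)
    have h5 := hM (G.rot d)
    have h6 := hM (G.opp (G.rot d))
    omega
  valley_iff := by
    intro j d hj hd
    have h1 := L.pos d
    have h2 := hM d
    have h3 := L.isLevel.ne d
    have h4 := L.isLevel.ne (G.rot d)
    have h5 := hM (G.rot d)
    have h6 := hM (G.opp (G.rot d))
    have h7 := hM (G.opp d)
    have hjM : j + 1 ≤ M := by omega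
    have hlev : lev d = M - (j + 1) + 1 := by omega
    have hside : lev d < lev (G.opp d) ↔ lev (G.rot d) < lev (G.opp (G.rot d)) := by omega
    rw [L.valley_iff _ d hlev hside]
    obtain ⟨a1, c1, ha1, g1, e1, f1⟩ := rimPos_flip L.pos hM L.height hjM
      (L.isLevel.leaves_of_level_eq hlev)
    obtain ⟨a2, c2, ha2, g2, e2, f2⟩ := rimPos_flip L.pos hM L.height hjM
      (L.isLevel.leaves_of_level_eq (d := G.rot d) (by rw [L.isLevel.rot, hlev]))
    rw [e1, e2, f1, f2]
    simp only [Prod.Lex.toLex_lt_toLex]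
    omega
  outer_bottom i d hd hmin := by
    rw [crosses_flip L.pos hM] at hd
    refine L.outer_top _ _ hd.2 fun e he => ?_
    have := hmin (G.opp e) (by rw [crosses_flip L.pos hM, G.opp_opp]; exact ⟨hd.1, he⟩)
    rw [G.opp_opp] at this
    omega
  outer_top i d hd hmax := by
    rw [crosses_flip L.pos hM] at hd
    rw [← L.outer_bottom _ _ hd.2 fun e he => ?_, G.opp_opp]
    have := hmax (G.opp e) (by rw [crosses_flip L.pos hM, G.opp_opp]; exact ⟨hd.1, he⟩)
    rw [G.opp_opp] at this
    omega

theorem consecutive_flip [Finite D] (L : Layering G lev) (M : ℕ) (hM : ∀ d, lev d ≤ M) (i : ℕ)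
    (a b : D) : (L.flip M hM).Consecutive i a b ↔
      i ≤ M ∧ L.Consecutive (M - i) (G.opp b) (G.opp a) := by
  unfold Consecutive
  simp only [crosses_flip L.pos hM]
  constructor
  · rintro ⟨ha, hb, hab, hnext⟩
    refine ⟨ha.1, hb.2, ha.2, neg_lt_neg_iff.1 hab, fun e he hlt => ?_⟩
    by_contra! hlt'
    have := hnext (G.opp e) (by rw [G.opp_opp]; exact ⟨ha.1, he⟩)
      (by
        change -L.height (M - i) (G.opp a) < -L.height (M - i) (G.opp (G.opp e))
        rw [G.opp_opp]
        exact neg_lt_neg hlt')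
    change -L.height (M - i) (G.opp b) ≤ -L.height (M - i) (G.opp (G.opp e)) at this
    rw [G.opp_opp] at this
    omega
  · rintro ⟨hi, hb, ha, hab, hnext⟩
    refine ⟨⟨hi, ha⟩, ⟨hi, hb⟩, neg_lt_neg hab, fun e he hlt => ?_⟩
    by_contra! hlt'
    have h1 := hnext (G.opp e) he.2 (neg_lt_neg_iff.1 hlt')
    have h2 := neg_lt_neg_iff.1 hlt
    omega

theorem touching_flip [Finite D] (L : Layering G lev) (M : ℕ) (hM : ∀ d, lev d ≤ M) (a b : D) :
    (L.flip M hM).Touching a b ↔ L.Touching a b := by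
  unfold Touching
  simp only [consecutive_flip, G.opp_opp]
  constructor
  · rintro ⟨i, ⟨-, hi⟩ | ⟨-, hi⟩⟩
    · exact ⟨M - i, Or.inr hi⟩
    · exact ⟨M - i, Or.inl hi⟩
  · have hle : ∀ {i a b}, L.Consecutive i a b → i ≤ M := fun h =>
      h.1.2.le.trans (hM _)
    rintro ⟨i, hi | hi⟩
    · exact ⟨M - i, Or.inr ⟨by omega, by rwa [Nat.sub_sub_self (hle hi)]⟩⟩
    · exact ⟨M - i, Or.inl ⟨by omega, by rwa [Nat.sub_sub_self (hle hi)]⟩⟩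

section Refine

variable {ρ κ : ℕ → ℕ} (hκ : ∀ k i, ρ k ≤ i ↔ k ≤ κ i)

include hκ

theorem crosses_refine (i : ℕ) (d : D) :
    G.Crosses (fun d => ρ (lev d)) i d ↔ G.Crosses lev (κ i) d := by
  unfold Crosses
  rw [hκ, ← not_le, ← not_le, hκ]

/-- Either the refined level `j + 1` is a level of the original layering, or it lies within one
of its intervals. -/
theorem refine_cases (hρ : StrictMono ρ) (j : ℕ) :
    (κ (j + 1) = κ j + 1 ∧ ∀ k, ρ k = j + 1 ↔ k = κ j + 1) ∨
      (κ (j + 1) = κ j ∧ ∀ k, ρ k ≠ j + 1) := by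
  have h1 := hκ (κ (j + 1)) (j + 1)
  have h2 := hκ (κ j) j
  have h3 := hκ (κ j) (j + 1)
  have h4 := hκ (κ j + 1) j
  have h5 := hκ (κ j + 1) (j + 1)
  have h6 := hκ (κ j + 2) (j + 1)
  have h7 : ρ (κ j + 1) < ρ (κ j + 2) := hρ (by omega)
  by_cases hc : ρ (κ j + 1) = j + 1
  · refine Or.inl ⟨by omega, fun k => ⟨fun hk => hρ.injective (by omega), fun hk => by rw [hk, hc]⟩⟩
  · refine Or.inr ⟨by omega, fun k hk => ?_⟩
    have h8 := hκ k (j + 1)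
    have h9 := hκ k j
    omega

theorem rimPos_refine {j : ℕ} (hj : κ (j + 1) = κ j + 1) (height : ℕ → D → ℤ) (d : D) :
    G.rimPos (fun d => ρ (lev d)) (fun i => height (κ i)) j d = G.rimPos lev height (κ j) d := by
  unfold rimPos
  beta_reduce
  rw [hj]
  congr 1
  rw [crosses_refine hκ, hj]

theorem rimPos_refine_right {j : ℕ} (hj : κ (j + 1) = κ j) (height : ℕ → D → ℤ) {d : D}
    (hd : G.Crosses lev (κ j) d) :
    G.rimPos (fun d => ρ (lev d)) (fun i => height (κ i)) j d = toLex (0, height (κ j) d) := by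
  rw [rimPos_right (by rw [crosses_refine hκ, hj]; exact hd), hj]

theorem rimPos_refine_left {j : ℕ} (height : ℕ → D → ℤ) {d : D}
    (hd : G.Crosses lev (κ j) (G.opp d)) :
    G.rimPos (fun d => ρ (lev d)) (fun i => height (κ i)) j d =
      toLex (3, -height (κ j) (G.opp d)) := by
  rw [rimPos_left (by rw [crosses_refine hκ]; exact hd)]

theorem leaves_refine {j : ℕ} (hj : κ (j + 1) = κ j + 1) (d : D) :
    G.Leaves (fun d => ρ (lev d)) j d ↔ G.Leaves lev (κ j) d := by
  unfold Leaves
  rw [crosses_refine hκ, crosses_refine hκ, hj]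

end Refine

/-- The layering with the levels renumbered by `ρ`, where further levels are inserted. -/
def refine (L : Layering G lev) {ρ κ : ℕ → ℕ} (hρ : StrictMono ρ)
    (hκ : ∀ k i, ρ k ≤ i ↔ k ≤ κ i) : Layering G (fun d => ρ (lev d)) where
  isLevel :=
    { rot := fun d => by rw [L.isLevel.rot]
      ne := fun d h => L.isLevel.ne d (hρ.injective h) }
  pos d := lt_of_lt_of_le (L.pos d) hρ.le_apply
  height i := L.height (κ i)
  height_inj i a b ha hb hab := by
    rw [crosses_refine hκ] at ha hb
    exact L.height_inj _ _ _ ha hb hab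
  noncrossing := by
    intro j d y hd hy h1 h2
    rcases refine_cases hκ hρ j with ⟨hj, hk⟩ | ⟨hj, hk⟩
    · have hturn : ∀ d, G.turn (fun d => ρ (lev d)) j d = G.turn lev (κ j) d := fun d => by
        unfold turn
        congr 1
        rw [eq_iff_iff]
        exact hk _
      rw [leaves_refine hκ hj] at hd hy
      simp only [rimPos_refine hκ hj, hturn] at *
      exact L.noncrossing _ d y hd hy h1 h2
    · have hturn : ∀ d, G.turn (fun d => ρ (lev d)) j d = G.opp d := fun d => if_neg (hk _)
      unfold Leaves at hd hy
      simp only [crosses_refine hκ, hj] at hd hy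
      rw [hturn] at *
      rw [hturn]
      rcases hd with hd | hd
      · have hd' : G.Crosses lev (κ j) (G.opp (G.opp d)) := by rwa [G.opp_opp]
        rw [rimPos_refine_right hκ hj _ hd] at *
        rw [rimPos_refine_left hκ _ hd', G.opp_opp] at *
        rcases hy with hy | hy
        · have hy' : G.Crosses lev (κ j) (G.opp (G.opp y)) := by rwa [G.opp_opp]
          rw [rimPos_refine_right hκ hj _ hy] at h1 h2
          rw [rimPos_refine_left hκ _ hy', G.opp_opp]
          simp [Prod.Lex.toLex_lt_toLex] at *
          omega
        · rw [rimPos_refine_left hκ _ hy] at h1 h2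
          rw [rimPos_refine_right hκ hj _ hy]
          simp [Prod.Lex.toLex_lt_toLex] at *
          omega
      · have := h1.trans h2
        rw [rimPos_refine_left hκ _ hd, rimPos_refine_right hκ hj _ hd,
          Prod.Lex.toLex_lt_toLex] at this
        simp at this
  flat_iff d := by
    rw [L.flat_iff]
    simp only [hρ.lt_iff_lt]
  valley_iff := by
    intro j d hj hd
    simp only [hρ.lt_iff_lt] at hd
    rcases refine_cases hκ hρ j with ⟨hj', hk⟩ | ⟨hj', hk⟩
    · rw [rimPos_refine hκ hj', rimPos_refine hκ hj']
      exact L.valley_iff _ d ((hk _).1 hj) hd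
    · exact absurd hj (hk _)
  outer_bottom i d hd hmin := by
    simp only [crosses_refine hκ] at hd hmin
    exact L.outer_bottom _ _ hd hmin
  outer_top i d hd hmax := by
    simp only [crosses_refine hκ] at hd hmax
    exact L.outer_top _ _ hd hmax

theorem touching_refine (L : Layering G lev) {ρ κ : ℕ → ℕ} (hρ : StrictMono ρ)
    (hκ : ∀ k i, ρ k ≤ i ↔ k ≤ κ i) (a b : D) :
    (L.refine hρ hκ).Touching a b ↔ L.Touching a b := by
  have key : ∀ i a b, (L.refine hρ hκ).Consecutive i a b ↔ L.Consecutive (κ i) a b := by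
    intro i a b
    unfold Consecutive
    simp only [crosses_refine hκ]
    rfl
  unfold Touching
  simp only [key]
  constructor
  · rintro ⟨i, hi⟩
    exact ⟨κ i, hi⟩
  · rintro ⟨k, hk⟩
    have : κ (ρ k) = k := by
      have h1 := hκ k (ρ k)
      have h2 := hκ (κ (ρ k)) (ρ k)
      have h3 : ρ (κ (ρ k)) ≤ ρ k := h2.2 le_rfl
      exact le_antisymm (hρ.le_iff_le.1 h3) (h1.1 le_rfl)
    exact ⟨ρ k, by rwa [this]⟩

/-! ### Placing the levels on the line -/

/-- A layering together with positions for its levels that give the right lengths is a flat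
folding with the same touching pairs. -/
theorem exists_flatFolding [Finite D] [Nonempty D] (L : Layering G lev) (hG : G.Connected)
    (X : ℕ → ℝ) (N : ℕ) (hX : ∀ i j, i < j → 1 ≤ i → j ≤ N → X i < X j) (hN : ∀ d, lev d ≤ N)
    (hlen : ∀ d, |X (lev (G.opp d)) - X (lev d)| = G.length d) :
    ∃ F : FlatFolding G, ∀ a b, F.Touching a b ↔ L.Touching a b := by
  classical
  have := Fintype.ofFinite D
  obtain ⟨dmin, hmin⟩ := Finite.exists_min lev
  obtain ⟨dmax, hmax⟩ := Finite.exists_max lev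
  obtain ⟨m, hm⟩ : ∃ m, lev dmin = m + 1 := ⟨lev dmin - 1, by have := L.pos dmin; omega⟩
  have hle : ∀ d, m + 1 ≤ lev d := fun d => hm ▸ hmin d
  choose view hmem hsorted using fun i => exists_sorted (p := L.height (i + m + 1))
    (Finset.univ.filter (G.Crosses lev (i + m + 1)))
    (fun a ha b hb hab => L.height_inj _ a b (by simpa using ha) (by simpa using hb) hab)
  simp only [Finset.mem_filter, Finset.mem_univ, true_and] at hmem
  let F : LineConfiguration G :=
    { n := lev dmax - (m + 1)
      pos := fun k => X (k + m + 1)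
      pos_lt := fun i j hij hj => by
        have h1 := hN dmax
        have h2 := hle dmax
        exact hX _ _ (by omega) (by omega) (by omega)
      level := fun d => lev d - (m + 1)
      level_le := fun d => by
        have := hmax d
        omega
      level_rot := fun d => by rw [L.isLevel.rot]
      length_eq := fun d => by
        have h1 : lev d - (m + 1) + m + 1 = lev d := by
          have := hle d
          omega
        have h2 : lev (G.opp d) - (m + 1) + m + 1 = lev (G.opp d) := by
          have := hle (G.opp d)
          omega
        rw [h1, h2, hlen]
      view := view
      nodup_view := fun i => (hsorted i).imp fun hab => fun h => absurd (h ▸ hab) (lt_irrefl _)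
      mem_view := fun i d => by
        rw [hmem, Crosses]
        have h1 := hle d
        have h2 := hle (G.opp d)
        omega
      view_ne_nil := fun i hi hnil => by
        have hno : ∀ d, ¬ G.Crosses lev (i + m + 1) d := fun d hd => by
          rw [← hmem, hnil] at hd
          simp at hd
        have hinv := eq_of_jointlyTransitive (g := fun d => decide (lev d ≤ i + m + 1)) hG
          (fun d => by rw [L.isLevel.rot]) (fun d => by
            have h1 := hno d
            have h2 := hno (G.opp d)
            unfold Crosses at h1 h2
            rw [G.opp_opp] at h2
            simp only [decide_eq_decide]
            omega) dmin dmax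
        simp only [decide_eq_decide] at hinv
        omega }
  have hF : F.Encodes lev L.height m :=
    { lev_eq := fun d => by
        change lev d = lev d - (m + 1) + m + 1
        have := hle d
        omega
      sorted := hsorted }
  exact ⟨L.toFlatFolding F hF, L.toFlatFolding_touching F hF⟩

end Layering


/-! ### Face cycles -/

namespace FoldingInput

open EmbeddedGraph

variable {D : Type*} (G : FoldingInput D) (f : G.Face)

theorem faceCycle_rot_true (x : {d : D // G.face d = f}) :
    (G.faceCycle f).rot (x, true) = ((G.boundaryNext f).symm x, false) := rfl

theorem faceCycle_rot_false (x : {d : D // G.face d = f}) :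
    (G.faceCycle f).rot (x, false) = (G.boundaryNext f x, true) := rfl

theorem faceCycle_opp (x : {d : D // G.face d = f}) (b : Bool) :
    (G.faceCycle f).opp (x, b) = (x, !b) := rfl

theorem faceCycle_faceNext_true (x : {d : D // G.face d = f}) :
    (G.faceCycle f).faceNext (x, true) = (G.boundaryNext f x, true) := rfl

theorem faceCycle_faceNext_false (x : {d : D // G.face d = f}) :
    (G.faceCycle f).faceNext (x, false) = ((G.boundaryNext f).symm x, false) := rfl

theorem rot_boundaryNext (x : {d : D // G.face d = f}) :
    G.rot (G.boundaryNext f x) = G.opp x := G.rot.apply_symm_apply _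

theorem opp_boundaryNext_symm (x : {d : D // G.face d = f}) :
    G.opp ((G.boundaryNext f).symm x) = G.rot x := by
  have h := G.rot_boundaryNext f ((G.boundaryNext f).symm x)
  rw [Equiv.apply_symm_apply] at h
  exact h.symm

theorem sameCycle_boundaryNext (x y : {d : D // G.face d = f}) :
    (G.boundaryNext f).SameCycle x y := by
  unfold boundaryNext
  rw [Equiv.Perm.sameCycle_subtypePerm]
  exact Quotient.exact (x.2.trans y.2.symm)

theorem faceCycle_face_eq_iff [Finite D] (x y : {d : D // G.face d = f}) (b c : Bool) :
    (G.faceCycle f).face (x, b) = (G.faceCycle f).face (y, c) ↔ b = c := by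
  constructor
  · intro h
    exact SameCycle.apply_eq (a := (G.faceCycle f).faceNext) (g := Prod.snd)
      (by rintro ⟨x, _ | _⟩ <;> rfl) (Quotient.exact h)
  · rintro rfl
    refine of_sameCycle (S := fun y => (G.faceCycle f).face (x, b) = (G.faceCycle f).face (y, b))
      (fun y hy => ?_) (G.sameCycle_boundaryNext f x y) rfl
    rw [hy]
    cases b
    · rw [← (G.faceCycle f).face_faceNext (G.boundaryNext f y, false), faceCycle_faceNext_false,
        Equiv.symm_apply_apply]
    · rw [← faceCycle_faceNext_true, face_faceNext]

open Classical in
theorem faceCycle_face_eq_outer_iff [Finite D] (x : {d : D // G.face d = f}) (b : Bool) :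
    (G.faceCycle f).face (x, b) = (G.faceCycle f).outer ↔ b = decide (f = G.outer) :=
  G.faceCycle_face_eq_iff f x _ b _

theorem faceCycle_connected [Finite D] : (G.faceCycle f).Connected := by
  set H := Subgroup.closure ({(G.faceCycle f).rot, (G.faceCycle f).opp} : Set (Equiv.Perm _))
  have hrot : (G.faceCycle f).rot ∈ H := Subgroup.subset_closure (by simp)
  have hopp : (G.faceCycle f).opp ∈ H := Subgroup.subset_closure (by simp)
  have key : ∀ x y, ∃ g ∈ H, g (x, true) = (y, true) := by
    intro x y
    refine of_sameCycle (S := fun y => ∃ g ∈ H, g (x, true) = (y, true)) ?_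
      (G.sameCycle_boundaryNext f x y) ⟨1, H.one_mem, rfl⟩
    rintro y ⟨g, hg, hxy⟩
    refine ⟨(G.faceCycle f).rot * ((G.faceCycle f).opp * g),
      H.mul_mem hrot (H.mul_mem hopp hg), ?_⟩
    rw [Equiv.Perm.mul_apply, Equiv.Perm.mul_apply, hxy]
    rfl
  rintro ⟨x, b⟩ ⟨y, c⟩
  obtain ⟨g, hg, hxy⟩ := key x y
  cases b <;> cases c
  · exact ⟨_, H.mul_mem hopp (H.mul_mem hg hopp), by
      simp only [Equiv.Perm.mul_apply, faceCycle_opp, Bool.not_false, hxy, Bool.not_true]⟩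
  · exact ⟨_, H.mul_mem hg hopp, by
      simp only [Equiv.Perm.mul_apply, faceCycle_opp, Bool.not_false, hxy]⟩
  · exact ⟨_, H.mul_mem hopp hg, by
      simp only [Equiv.Perm.mul_apply, faceCycle_opp, hxy, Bool.not_true]⟩
  · exact ⟨g, hg, hxy⟩

variable {G f}

/-- The dart of `G` with the same starting point and direction as a dart of a face cycle. -/
def outDart (x : {d : D // G.face d = f} × Bool) : D := if x.2 then x.1 else G.opp x.1

@[simp]
theorem outDart_true (x : {d : D // G.face d = f}) : outDart (x, true) = x := rfl

@[simp]
theorem outDart_false (x : {d : D // G.face d = f}) : outDart (x, false) = G.opp x := rfl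

theorem outDart_opp (x : {d : D // G.face d = f} × Bool) :
    outDart ((G.faceCycle f).opp x) = G.opp (outDart x) := by
  obtain ⟨x, _ | _⟩ := x
  · exact (G.opp_opp _).symm
  · rfl

theorem outDart_rot_true (x : {d : D // G.face d = f}) :
    outDart ((G.faceCycle f).rot (x, true)) = G.rot x := by
  rw [faceCycle_rot_true, outDart_false, opp_boundaryNext_symm]

theorem rot_outDart_rot_false (x : {d : D // G.face d = f}) :
    G.rot (outDart ((G.faceCycle f).rot (x, false))) = G.opp x := by
  rw [faceCycle_rot_false, outDart_true, rot_boundaryNext]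

/-- The levels of a face cycle. -/
def cycleLevel (lev : D → ℕ) (f : G.Face) (x : {d : D // G.face d = f} × Bool) : ℕ :=
  lev (outDart x)

variable {lev : D → ℕ}

theorem isLevel_cycleLevel (hl : G.IsLevel lev) :
    (G.faceCycle f).IsLevel (cycleLevel lev f) where
  rot := by
    rintro ⟨x, _ | _⟩
    · unfold cycleLevel
      rw [← hl.rot, rot_outDart_rot_false, outDart_false]
    · unfold cycleLevel
      rw [outDart_rot_true, hl.rot, outDart_true]
  ne x := by
    unfold cycleLevel
    rw [outDart_opp]
    exact hl.ne _

theorem crosses_cycle (i : ℕ) (x : {d : D // G.face d = f} × Bool) :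
    (G.faceCycle f).Crosses (cycleLevel lev f) i x ↔ G.Crosses lev i (outDart x) := by
  unfold Crosses cycleLevel
  rw [outDart_opp]

theorem leaves_cycle (j : ℕ) (x : {d : D // G.face d = f} × Bool) :
    (G.faceCycle f).Leaves (cycleLevel lev f) j x ↔ G.Leaves lev j (outDart x) := by
  unfold Leaves
  rw [crosses_cycle, crosses_cycle, outDart_opp]

theorem turn_cycle_true (j : ℕ) (x : {d : D // G.face d = f}) :
    (((G.faceCycle f).turn (cycleLevel lev f) j (x, true)).1 : D) = G.opp (G.turn lev j x) ∧
      ((G.faceCycle f).turn (cycleLevel lev f) j (x, true)).2 = false := by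
  unfold turn cycleLevel
  rw [outDart_true]
  split_ifs
  · refine ⟨?_, rfl⟩
    rw [faceCycle_rot_true, ← opp_boundaryNext_symm, G.opp_opp]
  · refine ⟨?_, rfl⟩
    rw [faceCycle_opp, G.opp_opp]

theorem outDart_turn_true (j : ℕ) (x : {d : D // G.face d = f}) :
    outDart ((G.faceCycle f).turn (cycleLevel lev f) j (x, true)) = G.turn lev j x := by
  obtain ⟨h1, h2⟩ := turn_cycle_true (lev := lev) j x
  unfold outDart
  rw [h2, if_neg (by simp), h1, G.opp_opp]

theorem turn_cycle_false (hl : G.IsLevel lev) {j : ℕ} (x : {d : D // G.face d = f})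
    (hx : G.Leaves lev j (G.opp x)) :
    G.turn lev j ((G.faceCycle f).turn (cycleLevel lev f) j (x, false)).1 = G.opp x ∧
      ((G.faceCycle f).turn (cycleLevel lev f) j (x, false)).2 = true := by
  by_cases h : lev (G.opp x) = j + 1
  · have h1 : (G.faceCycle f).turn (cycleLevel lev f) j (x, false) =
        (G.boundaryNext f x, true) := if_pos h
    rw [h1]
    refine ⟨?_, rfl⟩
    have h2 : lev (G.boundaryNext f x) = j + 1 := by rw [← h, ← rot_boundaryNext, hl.rot]
    rw [turn, if_pos h2, rot_boundaryNext]
  · have h1 : (G.faceCycle f).turn (cycleLevel lev f) j (x, false) = (x, true) := if_neg h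
    rw [h1]
    refine ⟨?_, rfl⟩
    rw [turn, if_neg]
    unfold Leaves Crosses at hx
    rw [G.opp_opp] at hx
    have := hl.ne x
    dsimp only
    omega

end FoldingInput

/-! ### A flat folding restricts to the face cycles -/

namespace Layering

open EmbeddedGraph FoldingInput

variable {D : Type*} {G : FoldingInput D} {lev : D → ℕ} (L : Layering G lev) (f : G.Face)

/-- An edge with both of its sides in the face is doubled: its lower side comes first. -/
def splitHeight (i : ℕ) (x : {d : D // G.face d = f} × Bool) : ℤ :=
  2 * L.height i (outDart x) + if x.2 then 1 else 0

variable {f}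

theorem rimPos_split {j : ℕ} {x : {d : D // G.face d = f} × Bool}
    (hx : G.Leaves lev j (outDart x)) :
    ∃ a c e : ℤ, (a = 0 ∨ a = 3) ∧ (a = 0 ∧ e = 0 ∨ a = 3 ∧ e = -1) ∧
      G.rimPos lev L.height j (outDart x) = toLex (a, c) ∧
      (G.faceCycle f).rimPos (cycleLevel lev f) (L.splitHeight f) j x =
        toLex (a, 2 * c + e + if x.2 then 1 else 0) := by
  rcases hx with hx | hx
  · refine ⟨_, _, 0, Or.inl rfl, by simp, rimPos_right hx, ?_⟩
    rw [rimPos_right (by rwa [crosses_cycle])]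
    simp [splitHeight]
  · refine ⟨_, _, -1, Or.inr rfl, by simp, rimPos_left hx, ?_⟩
    rw [rimPos_left (by rwa [crosses_cycle, outDart_opp])]
    simp only [splitHeight, outDart_opp]
    obtain ⟨x, _ | _⟩ := x
    · simp [faceCycle_opp]
      ring
    · simp [faceCycle_opp]

theorem rimPos_split_lt_iff {j : ℕ} {x y : {d : D // G.face d = f} × Bool}
    (hx : G.Leaves lev j (outDart x)) (hy : G.Leaves lev j (outDart y)) :
    (G.faceCycle f).rimPos (cycleLevel lev f) (L.splitHeight f) j x <
        (G.faceCycle f).rimPos (cycleLevel lev f) (L.splitHeight f) j y ↔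
      if x.2 = false ∧ y.2 = true then
        G.rimPos lev L.height j (outDart x) ≤ G.rimPos lev L.height j (outDart y)
      else G.rimPos lev L.height j (outDart x) < G.rimPos lev L.height j (outDart y) := by
  obtain ⟨a1, c1, e1, ha1, he1, h1, k1⟩ := L.rimPos_split hx
  obtain ⟨a2, c2, e2, ha2, he2, h2, k2⟩ := L.rimPos_split hy
  rw [h1, h2, k1, k2]
  simp only [Prod.Lex.toLex_lt_toLex, Prod.Lex.toLex_le_toLex]
  rcases x with ⟨x, _ | _⟩ <;> rcases y with ⟨y, _ | _⟩ <;> simp <;> omega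

variable [Fintype D]

theorem exists_top {i : ℕ} {d : D} (hd : G.Crosses lev i d) :
    ∃ a, G.Crosses lev i a ∧ ∀ e, G.Crosses lev i e → L.height i e ≤ L.height i a := by
  classical
  obtain ⟨a, ha, hmax⟩ := Finset.exists_max_image (Finset.univ.filter (G.Crosses lev i))
    (L.height i) ⟨d, by simpa using hd⟩
  exact ⟨a, by simpa using ha, fun e he => hmax e (by simpa using he)⟩

theorem exists_consecutive_above {i : ℕ} {a b : D} (ha : G.Crosses lev i a)
    (hb : G.Crosses lev i b) (hab : L.height i a < L.height i b) :
    ∃ c, L.Consecutive i a c := by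
  classical
  obtain ⟨c, hc, hmin⟩ := Finset.exists_min_image
    (Finset.univ.filter fun e => G.Crosses lev i e ∧ L.height i a < L.height i e)
    (L.height i) ⟨b, by simpa using ⟨hb, hab⟩⟩
  simp only [Finset.mem_filter, Finset.mem_univ, true_and] at hc hmin
  exact ⟨c, ha, hc.1, hc.2, fun e he hlt => hmin e ⟨he, hlt⟩⟩

theorem exists_consecutive_below {i : ℕ} {a b : D} (ha : G.Crosses lev i a)
    (hb : G.Crosses lev i b) (hab : L.height i a < L.height i b) :
    ∃ c, L.Consecutive i c b := by
  classical
  obtain ⟨c, hc, hmax⟩ := Finset.exists_max_image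
    (Finset.univ.filter fun e => G.Crosses lev i e ∧ L.height i e < L.height i b)
    (L.height i) ⟨a, by simpa using ⟨ha, hab⟩⟩
  simp only [Finset.mem_filter, Finset.mem_univ, true_and] at hc hmax
  refine ⟨c, hc.1, hb, hc.2, fun e he hlt => ?_⟩
  by_contra! hcon
  exact absurd hlt (not_lt.2 (hmax e ⟨he, hcon⟩))

/-- The layering of a face cycle obtained from a layering of the graph by keeping the sides of
edges that belong to the face. -/
def split (hG : G.Connected) (f : G.Face) : Layering (G.faceCycle f) (cycleLevel lev f) where
  isLevel := isLevel_cycleLevel L.isLevel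
  pos x := L.pos _
  height := L.splitHeight f
  height_inj := by
    rintro i ⟨x, b⟩ ⟨y, c⟩ hx hy h
    rw [crosses_cycle] at hx hy
    unfold splitHeight at h
    have hbc : b = c := by cases b <;> cases c <;> simp at h ⊢ <;> omega
    subst hbc
    have := L.height_inj _ _ _ hx hy (by omega)
    cases b
    · exact Prod.ext (Subtype.ext (G.opp.injective this)) rfl
    · exact Prod.ext (Subtype.ext this) rfl
  noncrossing := by
    intro j d y hd hy h1 h2
    have hl := isLevel_cycleLevel (f := f) L.isLevel
    have hd' := hl.leaves_turn hd
    have hy' := hl.leaves_turn hy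
    rw [leaves_cycle] at hd hy hd' hy'
    rw [L.rimPos_split_lt_iff hd hy] at h1
    rw [L.rimPos_split_lt_iff hy hd'] at h2
    rw [L.rimPos_split_lt_iff hd hy', L.rimPos_split_lt_iff hy' hd']
    have hNC := L.noncrossing' j
    have hinj := L.rimPos_injective' j
    have hback : ∀ v z : D, G.Leaves lev j v → ∀ hz : G.Leaves lev j z, ∀ z' : D,
        (z' = G.turn lev j z ∨ z = G.turn lev j z') → ∀ hz' : G.Leaves lev j z',
        G.rimPos lev L.height j (G.turn lev j v) ≤ G.rimPos lev L.height j z →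
        G.rimPos lev L.height j z ≤ G.rimPos lev L.height j v →
        G.rimPos lev L.height j (G.turn lev j v) ≤ G.rimPos lev L.height j z' ∧
        G.rimPos lev L.height j z' ≤ G.rimPos lev L.height j v := by
      intro v z hv hz z' hzz hz' h3 h4
      have hcyc : (L.isLevel.turnPerm j).SameCycle ⟨z, hz⟩ ⟨z', hz'⟩ := by
        rcases hzz with rfl | rfl
        · exact Equiv.Perm.sameCycle_apply_right.2 (Equiv.Perm.SameCycle.refl _ _)
        · exact (Equiv.Perm.sameCycle_apply_left
            (x := (⟨z', hz'⟩ : {d : D // G.Leaves lev j d}))).2 (Equiv.Perm.SameCycle.refl _ _)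
      exact of_sameCycle (s := L.isLevel.turnPerm j)
        (S := fun y => G.rimPos lev L.height j (G.turn lev j v) ≤ G.rimPos lev L.height j y ∧
          G.rimPos lev L.height j y ≤ G.rimPos lev L.height j v)
        (fun z hz => noncrossing_back hNC hinj (x := ⟨v, hv⟩) (h3.trans h4) hz.1 hz.2) hcyc ⟨h3, h4⟩
    obtain ⟨x, _ | _⟩ := d <;> obtain ⟨z, _ | _⟩ := y
    · obtain ⟨e1, e2⟩ := turn_cycle_false L.isLevel x hd
      obtain ⟨e3, e4⟩ := turn_cycle_false L.isLevel z hy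
      set t := (G.faceCycle f).turn (cycleLevel lev f) j (x, false)
      set r := (G.faceCycle f).turn (cycleLevel lev f) j (z, false)
      have ht : outDart t = t.1 := by unfold outDart; rw [e2]; rfl
      have hr : outDart r = r.1 := by unfold outDart; rw [e4]; rfl
      rw [ht] at hd' h2 ⊢
      rw [hr] at hy' ⊢
      simp only [e2, e4] at *
      simp at h1 h2 ⊢
      have h3 := hback t.1 _ hd' hy r.1 (Or.inr e3.symm) hy' (by rw [e1]; exact h1.le) h2
      rw [e1] at h3
      refine ⟨h3.1, lt_of_le_of_ne h3.2 fun h => ?_⟩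
      rw [L.rimPos_injective hy' hd' h, e1] at e3
      rw [e3] at h1
      exact lt_irrefl _ h1
    · obtain ⟨e1, e2⟩ := turn_cycle_false L.isLevel x hd
      have e3 := outDart_turn_true (lev := lev) j z
      have e4 := (turn_cycle_true (lev := lev) j z).2
      set t := (G.faceCycle f).turn (cycleLevel lev f) j (x, false)
      set r := (G.faceCycle f).turn (cycleLevel lev f) j (z, true)
      have ht : outDart t = t.1 := by unfold outDart; rw [e2]; rfl
      rw [ht] at hd' h2 ⊢
      rw [e3] at hy' ⊢
      simp only [e2, e4] at *
      simp at h1 h2 hy ⊢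
      have h3 := hback t.1 _ hd' hy _ (Or.inl rfl) hy' (by rw [e1]; exact h1) h2.le
      rw [e1] at h3
      refine ⟨lt_of_le_of_ne h3.1 fun h => ?_, h3.2⟩
      rw [← e1] at h
      have h4 := L.rimPos_injective (L.isLevel.leaves_turn hd') hy' h
      rw [L.isLevel.turn_injective hd' hy h4] at h2
      exact lt_irrefl _ h2
    · have e1 := outDart_turn_true (lev := lev) j x
      have e2 := (turn_cycle_true (lev := lev) j x).2
      obtain ⟨e3, e4⟩ := turn_cycle_false L.isLevel z hy
      set t := (G.faceCycle f).turn (cycleLevel lev f) j (x, true)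
      set r := (G.faceCycle f).turn (cycleLevel lev f) j (z, false)
      have hr : outDart r = r.1 := by unfold outDart; rw [e4]; rfl
      rw [e1] at hd' h2 ⊢
      rw [hr] at hy' ⊢
      simp only [e2, e4] at *
      simp at h1 h2 hd ⊢
      have hcyc : (L.isLevel.turnPerm j).SameCycle ⟨_, hy⟩ ⟨r.1, hy'⟩ := by
        have : (⟨_, hy⟩ : {d : D // G.Leaves lev j d}) = L.isLevel.turnPerm j ⟨r.1, hy'⟩ :=
          Subtype.ext e3.symm
        rw [this]
        exact Equiv.Perm.sameCycle_apply_left.2 (Equiv.Perm.SameCycle.refl _ _)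
      exact noncrossing_orbit hNC (x := ⟨x, hd⟩) hcyc h1 h2
    · have e1 := outDart_turn_true (lev := lev) j x
      have e2 := (turn_cycle_true (lev := lev) j x).2
      have e3 := outDart_turn_true (lev := lev) j z
      have e4 := (turn_cycle_true (lev := lev) j z).2
      set t := (G.faceCycle f).turn (cycleLevel lev f) j (x, true)
      set r := (G.faceCycle f).turn (cycleLevel lev f) j (z, true)
      rw [e1] at hd' h2 ⊢
      rw [e3] at hy' ⊢
      simp only [e2, e4] at *
      simp at h1 h2 hd hy ⊢
      exact L.noncrossing j _ _ hd hy h1 h2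
  flat_iff := by
    rintro ⟨x, _ | _⟩
    · have h1 := L.flat_iff (G.boundaryNext f x)
      rw [rot_boundaryNext] at h1
      have h2 : (G.faceCycle f).angle (x, false) = (G.angle (G.boundaryNext f x)).compl := rfl
      have h3 : (G.angle (G.boundaryNext f x)).compl = .flat ↔
          G.angle (G.boundaryNext f x) = .flat := by
        cases G.angle (G.boundaryNext f x) <;> simp [FoldAngle.compl]
      unfold cycleLevel
      rw [h2, h3, h1, outDart_opp, outDart_opp, faceCycle_rot_false, outDart_true, outDart_false]
      tauto
    · have h1 := L.flat_iff x
      have h2 : (G.faceCycle f).angle (x, true) = G.angle x := rfl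
      unfold cycleLevel
      rw [h2, h1, outDart_opp, outDart_opp, outDart_rot_true, outDart_true]
  valley_iff := by
    intro j x hj hx
    have hl := isLevel_cycleLevel (f := f) L.isLevel
    have h4 := hl.leaves_of_level_eq hj
    have h5 := hl.leaves_of_level_eq (d := (G.faceCycle f).rot x) (by rw [hl.rot, hj])
    rw [leaves_cycle] at h4 h5
    rw [L.rimPos_split_lt_iff h4 h5]
    unfold cycleLevel at hj hx
    rw [outDart_opp, outDart_opp] at hx
    obtain ⟨x, _ | _⟩ := x
    · rw [faceCycle_rot_false, outDart_true, outDart_false] at *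
      have hside : lev (G.boundaryNext f x) < lev (G.opp (G.boundaryNext f x)) ↔
          lev (G.rot (G.boundaryNext f x)) < lev (G.opp (G.rot (G.boundaryNext f x))) := by
        rw [rot_boundaryNext]
        exact hx.symm
      have h1 := L.valley_iff j (G.boundaryNext f x)
        (by rw [← L.isLevel.rot, rot_boundaryNext, hj]) hside
      have h2 := L.flat_iff (G.boundaryNext f x)
      rw [rot_boundaryNext] at h1
      have h3 : (G.faceCycle f).angle (x, false) = (G.angle (G.boundaryNext f x)).compl := rfl
      rw [h3, if_pos (by simp), ← not_lt, ← h1]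
      cases hang : G.angle (G.boundaryNext f x) <;> simp [FoldAngle.compl]
      exact h2.1 hang hside
    · rw [outDart_rot_true, outDart_true] at *
      rw [if_neg (by simp)]
      exact L.valley_iff j x hj hx
  outer_bottom := by
    classical
    rintro i ⟨x, b⟩ hx hmin
    rw [faceCycle_opp, faceCycle_face_eq_outer_iff]
    rw [crosses_cycle] at hx
    simp only [crosses_cycle] at hmin
    obtain ⟨a, ha, hbot⟩ := L.exists_bottom hx
    have hface := L.outer_bottom i a ha hbot
    cases b
    · rw [outDart_false] at hx
      suffices h : f = G.outer by simp [h]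
      rcases (hbot _ hx).lt_or_eq with hlt | heq
      · obtain ⟨c, hc⟩ := L.exists_consecutive_below ha hx hlt
        have hcf : G.face c = f := by rw [hc.face_eq hG, G.opp_opp, x.2]
        have := hmin (⟨c, hcf⟩, true) hc.1
        unfold splitHeight at this
        have h3 := hc.2.2.1
        simp at this
        omega
      · have := L.height_inj _ _ _ ha hx heq
        rw [this, G.opp_opp, x.2] at hface
        exact hface
    · rw [outDart_true] at hx
      suffices h : f ≠ G.outer by simp [h]
      intro h
      have := hmin (⟨G.opp a, hface.trans h.symm⟩, false) (by simpa [G.opp_opp] using ha)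
      have h3 := hbot _ hx
      unfold splitHeight at this
      simp [G.opp_opp] at this
      omega
  outer_top := by
    classical
    rintro i ⟨x, b⟩ hx hmax
    rw [faceCycle_face_eq_outer_iff]
    rw [crosses_cycle] at hx
    simp only [crosses_cycle] at hmax
    obtain ⟨a, ha, htop⟩ := L.exists_top hx
    have hface := L.outer_top i a ha htop
    cases b
    · rw [outDart_false] at hx
      suffices h : f ≠ G.outer by simp [h]
      intro h
      have := hmax (⟨a, hface.trans h.symm⟩, true) (by simpa using ha)
      have h3 := htop _ hx
      unfold splitHeight at this
      simp at this
      omega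
    · rw [outDart_true] at hx
      suffices h : f = G.outer by simp [h]
      rcases (htop _ hx).lt_or_eq with hlt | heq
      · obtain ⟨c, hc⟩ := L.exists_consecutive_above hx ha hlt
        have hcf : G.face (G.opp c) = f := by rw [← hc.face_eq hG, x.2]
        have := hmax (⟨G.opp c, hcf⟩, false) (by simpa [G.opp_opp] using hc.2.1)
        have h3 := hc.2.2.1
        unfold splitHeight at this
        simp [G.opp_opp] at this
        omega
      · have := L.height_inj _ _ _ hx ha heq
        rw [← this, x.2] at hface
        exact hface

end Layering


/-! ### Transversals of the orbits of two permutations -/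

section Transversals

open Equiv.Perm

variable {X : Type*} {a b : Equiv.Perm X}

/-- The action of the subgroup generated by two permutations on an invariant set. -/
theorem exists_subtypePerm_mem_closure {C : X → Prop} (ha : ∀ x, C (a x) ↔ C x)
    (hb : ∀ x, C (b x) ↔ C x) {g : Equiv.Perm X}
    (hg : g ∈ Subgroup.closure ({a, b} : Set (Equiv.Perm X))) :
    ∃ g' ∈ Subgroup.closure ({a.subtypePerm ha, b.subtypePerm hb} :
      Set (Equiv.Perm {x // C x})), ∀ x : {x // C x}, (g' x : X) = g x := by
  induction hg using Subgroup.closure_induction with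
  | mem g hg =>
    rcases hg with rfl | rfl
    · exact ⟨g.subtypePerm ha, Subgroup.subset_closure (by simp), fun x => rfl⟩
    · exact ⟨g.subtypePerm hb, Subgroup.subset_closure (by simp), fun x => rfl⟩
  | one => exact ⟨1, Subgroup.one_mem _, fun x => rfl⟩
  | mul g h _ _ ihg ihh =>
    obtain ⟨g', hg', h1⟩ := ihg
    obtain ⟨h', hh', h2⟩ := ihh
    exact ⟨g' * h', Subgroup.mul_mem _ hg' hh', fun x => by
      rw [Equiv.Perm.mul_apply, Equiv.Perm.mul_apply, h1, h2]⟩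
  | inv g _ ih =>
    obtain ⟨g', hg', h1⟩ := ih
    refine ⟨g'⁻¹, Subgroup.inv_mem _ hg', fun x => ?_⟩
    rw [Equiv.Perm.eq_inv_iff_eq, ← h1]
    simp

variable [Fintype X]

theorem card_le_numCycles {s : Equiv.Perm X} {S : X → Prop}
    (h : ∀ x y, S x → S y → s.SameCycle x y → x = y) : Nat.card {x // S x} ≤ numCycles s := by
  refine Nat.card_le_card_of_injective
    (fun x : {x // S x} => (Quotient.mk (SameCycle.setoid s) x.1)) fun x y hxy => ?_
  exact Subtype.ext (h _ _ x.2 y.2 (Quotient.exact hxy))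

theorem numCycles_le_card {s : Equiv.Perm X} {S : X → Prop}
    (h : ∀ x, ∃ y, S y ∧ s.SameCycle x y) : numCycles s ≤ Nat.card {x // S x} := by
  refine Nat.card_le_card_of_surjective
    (fun x : {x // S x} => (Quotient.mk (SameCycle.setoid s) x.1)) fun q => ?_
  obtain ⟨x, rfl⟩ := Quotient.exists_rep q
  obtain ⟨y, hy, hxy⟩ := h x
  exact ⟨⟨y, hy⟩, Quotient.sound hxy.symm⟩

theorem card_subtype_add_not (S : X → Prop) :
    Nat.card {x // S x} + Nat.card {x // ¬ S x} = Fintype.card X := by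
  classical
  rw [Nat.card_eq_fintype_card, Nat.card_eq_fintype_card, Fintype.card_subtype_compl]
  have := Fintype.card_subtype_le S
  omega

/-- The set `S` contains exactly one element of each orbit of `s`. -/
structure IsTransversal (s : Equiv.Perm X) (S : X → Prop) : Prop where
  eq : ∀ x y, S x → S y → s.SameCycle x y → x = y
  exists_mem : ∀ x, ∃ y, S y ∧ s.SameCycle x y

theorem isTransversal_of_unique {s : Equiv.Perm X} {S : X → Prop}
    (h : ∀ x y, S x → S y → s.SameCycle x y → x = y) (hc : numCycles s ≤ Nat.card {x // S x}) :
    IsTransversal s S := by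
  refine ⟨h, fun x => ?_⟩
  have hinj : Function.Injective
      (fun x : {x // S x} => (Quotient.mk (SameCycle.setoid s) x.1)) :=
    fun x y hxy => Subtype.ext (h _ _ x.2 y.2 (Quotient.exact hxy))
  obtain ⟨y, hy⟩ := (hinj.bijective_of_nat_card_le hc).2 (Quotient.mk _ x)
  exact ⟨y, y.2, (Quotient.exact hy).symm⟩

theorem isTransversal_of_exists {s : Equiv.Perm X} {S : X → Prop}
    (h : ∀ x, ∃ y, S y ∧ s.SameCycle x y) (hc : Nat.card {x // S x} ≤ numCycles s) :
    IsTransversal s S := by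
  refine ⟨fun x y hx hy hxy => ?_, h⟩
  have hsurj : Function.Surjective
      (fun x : {x // S x} => (Quotient.mk (SameCycle.setoid s) x.1)) := fun q => by
    obtain ⟨x, rfl⟩ := Quotient.exists_rep q
    obtain ⟨y, hy, hxy⟩ := h x
    exact ⟨⟨y, hy⟩, Quotient.sound hxy.symm⟩
  have := (hsurj.bijective_of_nat_card_le hc).1 (a₁ := ⟨x, hx⟩) (a₂ := ⟨y, hy⟩)
    (Quotient.sound hxy)
  exact congrArg Subtype.val this

theorem IsTransversal.sum_eq {s : Equiv.Perm X} {S T : X → Prop} [DecidablePred S]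
    [DecidablePred T] (hS : IsTransversal s S)
    (hT : IsTransversal s T) {u : X → ℚ} (hu : ∀ x, u (s x) = u x) :
    ∑ x with S x, u x = ∑ x with T x, u x := by
  choose f hf hxf using hT.exists_mem
  refine Finset.sum_nbij f (fun x _ => by simpa using hf x) ?_ ?_
    fun x _ => SameCycle.apply_eq hu (hxf x)
  · intro x hx y hy hxy
    simp only [Finset.coe_filter, Finset.mem_univ, true_and, Set.mem_ofPred_eq] at hx hy
    exact hS.eq x y hx hy ((hxf x).trans (hxy ▸ (hxf y).symm))
  · intro y hy
    simp only [Finset.coe_filter, Finset.mem_univ, true_and, Set.mem_ofPred_eq] at hy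
    obtain ⟨x, hx, hyx⟩ := hS.exists_mem y
    exact ⟨x, by simpa using hx, (hT.eq _ _ hy (hf x) (hyx.trans (hxf x))).symm⟩

theorem numCycles_le_two_of_unique [Nonempty X] (h : JointlyTransitive a b) {S : X → Prop}
    (ha : ∀ x y, S x → S y → a.SameCycle x y → x = y)
    (hb : ∀ x y, ¬ S x → ¬ S y → b.SameCycle x y → x = y) : numCycles (b * a) ≤ 2 := by
  have h1 := card_le_numCycles ha
  have h2 := card_le_numCycles hb
  have h3 := numCycles_add_le h
  have h4 := card_subtype_add_not S
  omega

theorem three_le_numCycles {s : Equiv.Perm X} {x y z : X} (hxy : ¬ s.SameCycle x y)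
    (hxz : ¬ s.SameCycle x z) (hyz : ¬ s.SameCycle y z) : 3 ≤ numCycles s := by
  have h : Function.Injective ![Quotient.mk (SameCycle.setoid s) x,
      Quotient.mk (SameCycle.setoid s) y, Quotient.mk (SameCycle.setoid s) z] := by
    have h1 : Quotient.mk (SameCycle.setoid s) x ≠ Quotient.mk (SameCycle.setoid s) y :=
      fun h => hxy (Quotient.exact h)
    have h2 : Quotient.mk (SameCycle.setoid s) x ≠ Quotient.mk (SameCycle.setoid s) z :=
      fun h => hxz (Quotient.exact h)
    have h3 : Quotient.mk (SameCycle.setoid s) y ≠ Quotient.mk (SameCycle.setoid s) z :=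
      fun h => hyz (Quotient.exact h)
    intro i j hij
    fin_cases i <;> fin_cases j <;> simp_all [Ne.symm]
  simpa [numCycles] using Nat.card_le_card_of_injective _ h

/-- If `S` contains at most one element of each orbit of `a`, and its complement at most one element
of each orbit of `b`, then each orbit of the group generated by `a` and `b` consists of at most two
orbits of `b * a`: otherwise it would violate Euler's inequality. -/
theorem sameCycle_or_sameCycle {S : X → Prop}
    (ha : ∀ x y, S x → S y → a.SameCycle x y → x = y)
    (hb : ∀ x y, ¬ S x → ¬ S y → b.SameCycle x y → x = y) {x y z : X}
    (hxy : ¬ (b * a).SameCycle x y)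
    (hy : ∃ g ∈ Subgroup.closure ({a, b} : Set (Equiv.Perm X)), g x = y)
    (hz : ∃ g ∈ Subgroup.closure ({a, b} : Set (Equiv.Perm X)), g x = z) :
    (b * a).SameCycle x z ∨ (b * a).SameCycle y z := by
  classical
  by_contra! hcon
  set H := Subgroup.closure ({a, b} : Set (Equiv.Perm X))
  have haH : a ∈ H := Subgroup.subset_closure (by simp)
  have hbH : b ∈ H := Subgroup.subset_closure (by simp)
  let C : X → Prop := fun y => ∃ g ∈ H, g x = y
  have hC : ∀ c ∈ H, ∀ y, C (c y) ↔ C y := by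
    intro c hc y
    constructor
    · rintro ⟨g, hg, h⟩
      exact ⟨c⁻¹ * g, H.mul_mem (H.inv_mem hc) hg, by
        rw [Equiv.Perm.mul_apply, h]; simp⟩
    · rintro ⟨g, hg, rfl⟩
      exact ⟨c * g, H.mul_mem hc hg, rfl⟩
  have hCx : C x := ⟨1, H.one_mem, rfl⟩
  have : Nonempty {y // C y} := ⟨x, hCx⟩
  have htrans : JointlyTransitive (a.subtypePerm (hC a haH)) (b.subtypePerm (hC b hbH)) := by
    rintro ⟨u, gu, hgu, rfl⟩ ⟨v, gv, hgv, rfl⟩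
    obtain ⟨g', hg', h'⟩ := exists_subtypePerm_mem_closure (hC a haH) (hC b hbH)
      (H.mul_mem hgv (H.inv_mem hgu))
    refine ⟨g', hg', Subtype.ext ?_⟩
    rw [h', Equiv.Perm.mul_apply]
    simp
  have hsame : ∀ (c : Equiv.Perm X) (hc : c ∈ H) (u v : {y // C y}),
      (c.subtypePerm (hC c hc)).SameCycle u v → c.SameCycle u v := fun c hc u v h =>
    Equiv.Perm.sameCycle_subtypePerm.1 h
  have hprod : b.subtypePerm (hC b hbH) * a.subtypePerm (hC a haH) =
      (b * a).subtypePerm (hC _ (H.mul_mem hbH haH)) := rfl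
  have hle := numCycles_le_two_of_unique (S := fun y : {y // C y} => S y) htrans
    (fun u v hu hv h => Subtype.ext (ha _ _ hu hv (hsame _ haH _ _ h)))
    (fun u v hu hv h => Subtype.ext (hb _ _ hu hv (hsame _ hbH _ _ h)))
  rw [hprod] at hle
  have hge := three_le_numCycles (s := (b * a).subtypePerm (hC _ (H.mul_mem hbH haH)))
    (x := ⟨x, hCx⟩) (y := ⟨y, hy⟩) (z := ⟨z, hz⟩)
    (fun h => hxy (hsame _ (H.mul_mem hbH haH) _ _ h))
    (fun h => hcon.1 (hsame _ (H.mul_mem hbH haH) _ _ h))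
    (fun h => hcon.2 (hsame _ (H.mul_mem hbH haH) _ _ h))
  omega

end Transversals


/-! ### Reconstruction of the order in a disk -/

section SlitRim

open Equiv.Perm

variable {X A : Type*} [LinearOrder A]

/-- The places on the boundary of a disk, in the linear order given by `p` and with the
permutation `R` that takes each place to the next one, except that `R` closes up separately
the two sides: `a₀` is the last place of the first side and `a₁` is the first place of the second
side. -/
structure IsSlitRim (p : X → A) (R : Equiv.Perm X) (a₀ a₁ : X) : Prop where
  inj : Function.Injective p
  lt_apply : ∀ x, x ≠ a₀ → R x ≠ a₁ → p x < p (R x)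
  apply_le : ∀ x y, x ≠ a₀ → R x ≠ a₁ → p x < p y → p (R x) ≤ p y
  lt : p a₀ < p a₁
  le : ∀ y, p a₀ < p y → p a₁ ≤ p y
  last : ∀ x y, R x = a₁ → p y ≤ p x
  orbit : ∀ x, R.SameCycle a₀ x ∨ R.SameCycle a₁ x
  not_sameCycle : ¬ R.SameCycle a₀ a₁

variable {p : X → A} {σ φ : Equiv.Perm X} {a₀ a₁ : X} {fwd : X → Prop}

namespace IsSlitRim

theorem jointlyTransitive (h : IsSlitRim p (σ * φ) a₀ a₁) (h01 : σ a₀ = a₁) :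
    JointlyTransitive φ σ := by
  set H := Subgroup.closure ({φ, σ} : Set (Equiv.Perm X))
  have hφ : φ ∈ H := Subgroup.subset_closure (by simp)
  have hσ : σ ∈ H := Subgroup.subset_closure (by simp)
  have key : ∀ x, ∃ g ∈ H, g a₀ = x := by
    intro x
    rcases h.orbit x with ⟨n, hn⟩ | ⟨n, hn⟩
    · exact ⟨_, H.zpow_mem (H.mul_mem hσ hφ) n, hn⟩
    · exact ⟨_, H.mul_mem (H.zpow_mem (H.mul_mem hσ hφ) n) hσ, by
        rw [Equiv.Perm.mul_apply, h01, hn]⟩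
  intro x y
  obtain ⟨g, hg, rfl⟩ := key x
  obtain ⟨k, hk, rfl⟩ := key y
  exact ⟨k * g⁻¹, H.mul_mem hk (H.inv_mem hg), by simp⟩

variable [Fintype X]

theorem numCycles_eq (h : IsSlitRim p (σ * φ) a₀ a₁) : numCycles (σ * φ) = 2 := by
  have h1 : numCycles (σ * φ) ≤ 2 := by
    have : Function.Surjective ![Quotient.mk (SameCycle.setoid (σ * φ)) a₀,
        Quotient.mk (SameCycle.setoid (σ * φ)) a₁] := fun q => by
      obtain ⟨x, rfl⟩ := Quotient.exists_rep q
      rcases h.orbit x with hx | hx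
      · exact ⟨0, Quotient.sound hx⟩
      · exact ⟨1, Quotient.sound hx⟩
    simpa [numCycles] using Nat.card_le_card_of_surjective _ this
  have h2 : 2 ≤ numCycles (σ * φ) := by
    have : Function.Injective ![Quotient.mk (SameCycle.setoid (σ * φ)) a₀,
        Quotient.mk (SameCycle.setoid (σ * φ)) a₁] := by
      have h1 : Quotient.mk (SameCycle.setoid (σ * φ)) a₀ ≠
          Quotient.mk (SameCycle.setoid (σ * φ)) a₁ := fun hq => h.not_sameCycle (Quotient.exact hq)
      intro i j hij
      fin_cases i <;> fin_cases j <;> simp_all [Ne.symm]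
    simpa [numCycles] using Nat.card_le_card_of_injective _ this
  omega

/-- An orbit of `φ = σ⁻¹ R` contains a place at which `σ` goes forward: otherwise `φ` would go
forward all along the orbit. -/
theorem exists_forward (h : IsSlitRim p (σ * φ) a₀ a₁) (h01 : σ a₀ = a₁) (x : X) :
    ∃ y, p y < p (σ y) ∧ φ.SameCycle x y := by
  by_contra! hcon
  have hne : ∀ y, φ.SameCycle x y → y ≠ a₀ := by
    rintro y hy rfl
    exact hcon y (by rw [h01]; exact h.lt) hy
  obtain ⟨y, hy, hmax⟩ := Finset.exists_max_image
    (by classical exact Finset.univ.filter (φ.SameCycle x)) p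
      ⟨x, by simp [Equiv.Perm.SameCycle.refl]⟩
  simp only [Finset.mem_filter, Finset.mem_univ, true_and] at hy hmax
  have hy' : φ.SameCycle x (φ y) := Equiv.Perm.sameCycle_apply_right.2 hy
  have h1 := h.lt_apply y (hne y hy) fun hR => hne _ hy' (σ.injective (hR.trans h01.symm))
  have h2 : ¬ p (φ y) < p (σ (φ y)) := fun h3 => hcon _ h3 hy'
  exact absurd (h1.trans_le (not_lt.1 h2)) (not_lt.2 (hmax _ hy'))

theorem exists_not_forward (p : X → A) (σ : Equiv.Perm X) (x : X) :
    ∃ y, ¬ p y < p (σ y) ∧ σ.SameCycle x y := by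
  obtain ⟨y, hy, hmax⟩ := Finset.exists_max_image
    (by classical exact Finset.univ.filter (σ.SameCycle x)) p
      ⟨x, by simp [Equiv.Perm.SameCycle.refl]⟩
  simp only [Finset.mem_filter, Finset.mem_univ, true_and] at hy hmax
  exact ⟨y, not_lt.2 (hmax _ (Equiv.Perm.sameCycle_apply_right.2 hy)), hy⟩

/-- A prescription of the places at which `σ` goes forward, with at most one such place in each
orbit of `φ` and at most one other place in each orbit of `σ`, is correct. It makes
`φ` and `σ` planar, so that both the prescribed and the actual places are transversals, and
the difference of their indicator functions is zero by the exactness of functions on the sphere. -/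
theorem forward_iff (h : IsSlitRim p (σ * φ) a₀ a₁) (h01 : σ a₀ = a₁)
    (hφ : ∀ x y, fwd x → fwd y → φ.SameCycle x y → x = y)
    (hσ : ∀ x y, ¬ fwd x → ¬ fwd y → σ.SameCycle x y → x = y) (h0 : fwd a₀) :
    numCycles φ + numCycles σ = Fintype.card X ∧ ∀ x, fwd x ↔ p x < p (σ x) := by
  classical
  have : Nonempty X := ⟨a₀⟩
  have htrans := h.jointlyTransitive h01
  have h1 := card_le_numCycles hφ
  have h2 := card_le_numCycles hσ
  have h3 := numCycles_add_le htrans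
  have h4 := card_subtype_add_not fwd
  have h5 := h.numCycles_eq
  have h6 := numCycles_le_card (h.exists_forward h01)
  have h7 := numCycles_le_card (exists_not_forward p σ)
  have h8 := card_subtype_add_not fun x => p x < p (σ x)
  have hc : numCycles φ + numCycles σ + numCycles (σ * φ) = Fintype.card X + 2 := by omega
  refine ⟨by omega, ?_⟩
  have t1 := isTransversal_of_unique hφ (by omega)
  have t2 := isTransversal_of_unique hσ (by omega)
  have t3 := isTransversal_of_exists (h.exists_forward h01) (by omega)
  have t4 := isTransversal_of_exists (exists_not_forward p σ) (by omega)
  let m : X → ℚ := fun x => (if fwd x then 1 else 0) - if p x < p (σ x) then 1 else 0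
  have hm : ∀ u : X → ℚ, ∑ x, u x * m x = ∑ x with fwd x, u x - ∑ x with p x < p (σ x), u x := by
    intro u
    simp [m, mul_sub, Finset.sum_filter]
  obtain ⟨u, hu, hmu⟩ := exists_invariant_sub (K := ℚ) htrans hc m
    (fun u hu => by rw [hm, t1.sum_eq t3 hu, sub_self])
    (fun u hu => by
      have e1 := t2.sum_eq t4 hu
      have e2 := Finset.sum_filter_add_sum_filter_not Finset.univ fwd u
      have e3 := Finset.sum_filter_add_sum_filter_not Finset.univ (fun x => p x < p (σ x)) u
      rw [hm]
      linarith)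
  have hval : ∀ x, u x = u a₀ ∨ u x = u a₁ := fun x => (h.orbit x).imp
    (fun hx => (SameCycle.apply_eq (a := σ * φ) hu hx).symm)
    (fun hx => (SameCycle.apply_eq (a := σ * φ) hu hx).symm)
  have h9 : u a₀ = u a₁ := by
    have := hmu a₀
    rw [h01] at this
    simp only [m, h0, h01, h.lt, if_true, sub_self] at this
    linarith
  intro x
  have h10 : m x = 0 := by
    rw [hmu x]
    rcases hval x with h | h <;> rcases hval (σ x) with h' | h' <;> rw [h, h'] <;> linarith
  simp only [m] at h10
  by_cases hx : fwd x <;> by_cases hx' : p x < p (σ x) <;> simp [hx, hx'] at h10 ⊢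

/-- If `φ` and `σ` are planar, then the orbits of `σ` do not cross. -/
theorem noncrossing (h : IsSlitRim p (σ * φ) a₀ a₁) (h01 : σ a₀ = a₁)
    (hc : numCycles φ + numCycles σ = Fintype.card X) (x y : X) (hxy : p x < p y)
    (hy : p y < p (σ x)) : p x < p (σ y) ∧ p (σ y) < p (σ x) := by
  classical
  have : Nonempty X := ⟨a₀⟩
  set R := σ * φ with hR
  -- The next place, on the rim of the whole disk.
  let next : X → X := fun z => if z = a₀ then a₁ else R z
  let W : Finset X := {z | p x ≤ p z ∧ p z < p (σ x)}
  have hlast : ∀ z ∈ W, z ≠ a₀ → R z ≠ a₁ := by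
    intro z hz _ hcon
    simp only [W, Finset.mem_filter, Finset.mem_univ, true_and] at hz
    exact absurd (h.last z (σ x) hcon) (not_le.2 hz.2)
  have hnext : ∀ z ∈ W, p z < p (next z) ∧ ∀ t, p z < p t → p (next z) ≤ p t := by
    intro z hz
    by_cases hz0 : z = a₀
    · simp only [next, if_pos hz0]
      rw [hz0]
      exact ⟨h.lt, h.le⟩
    · simp only [next, if_neg hz0]
      exact ⟨h.lt_apply z hz0 (hlast z hz hz0), fun t => h.apply_le z t hz0 (hlast z hz hz0)⟩
  have hsum : ∀ u : X → ℚ, (∀ z, u (σ z) = u z) → ∑ z ∈ W, (u z - u (R z)) =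
      if p x ≤ p a₀ ∧ p a₀ < p (σ x) then u a₀ - u (R a₀) else 0 := by
    intro u hu
    have e1 : ∑ z ∈ W, u (next z) = ∑ z with p x < p z ∧ p z ≤ p (σ x), u z := by
      refine Finset.sum_nbij next ?_ ?_ ?_ fun _ _ => rfl
      · intro z hz
        have hn := hnext z hz
        simp only [W, Finset.mem_filter, Finset.mem_univ, true_and] at hz ⊢
        exact ⟨hz.1.trans_lt hn.1, hn.2 _ hz.2⟩
      · intro z hz t ht hzt
        have hn1 := hnext z hz
        have hn2 := hnext t ht
        rcases lt_trichotomy (p z) (p t) with h1 | h1 | h1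
        · have h2 := hn1.2 _ h1
          rw [hzt] at h2
          exact absurd hn2.1 (not_lt.2 h2)
        · exact h.inj h1
        · have h2 := hn2.2 _ h1
          rw [← hzt] at h2
          exact absurd hn1.1 (not_lt.2 h2)
      · intro t ht
        simp only [Finset.coe_filter, Finset.mem_univ, true_and, Set.mem_ofPred_eq] at ht
        -- The place before `t` is the last one among those before `t` in the interval.
        obtain ⟨z, hz, hmax⟩ := Finset.exists_max_image
          (Finset.univ.filter fun z => p x ≤ p z ∧ p z < p t) p ⟨x, by simp [ht.1]⟩
        simp only [Finset.mem_filter, Finset.mem_univ, true_and] at hz hmax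
        have hzW : z ∈ W := by
          simpa [W] using ⟨hz.1, hz.2.trans_le ht.2⟩
        have hn := hnext z hzW
        refine ⟨z, hzW, h.inj ((hn.2 t hz.2).antisymm ?_)⟩
        by_contra! hlt
        exact absurd hn.1 (not_lt.2 (hmax _ ⟨hz.1.trans hn.1.le, hlt⟩))
    have e2 : ∑ z ∈ W, u z = ∑ z with p x < p z ∧ p z ≤ p (σ x), u z := by
      have s1 : W = insert x (Finset.univ.filter fun z => p x < p z ∧ p z < p (σ x)) := by
        ext z
        simp only [W, Finset.mem_filter, Finset.mem_univ, true_and, Finset.mem_insert]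
        constructor
        · rintro ⟨h1, h2⟩
          rcases h1.lt_or_eq with h3 | h3
          · exact Or.inr ⟨h3, h2⟩
          · exact Or.inl (h.inj h3.symm)
        · rintro (rfl | ⟨h1, h2⟩)
          · exact ⟨le_rfl, hxy.trans hy⟩
          · exact ⟨h1.le, h2⟩
      have s2 : (Finset.univ.filter fun z => p x < p z ∧ p z ≤ p (σ x)) =
          insert (σ x) (Finset.univ.filter fun z => p x < p z ∧ p z < p (σ x)) := by
        ext z
        simp only [Finset.mem_filter, Finset.mem_univ, true_and, Finset.mem_insert]
        constructor
        · rintro ⟨h1, h2⟩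
          rcases h2.lt_or_eq with h3 | h3
          · exact Or.inr ⟨h1, h3⟩
          · exact Or.inl (h.inj h3)
        · rintro (rfl | ⟨h1, h2⟩)
          · exact ⟨hxy.trans hy, le_rfl⟩
          · exact ⟨h1, h2.le⟩
      rw [s1, s2, Finset.sum_insert (by simp), Finset.sum_insert (by simp), hu]
    have e3 : ∑ z ∈ W, (u (next z) - u (R z)) =
        if p x ≤ p a₀ ∧ p a₀ < p (σ x) then u a₀ - u (R a₀) else 0 := by
      have : ∀ z ∈ W, u (next z) - u (R z) = if z = a₀ then u a₀ - u (R a₀) else 0 := by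
        intro z _
        by_cases hz0 : z = a₀
        · rw [if_pos hz0, hz0, ← hu a₀, h01]
          simp [next]
        · simp [next, hz0]
      rw [Finset.sum_congr rfl this, Finset.sum_ite_eq']
      simp [W]
    rw [← e3]
    simp only [Finset.sum_sub_distrib, e1, e2]
  let w : X → ℚ := fun z => if z ∈ W ∧ z ≠ a₀ then 1 else 0
  have hcR : numCycles R = 2 := h.numCycles_eq
  have htrans := h.jointlyTransitive h01
  have hw : ∀ u : X → ℚ, (∀ z, u (R (φ⁻¹ z)) = u z) → ∑ z, (u z - u (R z)) * w z = 0 := by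
    intro u hu
    have hu' : ∀ z, u (σ z) = u z := fun z => by simpa [hR] using hu z
    have : ∑ z, (u z - u (R z)) * w z = ∑ z ∈ W, (u z - u (R z)) -
        if p x ≤ p a₀ ∧ p a₀ < p (σ x) then u a₀ - u (R a₀) else 0 := by
      have h1 : ∀ z, (u z - u (R z)) * w z = (if z ∈ W then u z - u (R z) else 0) -
          if z = a₀ then (if a₀ ∈ W then u a₀ - u (R a₀) else 0) else 0 := by
        intro z
        by_cases hz0 : z = a₀
        · subst hz0
          simp [w]
        · simp [w, hz0]
      rw [Finset.sum_congr rfl fun z _ => h1 z, Finset.sum_sub_distrib, Finset.sum_ite_mem,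
        Finset.univ_inter, Finset.sum_ite_eq' Finset.univ a₀]
      simp [W]
    rw [this, hsum u hu', sub_self]
  have hprod : R * φ⁻¹ = σ := by rw [hR, mul_inv_cancel_right]
  have hinvc : numCycles φ⁻¹ = numCycles φ := by
    unfold numCycles
    exact Nat.card_congr (Quotient.congr (Equiv.refl X) fun a b => by
      exact Equiv.Perm.sameCycle_inv)
  have htrans' : JointlyTransitive φ⁻¹ R := by
    intro s t
    obtain ⟨g, hg, h1⟩ := htrans s t
    refine ⟨g, ?_, h1⟩
    refine (Subgroup.closure_le _).2 ?_ hg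
    have hφ : φ ∈ Subgroup.closure ({φ⁻¹, R} : Set (Equiv.Perm X)) := by
      rw [← Subgroup.inv_mem_iff]
      exact Subgroup.subset_closure (by simp)
    rintro s (rfl | rfl)
    · exact hφ
    · have hRm : R ∈ Subgroup.closure ({φ⁻¹, R} : Set (Equiv.Perm X)) :=
        Subgroup.subset_closure (by simp)
      have := Subgroup.mul_mem _ hRm (Subgroup.inv_mem _ hφ)
      rwa [hprod] at this
  obtain ⟨α, β, hα, hβ, hwab⟩ := exists_invariant_add (K := ℚ) htrans'
    (by rw [hprod, hinvc]; omega) w hw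
  have hα' : ∀ z, α (φ z) = α z := fun z => by simpa using (hα (φ z)).symm
  have hβ0 : ∀ z, β z = β a₀ ∨ β z = β a₁ := fun z => (h.orbit z).imp
    (fun hx => (SameCycle.apply_eq (a := R) hβ hx).symm)
    (fun hx => (SameCycle.apply_eq (a := R) hβ hx).symm)
  -- The weights of `a₀` and of the place before `a₁` are both zero.
  have hβ1 : β a₀ = β a₁ := by
    set l := R⁻¹ a₁ with hl
    have hRl : R l = a₁ := by simp [hl]
    have hφl : φ l = a₀ := σ.injective (by rw [h01, ← hRl]; rfl)
    have hwl : w l = 0 := by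
      have : l ∉ W := by
        simp only [W, Finset.mem_filter, Finset.mem_univ, true_and, not_and, not_lt]
        exact fun _ => h.last l _ hRl
      simp [w, this]
    have hw0 : w a₀ = 0 := by simp [w]
    have h1 := hwab l
    have h2 := hwab a₀
    rw [← hβ l, hRl] at h1
    rw [← hφl, hα', hφl] at h2
    linarith
  have hwφ : ∀ z, w (φ z) = w z := by
    intro z
    rw [hwab, hwab, hα']
    rcases hβ0 z with h1 | h1 <;> rcases hβ0 (φ z) with h2 | h2 <;> rw [h1, h2] <;> linarith
  have hyW : y ∈ W := by simpa [W] using ⟨hxy.le, hy⟩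
  have hyx : σ y ≠ σ x := σ.injective.ne (by rintro rfl; exact lt_irrefl _ hxy)
  by_cases hy0 : y = a₀
  · subst hy0
    rw [h01]
    refine ⟨hxy.trans h.lt, lt_of_le_of_ne (h.le _ hy) fun h1 => ?_⟩
    exact hyx (by rw [h01]; exact h.inj h1)
  · obtain ⟨t, rfl⟩ := φ.surjective y
    have h1 : w (φ t) = 1 := by simp [w, hyW, hy0]
    rw [hwφ] at h1
    have ht : t ∈ W ∧ t ≠ a₀ := by
      by_contra hcon
      simp [w, hcon] at h1
    have hn := hnext t ht.1
    simp only [next, if_neg ht.2] at hn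
    have ht1 := ht.1
    simp only [W, Finset.mem_filter, Finset.mem_univ, true_and] at ht1
    exact ⟨ht1.1.trans_lt hn.1, lt_of_le_of_ne (hn.2 _ ht1.2) (h.inj.ne hyx)⟩

end IsSlitRim

end SlitRim


/-! ### Cyclic permutations as linear orders -/

section CycleRank

variable {X : Type*} [Finite X] {s : Equiv.Perm X} {w : X}

theorem exists_pow_succ_apply_eq (h : ∀ x, s.SameCycle w x) (x : X) :
    ∃ k : ℕ, (s ^ (k + 1)) w = x := by
  obtain ⟨n, hn⟩ := (Equiv.Perm.sameCycle_apply_left.2 (h x)).exists_nat_pow_eq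
  exact ⟨n, by rw [pow_succ, Equiv.Perm.mul_apply, hn]⟩

open Classical in
/-- The place of `x` in the linear order of a cycle that starts after `w` and ends with `w`. -/
noncomputable def cycleRank (h : ∀ x, s.SameCycle w x) (x : X) : ℕ :=
  Nat.find (exists_pow_succ_apply_eq h x)

variable (h : ∀ x, s.SameCycle w x)

theorem pow_cycleRank (x : X) : (s ^ (cycleRank h x + 1)) w = x := by
  classical
  exact Nat.find_spec (exists_pow_succ_apply_eq h x)

theorem cycleRank_le {x : X} {k : ℕ} (hk : (s ^ (k + 1)) w = x) : cycleRank h x ≤ k := by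
  classical
  exact Nat.find_min' (exists_pow_succ_apply_eq h x) hk

theorem cycleRank_injective : Function.Injective (cycleRank h) := fun x y hxy => by
  rw [← pow_cycleRank h x, hxy, pow_cycleRank]

theorem cycleRank_apply_self : cycleRank h (s w) = 0 :=
  Nat.le_zero.1 (cycleRank_le h (by simp))

theorem cycleRank_apply {x : X} (hx : x ≠ w) : cycleRank h (s x) = cycleRank h x + 1 := by
  refine le_antisymm (cycleRank_le h ?_) ?_
  · rw [pow_succ', Equiv.Perm.mul_apply, pow_cycleRank]
  · have h1 := pow_cycleRank h (s x)
    by_contra! hlt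
    rw [pow_succ', Equiv.Perm.mul_apply] at h1
    have h2 := s.injective h1
    rcases hk : cycleRank h (s x) with _ | k
    · rw [hk] at h2
      exact hx (by simpa using h2.symm)
    · rw [hk] at h2
      have := cycleRank_le h h2
      omega

theorem cycleRank_le_self (x : X) : cycleRank h x ≤ cycleRank h w := by
  by_contra! hlt
  obtain ⟨m, hm⟩ := Nat.exists_eq_add_of_lt hlt
  have h1 := pow_cycleRank h x
  have h2 := pow_cycleRank h w
  rw [hm, show cycleRank h w + m + 1 + 1 = (m + 1) + (cycleRank h w + 1) by ring, pow_add,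
    Equiv.Perm.mul_apply, h2] at h1
  have := cycleRank_le h h1
  omega

end CycleRank

/-! ### Stacking the edges over each interval -/

namespace EmbeddedGraph

variable {Y : Type*} {E : EmbeddedGraph Y} {lev : Y → ℕ}

open Classical in
/-- The places on the boundary of a disk are the edges over the two intervals next to it. -/
noncomputable def placeEquiv (E : EmbeddedGraph Y) (lev : Y → ℕ) (j : ℕ) :
    {d // E.Leaves lev j d} ≃ {d // E.Crosses lev (j + 1) d} ⊕ {d // E.Crosses lev j d} where
  toFun d := if h : E.Crosses lev (j + 1) d then Sum.inl ⟨d, h⟩ else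
    Sum.inr ⟨E.opp d, d.2.resolve_left h⟩
  invFun := Sum.elim (fun d => ⟨d, Or.inl d.2⟩)
    fun d => ⟨E.opp d, Or.inr (by rw [E.opp_opp]; exact d.2)⟩
  left_inv d := by
    by_cases h : E.Crosses lev (j + 1) d
    · simp [h]
    · simp [h, E.opp_opp]
  right_inv := by
    rintro (d | d)
    · simp [d.2]
    · have h : ¬ E.Crosses lev (j + 1) (E.opp d) :=
        not_crosses_of_crosses_opp (j := j) (by rw [E.opp_opp]; exact d.2)
      simp [h, E.opp_opp]

/-- Given cyclic orders `next i` of the edges over each interval, the next place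
on the boundary of the disk: upwards on the right side and downwards on the left side. -/
noncomputable def rimNext (next : ∀ i, Equiv.Perm {d // E.Crosses lev i d}) (j : ℕ) :
    Equiv.Perm {d // E.Leaves lev j d} :=
  (E.placeEquiv lev j).trans
    ((Equiv.sumCongr (next (j + 1)) (next j).symm).trans (E.placeEquiv lev j).symm)

variable {next : ∀ i, Equiv.Perm {d // E.Crosses lev i d}}

theorem rimNext_right {j : ℕ} {d : Y} (h : E.Crosses lev (j + 1) d) :
    rimNext next j ⟨d, Or.inl h⟩ = ⟨next (j + 1) ⟨d, h⟩, Or.inl (next (j + 1) ⟨d, h⟩).2⟩ := by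
  simp [rimNext, placeEquiv, h]

theorem rimNext_left {j : ℕ} {d : Y} (h : E.Crosses lev j (E.opp d)) :
    rimNext next j ⟨d, Or.inr h⟩ = ⟨E.opp ((next j).symm ⟨E.opp d, h⟩),
      Or.inr (by rw [E.opp_opp]; exact ((next j).symm ⟨E.opp d, h⟩).2)⟩ := by
  have h1 : ¬ E.Crosses lev (j + 1) d := not_crosses_of_crosses_opp h
  simp [rimNext, placeEquiv, h1]

/-- Cyclic orders of the edges over each interval, together with a prescription of the places of
each disk at which the next place of the same component comes later on the rim. The edge of `w`
lies over all intervals: the cyclic orders are to become linear orders that end with `w`. The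
permutation `(turnPerm j)⁻¹ * rimNext next j` describes the pieces into which the components cut the
disk. -/
structure Stacking [Finite Y] (E : EmbeddedGraph Y) (lev : Y → ℕ) (w : Y) (M : ℕ) where
  isLevel : E.IsLevel lev
  lev_left : lev w = 0
  lev_right : lev (E.opp w) = M + 1
  next : ∀ i, Equiv.Perm {d // E.Crosses lev i d}
  fwd : ∀ j, {d // E.Leaves lev j d} → Prop
  unique_fwd : ∀ j < M, ∀ x y, fwd j x → fwd j y →
    ((isLevel.turnPerm j)⁻¹ * rimNext next j).SameCycle x y → x = y
  unique_not_fwd : ∀ j < M, ∀ x y, ¬ fwd j x → ¬ fwd j y → (isLevel.turnPerm j).SameCycle x y →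
    x = y
  fwd_right : ∀ j x, x.1 = w → fwd j x

namespace Stacking

variable [Finite Y] {w : Y} {M : ℕ} (S : Stacking E lev w M)

include S in
theorem crosses {i : ℕ} (hi : i ≤ M) : E.Crosses lev i w := by
  unfold Crosses
  rw [S.lev_left, S.lev_right]
  omega

/-- The edge of `d` is met in the cyclic order that starts at the edge of `w`. -/
def Reached (i : ℕ) (d : Y) : Prop :=
  ∃ (hi : i ≤ M) (hd : E.Crosses lev i d), (S.next i).SameCycle ⟨w, S.crosses hi⟩ ⟨d, hd⟩

/-- The place `d` is met in the cyclic order that starts at the edge of `w`. -/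
def RimReached (j : ℕ) (d : Y) : Prop := S.Reached (j + 1) d ∨ S.Reached j (E.opp d)

theorem rimReached_right {j : ℕ} {d : Y} (h : E.Crosses lev (j + 1) d) :
    S.RimReached j d ↔ S.Reached (j + 1) d := by
  refine or_iff_left ?_
  rintro ⟨-, h', -⟩
  exact not_crosses_of_crosses_opp h' h

theorem rimReached_left {j : ℕ} {d : Y} (h : E.Crosses lev j (E.opp d)) :
    S.RimReached j d ↔ S.Reached j (E.opp d) := by
  refine or_iff_right ?_
  rintro ⟨-, h', -⟩
  exact not_crosses_of_crosses_opp h h'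

/-- The place at which the edge of `w` leaves the disk to the right. -/
def rightEnd {j : ℕ} (hj : j < M) : {d // E.Leaves lev j d} := ⟨w, Or.inl (S.crosses hj)⟩

/-- The place at which the edge of `w` leaves the disk to the left. -/
def leftEnd {j : ℕ} (hj : j < M) : {d // E.Leaves lev j d} :=
  ⟨E.opp w, Or.inr (by rw [E.opp_opp]; exact S.crosses hj.le)⟩

theorem turn_rightEnd {j : ℕ} (hj : j < M) :
    S.isLevel.turnPerm j (S.rightEnd hj) = S.leftEnd hj := by
  refine Subtype.ext ?_
  rw [S.isLevel.turnPerm_apply]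
  exact if_neg (by rw [rightEnd, S.lev_left]; omega)

theorem crosses_rimNext {j : ℕ} (x : {d // E.Leaves lev j d}) :
    E.Crosses lev (j + 1) (rimNext S.next j x : Y) ↔ E.Crosses lev (j + 1) x := by
  obtain ⟨x, h | h⟩ := x
  · rw [rimNext_right h]
    exact iff_of_true (S.next (j + 1) _).2 h
  · rw [rimNext_left h]
    refine iff_of_false (not_crosses_of_crosses_opp (j := j) ?_) (not_crosses_of_crosses_opp h)
    rw [E.opp_opp]
    exact Subtype.prop _

theorem not_sameCycle {j : ℕ} (hj : j < M) :
    ¬ (rimNext S.next j).SameCycle (S.rightEnd hj) (S.leftEnd hj) := by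
  intro h
  have := SameCycle.apply_eq (a := rimNext S.next j)
    (g := fun x => E.Crosses lev (j + 1) (x : Y)) (fun x => propext (S.crosses_rimNext x)) h
  have h2 : E.Crosses lev (j + 1) (E.opp w) := this.mp (S.crosses hj)
  exact not_crosses_of_crosses_opp (j := j) (by rw [E.opp_opp]; exact S.crosses hj.le) h2

theorem rimReached_iff {j : ℕ} (hj : j < M) (x : {d // E.Leaves lev j d}) :
    S.RimReached j x ↔ (rimNext S.next j).SameCycle (S.rightEnd hj) x ∨
      (rimNext S.next j).SameCycle (S.leftEnd hj) x := by
  constructor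
  · rintro (⟨hi, hd, h⟩ | ⟨hi, hd, h⟩)
    · left
      exact of_sameCycle (S := fun y => (rimNext S.next j).SameCycle (S.rightEnd hj)
        ⟨y.1, Or.inl y.2⟩) (fun y hy => by
          have := Equiv.Perm.sameCycle_apply_right.2 hy
          rwa [rimNext_right y.2] at this) h (Equiv.Perm.SameCycle.refl _ _)
    · right
      have := of_sameCycle (s := S.next j) (S := fun y => (rimNext S.next j).SameCycle
        (S.leftEnd hj) ⟨E.opp y.1, Or.inr (by rw [E.opp_opp]; exact y.2)⟩) (fun y hy => by
          rw [← Equiv.Perm.sameCycle_apply_right,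
            rimNext_left (by rw [E.opp_opp]; exact Subtype.prop _)]
          simpa [E.opp_opp] using hy) h (Equiv.Perm.SameCycle.refl _ _)
      simpa [E.opp_opp] using this
  · rintro (h | h)
    · refine of_sameCycle (S := fun y : {d // E.Leaves lev j d} => S.RimReached j y) ?_ h
        (Or.inl ⟨hj, _, Equiv.Perm.SameCycle.refl _ _⟩)
      rintro ⟨y, hy | hy⟩ h1
      · rw [S.rimReached_right hy] at h1
        obtain ⟨hi, hd, h1⟩ := h1
        rw [rimNext_right hy]
        exact Or.inl ⟨hi, _, Equiv.Perm.sameCycle_apply_right.2 h1⟩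
      · rw [S.rimReached_left hy] at h1
        obtain ⟨hi, hd, h1⟩ := h1
        rw [rimNext_left hy]
        refine Or.inr ⟨hi, by rw [E.opp_opp]; exact Subtype.prop _, ?_⟩
        simp only [E.opp_opp]
        exact Equiv.Perm.sameCycle_symm_apply_right.2 h1
    · refine of_sameCycle (S := fun y : {d // E.Leaves lev j d} => S.RimReached j y) ?_ h
        (Or.inr ⟨hj.le, (by rw [leftEnd, E.opp_opp]; exact S.crosses hj.le), ?_⟩)
      · rintro ⟨y, hy | hy⟩ h1
        · rw [S.rimReached_right hy] at h1
          obtain ⟨hi, hd, h1⟩ := h1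
          rw [rimNext_right hy]
          exact Or.inl ⟨hi, _, Equiv.Perm.sameCycle_apply_right.2 h1⟩
        · rw [S.rimReached_left hy] at h1
          obtain ⟨hi, hd, h1⟩ := h1
          rw [rimNext_left hy]
          refine Or.inr ⟨hi, by rw [E.opp_opp]; exact Subtype.prop _, ?_⟩
          simp only [E.opp_opp]
          exact Equiv.Perm.sameCycle_symm_apply_right.2 h1
      · simp [leftEnd, E.opp_opp, Equiv.Perm.SameCycle.refl]

theorem rimReached_turn {j : ℕ} (hj : j < M) {d : Y} (hd : E.Leaves lev j d) :
    S.RimReached j (E.turn lev j d) ↔ S.RimReached j d := by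
  classical
  have := Fintype.ofFinite Y
  have key : ∀ x, S.RimReached j (x : {d // E.Leaves lev j d}) →
      S.RimReached j (S.isLevel.turnPerm j x : {d // E.Leaves lev j d}) := by
    intro x hx
    have hprod : S.isLevel.turnPerm j * ((S.isLevel.turnPerm j)⁻¹ * rimNext S.next j) =
        rimNext S.next j := mul_inv_cancel_left _ _
    set φ := (S.isLevel.turnPerm j)⁻¹ * rimNext S.next j
    set H := Subgroup.closure ({φ, S.isLevel.turnPerm j} : Set (Equiv.Perm {d // E.Leaves lev j d}))
    have hφ : φ ∈ H := Subgroup.subset_closure (by simp)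
    have hσ : S.isLevel.turnPerm j ∈ H := Subgroup.subset_closure (by simp)
    have hR : rimNext S.next j ∈ H := hprod ▸ H.mul_mem hσ hφ
    have h1 : ∃ g ∈ H, g (S.rightEnd hj) = x := by
      rcases (S.rimReached_iff hj x).1 hx with ⟨n, hn⟩ | ⟨n, hn⟩
      · exact ⟨_, H.zpow_mem hR n, hn⟩
      · exact ⟨_, H.mul_mem (H.zpow_mem hR n) hσ, by
          rw [Equiv.Perm.mul_apply, S.turn_rightEnd hj, hn]⟩
    obtain ⟨g, hg, hgx⟩ := h1
    have := sameCycle_or_sameCycle (S.unique_fwd j hj) (S.unique_not_fwd j hj)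
      (by rw [hprod]; exact S.not_sameCycle hj) ⟨_, hσ, S.turn_rightEnd hj⟩
      (z := S.isLevel.turnPerm j x) ⟨S.isLevel.turnPerm j * g, H.mul_mem hσ hg, by
        rw [Equiv.Perm.mul_apply, hgx]⟩
    rw [hprod] at this
    exact (S.rimReached_iff hj _).2 this
  refine ⟨fun h => ?_, key ⟨d, hd⟩⟩
  exact of_sameCycle (s := S.isLevel.turnPerm j)
    (S := fun x : {d // E.Leaves lev j d} => S.RimReached j x) key
    (x := S.isLevel.turnPerm j ⟨d, hd⟩) (y := ⟨d, hd⟩)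
    (Equiv.Perm.sameCycle_apply_left.2 (Equiv.Perm.SameCycle.refl _ _)) h

/-- Every edge is met. -/
def Total : Prop :=
  ∀ i (hi : i ≤ M), ∀ x, (S.next i).SameCycle ⟨w, S.crosses hi⟩ x

variable {S} (hS : S.Total)

open Classical in
/-- The height of an edge over an interval, in the linear order that ends with `w`; zero for a
dart that does not cross the interval. -/
noncomputable def height (hS : S.Total) (i : ℕ) (d : Y) : ℤ :=
  if h : i ≤ M ∧ E.Crosses lev i d then cycleRank (hS i h.1) ⟨d, h.2⟩ else 0

theorem height_eq {i : ℕ} (hi : i ≤ M) (d : {d // E.Crosses lev i d}) :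
    height hS i d = cycleRank (hS i hi) d := dif_pos ⟨hi, d.2⟩

theorem height_injective {i : ℕ} (hi : i ≤ M) {a b : Y} (ha : E.Crosses lev i a)
    (hb : E.Crosses lev i b) (h : height hS i a = height hS i b) : a = b := by
  rw [height_eq hS hi ⟨a, ha⟩, height_eq hS hi ⟨b, hb⟩, Nat.cast_inj] at h
  exact congrArg Subtype.val (cycleRank_injective _ h)

theorem height_next {i : ℕ} (hi : i ≤ M) {d : {d // E.Crosses lev i d}} (hd : d.1 ≠ w) :
    height hS i (S.next i d) = height hS i d + 1 := by
  rw [height_eq hS hi, height_eq hS hi, cycleRank_apply]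
  · push_cast
    rfl
  · rintro rfl
    exact hd rfl

theorem height_next_self {i : ℕ} (hi : i ≤ M) {d : {d // E.Crosses lev i d}} (hd : d.1 = w) :
    height hS i (S.next i d) = 0 := by
  obtain ⟨d, h⟩ := d
  obtain rfl : d = w := hd
  rw [height_eq hS hi, cycleRank_apply_self]
  rfl

theorem height_nonneg {i : ℕ} (d : Y) : 0 ≤ height hS i d := by
  unfold height
  split_ifs <;> positivity

theorem height_le {i : ℕ} (hi : i ≤ M) {d : Y} (hd : E.Crosses lev i d) :
    height hS i d ≤ height hS i w := by
  rw [height_eq hS hi ⟨d, hd⟩, height_eq hS hi ⟨w, S.crosses hi⟩]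
  exact_mod_cast cycleRank_le_self _ _

/-- The order of the places given by the heights. -/
noncomputable def place (hS : S.Total) (j : ℕ) (x : {d // E.Leaves lev j d}) : ℤ ×ₗ ℤ :=
  E.rimPos lev (height hS) j x

theorem place_right {j : ℕ} {d : Y} (h : E.Crosses lev (j + 1) d) :
    place hS j ⟨d, Or.inl h⟩ = toLex (0, height hS (j + 1) d) := rimPos_right h

theorem place_left {j : ℕ} {d : Y} (h : E.Crosses lev j (E.opp d)) :
    place hS j ⟨d, Or.inr h⟩ = toLex (3, -height hS j (E.opp d)) := rimPos_left h

theorem isSlitRim {j : ℕ} (hj : j < M) :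
    IsSlitRim (place hS j) (rimNext S.next j) (S.rightEnd hj) (S.leftEnd hj) where
  inj := by
    rintro ⟨a, ha | ha⟩ ⟨b, hb | hb⟩ h
    · rw [place_right hS ha, place_right hS hb] at h
      simp at h
      exact Subtype.ext (height_injective hS hj ha hb h)
    · rw [place_right hS ha, place_left hS hb] at h
      simp at h
    · rw [place_left hS ha, place_right hS hb] at h
      simp at h
    · rw [place_left hS ha, place_left hS hb] at h
      simp at h
      exact Subtype.ext (E.opp.injective (height_injective hS hj.le ha hb h))
  lt_apply := by
    rintro ⟨a, ha | ha⟩ h0 h1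
    · rw [rimNext_right ha, place_right hS ha, place_right hS (Subtype.prop _),
        height_next hS hj fun h => h0 (Subtype.ext h)]
      simp [Prod.Lex.toLex_lt_toLex]
    · rw [rimNext_left ha] at h1 ⊢
      rw [place_left hS ha, place_left hS (by rw [E.opp_opp]; exact Subtype.prop _), E.opp_opp]
      have := height_next hS hj.le (d := (S.next j).symm ⟨E.opp a, ha⟩)
        fun h => h1 (Subtype.ext (congrArg E.opp h))
      rw [Equiv.apply_symm_apply] at this
      simp only [Prod.Lex.toLex_lt_toLex]
      right
      simp only [this]
      simp
  apply_le := by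
    rintro ⟨a, ha | ha⟩ ⟨b, hb | hb⟩ h0 h1
    · rw [rimNext_right ha, place_right hS ha, place_right hS hb, place_right hS (Subtype.prop _),
        height_next hS hj fun h => h0 (Subtype.ext h)]
      simp [Prod.Lex.toLex_lt_toLex, Prod.Lex.toLex_le_toLex]
    · rw [rimNext_right ha, place_right hS ha, place_left hS hb, place_right hS (Subtype.prop _)]
      simp [Prod.Lex.toLex_le_toLex]
    · rw [place_left hS ha, place_right hS hb]
      simp [Prod.Lex.toLex_lt_toLex]
    · rw [rimNext_left ha] at h1 ⊢
      rw [place_left hS ha, place_left hS hb,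
        place_left hS (by rw [E.opp_opp]; exact Subtype.prop _), E.opp_opp]
      have := height_next hS hj.le (d := (S.next j).symm ⟨E.opp a, ha⟩)
        fun h => h1 (Subtype.ext (congrArg E.opp h))
      rw [Equiv.apply_symm_apply] at this
      change height hS j (E.opp a) = _ at this
      simp only [Prod.Lex.toLex_lt_toLex, Prod.Lex.toLex_le_toLex, true_and, lt_irrefl, false_or]
      omega
  lt := by
    rw [rightEnd, leftEnd, place_right hS (S.crosses hj),
      place_left hS (by rw [E.opp_opp]; exact S.crosses hj.le)]
    simp [Prod.Lex.toLex_lt_toLex]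
  le := by
    rintro ⟨b, hb | hb⟩
    · rw [rightEnd, place_right hS (S.crosses hj), place_right hS hb]
      have := height_le hS hj hb
      simp [Prod.Lex.toLex_lt_toLex, not_lt.2 this]
    · intro _
      rw [leftEnd, place_left hS (by rw [E.opp_opp]; exact S.crosses hj.le), place_left hS hb,
        E.opp_opp]
      have := height_le hS hj.le hb
      simp [Prod.Lex.toLex_le_toLex, this]
  last := by
    rintro ⟨a, ha | ha⟩ ⟨b, hb⟩ h
    · have h1 := (S.crosses_rimNext ⟨a, Or.inl ha⟩).2 ha
      rw [h] at h1
      exact absurd h1 (not_crosses_of_crosses_opp (j := j) (by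
        rw [leftEnd, E.opp_opp]; exact S.crosses hj.le))
    · rw [rimNext_left ha] at h
      have h1 : ((S.next j).symm ⟨E.opp a, ha⟩).1 = w :=
        E.opp.injective (congrArg Subtype.val h)
      have h2 := height_next_self hS hj.le h1
      rw [Equiv.apply_symm_apply] at h2
      rw [place_left hS ha]
      rcases hb with hb | hb
      · rw [place_right hS hb]
        simp [Prod.Lex.toLex_le_toLex]
      · rw [place_left hS hb]
        have := height_nonneg hS (i := j) (E.opp b)
        change height hS j (E.opp a) = _ at h2
        simp only [Prod.Lex.toLex_le_toLex, true_and, lt_irrefl, false_or]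
        omega
  orbit := by
    intro x
    rw [← S.rimReached_iff hj]
    obtain ⟨x, h | h⟩ := x
    · exact Or.inl ⟨hj, h, hS _ hj _⟩
    · exact Or.inr ⟨hj.le, h, hS _ hj.le _⟩
  not_sameCycle := S.not_sameCycle hj

include hS in
theorem fwd_iff_and_noncrossing {j : ℕ} (hj : j < M) :
    (∀ x, S.fwd j x ↔ place hS j x < place hS j (S.isLevel.turnPerm j x)) ∧
      ∀ x y, place hS j x < place hS j y → place hS j y < place hS j (S.isLevel.turnPerm j x) →
        place hS j x < place hS j (S.isLevel.turnPerm j y) ∧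
          place hS j (S.isLevel.turnPerm j y) < place hS j (S.isLevel.turnPerm j x) := by
  classical
  have := Fintype.ofFinite Y
  have hprod : S.isLevel.turnPerm j * ((S.isLevel.turnPerm j)⁻¹ * rimNext S.next j) =
      rimNext S.next j := mul_inv_cancel_left _ _
  have hrim := isSlitRim hS hj
  rw [← hprod] at hrim
  obtain ⟨h1, h2⟩ := hrim.forward_iff (S.turn_rightEnd hj) (S.unique_fwd j hj)
    (S.unique_not_fwd j hj) (S.fwd_right j _ rfl)
  exact ⟨h2, hrim.noncrossing (S.turn_rightEnd hj) h1⟩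

end Stacking

end EmbeddedGraph


/-! ### The line above the folding -/

namespace EmbeddedGraph

variable {D : Type*} (G : EmbeddedGraph D)

/-- The graph with an additional edge, with the darts `inr true` and `inr false`. In a folding this
edge is the line above all other edges, so that the outer face is cut open. -/
def withLine : EmbeddedGraph (D ⊕ Bool) where
  rot := Equiv.sumCongr G.rot (Equiv.refl Bool)
  opp := Equiv.sumCongr G.opp Equiv.boolNot
  opp_opp := by
    rintro (d | b)
    · simp [G.opp_opp]
    · simp
  opp_ne := by
    rintro (d | b)
    · simpa using G.opp_ne d
    · simp

@[simp]
theorem withLine_opp_inr (b : Bool) : G.withLine.opp (Sum.inr b) = Sum.inr !b := rfl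

/-- The levels of the graph with the additional edge, for levels of the graph from `1` to `M`. -/
def lineLevel (lev : D → ℕ) (M : ℕ) : D ⊕ Bool → ℕ :=
  Sum.elim lev fun b => if b then 0 else M + 1

variable {G} {lev : D → ℕ} {M : ℕ}

theorem IsLevel.withLine (hl : G.IsLevel lev) : G.withLine.IsLevel (lineLevel lev M) where
  rot := by
    rintro (d | b)
    · exact hl.rot d
    · rfl
  ne := by
    rintro (d | _ | _)
    · exact hl.ne d
    · simp [lineLevel]
    · simp [lineLevel]

theorem crosses_withLine_true {i : ℕ} :
    G.withLine.Crosses (lineLevel lev M) i (Sum.inr true) ↔ i ≤ M := by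
  simp [Crosses, lineLevel]

theorem not_crosses_withLine_false {i : ℕ} :
    ¬ G.withLine.Crosses (lineLevel lev M) i (Sum.inr false) := by
  simp [Crosses, lineLevel]

theorem turn_withLine_inl (j : ℕ) (d : D) :
    G.withLine.turn (lineLevel lev M) j (Sum.inl d) = Sum.inl (G.turn lev j d) := by
  unfold turn
  by_cases h : lev d = j + 1
  · rw [if_pos h]
    exact if_pos h
  · rw [if_neg h]
    exact if_neg h

theorem turn_withLine_inr {j : ℕ} (hj : j < M) (b : Bool) :
    G.withLine.turn (lineLevel lev M) j (Sum.inr b) = Sum.inr !b :=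
  if_neg (by cases b <;> simp [lineLevel]; omega)

theorem rimPos_withLine_inl (height : ℕ → D ⊕ Bool → ℤ) (j : ℕ) (d : D) :
    G.withLine.rimPos (lineLevel lev M) height j (Sum.inl d) =
      G.rimPos lev (fun i d => height i (Sum.inl d)) j d := by
  classical
  unfold rimPos
  exact if_congr Iff.rfl rfl rfl

theorem lt_of_crosses (hM : ∀ d, lev d ≤ M) {i : ℕ} {d : D} (h : G.Crosses lev i d) : i < M :=
  h.2.trans_le (hM _)

theorem lt_of_leaves (hM : ∀ d, lev d ≤ M) {j : ℕ} {d : D} (h : G.Leaves lev j d) : j < M := by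
  rcases h with h | h
  · have := lt_of_crosses hM h
    omega
  · exact lt_of_crosses hM h

namespace Stacking

variable [Finite D] (S : Stacking G.withLine (lineLevel lev M) (Sum.inr true) M)

/-- In a connected graph, all edges are met if one of them is. -/
theorem total (hG : G.Connected) (hl : G.IsLevel lev) (hpos : ∀ d, 0 < lev d)
    (hM : ∀ d, lev d ≤ M) {i₀ : ℕ} {d₀ : D} (h₀ : G.Crosses lev i₀ d₀)
    (hd₀ : S.Reached i₀ (Sum.inl d₀)) : S.Total := by
  rintro i hi ⟨x, hx⟩
  rcases x with d | _ | _
  · have := eq_of_turn_eq hG hl hpos (fun i d => S.Reached i (Sum.inl d))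
      (fun j d => S.RimReached j (Sum.inl d)) (fun j d h => propext (S.rimReached_right h))
      (fun j d h => propext (S.rimReached_left h)) (fun j d h' => by
        rw [← turn_withLine_inl (M := M)]
        exact propext (S.rimReached_turn (lt_of_leaves hM h') h')) h₀ hx
    obtain ⟨_, _, h⟩ := this.mp hd₀
    exact h
  · exact absurd hx not_crosses_withLine_false
  · exact Equiv.Perm.SameCycle.refl _ _

end Stacking

end EmbeddedGraph

open EmbeddedGraph

namespace Layering

variable {D : Type*} [Finite D] {G : FoldingInput D} {lev : D → ℕ} {M : ℕ}
  {S : Stacking G.withLine (lineLevel lev M) (Sum.inr true) M}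

/-- The layering of the graph given by a stacking of the edges. -/
noncomputable def ofStacking (hS : S.Total) (hl : G.IsLevel lev) (hpos : ∀ d, 0 < lev d)
    (hM : ∀ d, lev d ≤ M)
    (hflat : ∀ d, G.angle d = .flat ↔
      ¬ (lev d < lev (G.opp d) ↔ lev (G.rot d) < lev (G.opp (G.rot d))))
    (hvalley : ∀ j d, lev d = j + 1 →
      (lev d < lev (G.opp d) ↔ lev (G.rot d) < lev (G.opp (G.rot d))) →
      ∀ h, G.angle d = .valley ↔ S.fwd j ⟨Sum.inl d, h⟩)
    (hbottom : ∀ i d h h', S.next i ⟨Sum.inr true, h⟩ = ⟨Sum.inl d, h'⟩ →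
      G.face (G.opp d) = G.outer)
    (htop : ∀ i d h h', S.next i ⟨Sum.inl d, h⟩ = ⟨Sum.inr true, h'⟩ → G.face d = G.outer) :
    Layering G lev where
  isLevel := hl
  pos := hpos
  height i d := Stacking.height hS i (Sum.inl d)
  height_inj i a b ha hb h := Sum.inl_injective
    (Stacking.height_injective hS (lt_of_crosses hM ha).le ha hb h)
  noncrossing := by
    intro j d y hd hy
    have h := (Stacking.fwd_iff_and_noncrossing hS (lt_of_leaves hM hd)).2 ⟨Sum.inl d, hd⟩
      ⟨Sum.inl y, hy⟩
    simp only [Stacking.place, IsLevel.turnPerm_apply, turn_withLine_inl, rimPos_withLine_inl] at h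
    exact h
  flat_iff := hflat
  valley_iff := by
    intro j d hd hside
    have hl' := hl.leaves_of_level_eq hd
    rw [hvalley j d hd hside hl',
      (Stacking.fwd_iff_and_noncrossing hS (lt_of_leaves hM hl')).1 ⟨Sum.inl d, hl'⟩]
    simp only [Stacking.place, IsLevel.turnPerm_apply, turn_withLine_inl, rimPos_withLine_inl]
    rw [turn, if_pos hd]
  outer_bottom := by
    intro i d hd hmin
    have hi := (lt_of_crosses hM hd).le
    have hw := S.crosses hi
    have h0 := Stacking.height_next_self hS hi (d := ⟨Sum.inr true, hw⟩) rfl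
    rcases hn : S.next i ⟨Sum.inr true, hw⟩ with ⟨y | _ | _, hy⟩
    · have := hmin y hy
      rw [hn] at h0
      have h1 := Stacking.height_nonneg hS (i := i) (Sum.inl d)
      have h2 := Stacking.height_injective hS hi (a := Sum.inl d) hd hy
        (by dsimp only at h0 this; omega)
      obtain rfl := Sum.inl_injective h2
      exact hbottom i d _ _ hn
    · exact absurd hy not_crosses_withLine_false
    · rw [hn] at h0
      have h1 := Stacking.height_le hS hi (d := Sum.inl d) hd
      have h2 := Stacking.height_nonneg hS (i := i) (Sum.inl d)
      have h3 := Stacking.height_injective hS hi (a := Sum.inl d) hd hw (by dsimp only at h0; omega)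
      simp at h3
  outer_top := by
    intro i d hd hmax
    have hi := (lt_of_crosses hM hd).le
    have hw := S.crosses hi
    rcases hn : S.next i ⟨Sum.inl d, hd⟩ with ⟨y | _ | _, hy⟩
    · have h0 := Stacking.height_next hS hi (d := ⟨Sum.inl d, hd⟩) (by simp)
      rw [hn] at h0
      have := hmax y hy
      dsimp only at h0 this
      omega
    · exact absurd hy not_crosses_withLine_false
    · exact htop i d _ _ hn

theorem consecutive_ofStacking {hS : S.Total} {hl : G.IsLevel lev} {hpos : ∀ d, 0 < lev d}
    {hM : ∀ d, lev d ≤ M} {hflat} {hvalley} {hbottom} {htop} (i : ℕ) (a b : D) :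
    (ofStacking hS hl hpos hM hflat hvalley hbottom htop).Consecutive i a b ↔
      ∃ ha hb, S.next i ⟨Sum.inl a, ha⟩ = ⟨Sum.inl b, hb⟩ := by
  constructor
  · rintro ⟨ha, hb, hlt, hnext⟩
    change Stacking.height hS i (Sum.inl a) < Stacking.height hS i (Sum.inl b) at hlt
    have hi := (lt_of_crosses hM ha).le
    have hw := S.crosses hi
    refine ⟨ha, hb, Subtype.ext ?_⟩
    have h0 := Stacking.height_next hS hi (d := ⟨Sum.inl a, ha⟩) (by simp)
    refine Stacking.height_injective hS hi (Subtype.prop _) hb ?_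
    rcases hn : S.next i ⟨Sum.inl a, ha⟩ with ⟨y | _ | _, hy⟩
    · rw [hn] at h0
      have : Stacking.height hS i (Sum.inl b) ≤ Stacking.height hS i (Sum.inl y) := hnext y hy (by
        change Stacking.height hS i (Sum.inl a) < Stacking.height hS i (Sum.inl y)
        dsimp only at h0
        omega)
      dsimp only at h0 ⊢
      omega
    · exact absurd hy not_crosses_withLine_false
    · rw [hn] at h0
      have := Stacking.height_le hS hi (d := Sum.inl b) hb
      dsimp only at h0 ⊢
      omega
  · rintro ⟨ha, hb, hn⟩
    have hi := (lt_of_crosses hM ha).le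
    have h0 := Stacking.height_next hS hi (d := ⟨Sum.inl a, ha⟩) (by simp)
    rw [hn] at h0
    refine ⟨ha, hb, ?_, fun e _ hlt => ?_⟩
    · change Stacking.height hS i (Sum.inl a) < Stacking.height hS i (Sum.inl b)
      dsimp only at h0
      omega
    · change Stacking.height hS i (Sum.inl a) < Stacking.height hS i (Sum.inl e) at hlt
      change Stacking.height hS i (Sum.inl b) ≤ Stacking.height hS i (Sum.inl e)
      dsimp only at h0
      omega

end Layering


/-! ### Forward steps along the boundary of a face -/

section ForwardSteps

variable {Z A F : Type*} [Finite Z] [LinearOrder A]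

/-- Let `p z` and `q z` be the two ends of the step at `z`, in the linear order of the rim of a
disk, and let `φ` lead from the start of a step to the step that ends next after it. If the steps do
not cross, then each orbit of `φ` contains at most one forward step: the orbit stays below the step. -/
theorem eq_of_sameCycle_of_forward {φ : Equiv.Perm Z} {p q : Z → A} {fc : Z → F} {w : Z}
    (hfc : ∀ z, z ≠ w → fc (φ z) = fc z)
    (hp : ∀ y z, fc y = fc z → p y = p z → y = z) (hq : ∀ y z, fc y = fc z → q y = q z → y = z)
    (hstep : ∀ z, z ≠ w → φ z ≠ w →
      p z < q (φ z) ∧ ∀ d, fc d = fc z → p z < q d → q (φ z) ≤ q d)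
    (hlast : ∀ z, z ≠ w → φ z = w → ∀ d, fc d = fc z → q d ≤ p z)
    (hNC : ∀ d y, fc d = fc y → p d < q y → q y < q d → p d < p y ∧ p y < q d) {d e : Z}
    (hd : p d < q d) (he : p e < q e) (hde : φ.SameCycle d e) : d = e := by
  have key : ∀ d e, d ≠ w → p d < q d → φ.SameCycle d e →
      fc e = fc d ∧ e ≠ w ∧ p d ≤ p e ∧ p e < q d := by
    intro d e hdw hd hde
    refine of_sameCycle (S := fun z => fc z = fc d ∧ z ≠ w ∧ p d ≤ p z ∧ p z < q d) ?_ hde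
      ⟨rfl, hdw, le_rfl, hd⟩
    rintro z ⟨h1, h2, h3, h4⟩
    have h5 : φ z ≠ w := fun h => absurd h4 (not_lt.2 (hlast z h2 h d h1.symm))
    obtain ⟨h6, h7⟩ := hstep z h2 h5
    have h8 : fc (φ z) = fc d := (hfc z h2).trans h1
    refine ⟨h8, h5, ?_⟩
    rcases (h7 d h1.symm h4).lt_or_eq with h9 | h9
    · have := hNC d (φ z) h8.symm (h3.trans_lt h6) h9
      exact ⟨this.1.le, this.2⟩
    · obtain rfl := hq _ _ h8 h9
      exact ⟨le_rfl, hd⟩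
  by_cases hdw : d = w
  · by_contra hne
    exact (key e d (fun h => hne (hdw.trans h.symm)) he hde.symm).2.1 hdw
  · obtain ⟨h1, h2, h3, -⟩ := key d e hdw hd hde
    exact hp _ _ h1.symm (h3.antisymm (key e d h2 he hde.symm).2.2.1)

end ForwardSteps

/-! ### Gluing layerings of the face cycles -/

open EmbeddedGraph FoldingInput

namespace FoldingInput

variable {D : Type*} {G : FoldingInput D} {lev : D → ℕ} {M : ℕ}

/-- Over the interval `i`, the edge of `y` is the next one above the edge of `x` according to the
layering of the cycle of the face between the two. The line above the folding counts
as the upper and the lower end of the outer face. -/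
def EdgeAbove (L : ∀ f, Layering (G.faceCycle f) (cycleLevel lev f)) (i : ℕ) :
    D ⊕ Bool → D ⊕ Bool → Prop
  | Sum.inl a, Sum.inl b => ∃ (f : G.Face) (ha : G.face a = f) (hb : G.face (G.opp b) = f),
      (L f).Consecutive i (⟨a, ha⟩, true) (⟨G.opp b, hb⟩, false)
  | Sum.inl a, Sum.inr _ => ∃ ha : G.face a = G.outer,
      ∀ e, (G.faceCycle G.outer).Crosses (cycleLevel lev G.outer) i e →
        (L G.outer).height i e ≤ (L G.outer).height i (⟨a, ha⟩, true)
  | Sum.inr _, Sum.inl b => ∃ hb : G.face (G.opp b) = G.outer,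
      ∀ e, (G.faceCycle G.outer).Crosses (cycleLevel lev G.outer) i e →
        (L G.outer).height i (⟨G.opp b, hb⟩, false) ≤ (L G.outer).height i e
  | Sum.inr _, Sum.inr _ =>
      ∀ e, ¬ (G.faceCycle G.outer).Crosses (cycleLevel lev G.outer) i e

variable (L : ∀ f, Layering (G.faceCycle f) (cycleLevel lev f))

theorem crosses_cycle_true {i : ℕ} {f : G.Face} {a : D} (ha : G.face a = f)
    (h : G.Crosses lev i a) : (G.faceCycle f).Crosses (cycleLevel lev f) i (⟨a, ha⟩, true) := by
  rwa [crosses_cycle]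

theorem exists_edgeAbove [Fintype D] (hM : ∀ d, lev d ≤ M) {i : ℕ}
    (x : {x // G.withLine.Crosses (lineLevel lev M) i x}) :
    ∃ y : {x // G.withLine.Crosses (lineLevel lev M) i x}, EdgeAbove L i x y := by
  classical
  obtain ⟨a | _ | _, hx⟩ := x
  · change G.Crosses lev i a at hx
    obtain ⟨f, hf⟩ : ∃ f, G.face a = f := ⟨_, rfl⟩
    have ha := crosses_cycle_true hf hx
    by_cases h : ∃ e, (G.faceCycle f).Crosses (cycleLevel lev f) i e ∧
        (L f).height i (⟨a, hf⟩, true) < (L f).height i e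
    · obtain ⟨e, he, hlt⟩ := h
      obtain ⟨⟨c, b⟩, hc⟩ := (L f).exists_consecutive_above ha he hlt
      have hb := hc.face_eq (G.faceCycle_connected f)
      rw [faceCycle_opp, faceCycle_face_eq_iff] at hb
      obtain rfl : b = false := by simpa using hb.symm
      have h2 := hc.2.1
      rw [crosses_cycle, outDart_false] at h2
      refine ⟨⟨Sum.inl (G.opp c), h2⟩, f, hf, (by rw [G.opp_opp]; exact c.2), ?_⟩
      simpa only [G.opp_opp] using hc
    · push Not at h
      have := (L f).outer_top i _ ha h
      rw [faceCycle_face_eq_outer_iff] at this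
      obtain rfl : f = G.outer := by simpa using this.symm
      exact ⟨⟨Sum.inr true, crosses_withLine_true.2 (lt_of_crosses hM hx).le⟩, hf, h⟩
  · exact absurd hx not_crosses_withLine_false
  · by_cases h : ∃ e, (G.faceCycle G.outer).Crosses (cycleLevel lev G.outer) i e
    · obtain ⟨e, he⟩ := h
      obtain ⟨⟨c, b⟩, hc, hmin⟩ := (L G.outer).exists_bottom he
      have hb := (L G.outer).outer_bottom i _ hc hmin
      rw [faceCycle_opp, faceCycle_face_eq_outer_iff] at hb
      obtain rfl : b = false := by simpa using hb
      rw [crosses_cycle, outDart_false] at hc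
      refine ⟨⟨Sum.inl (G.opp c), hc⟩, (by rw [G.opp_opp]; exact c.2), ?_⟩
      simpa only [G.opp_opp] using hmin
    · push Not at h
      exact ⟨⟨Sum.inr true, hx⟩, h⟩

theorem edgeAbove_left_unique {i : ℕ}
    {x x' y : {x // G.withLine.Crosses (lineLevel lev M) i x}} (h : EdgeAbove L i x y)
    (h' : EdgeAbove L i x' y) : x = x' := by
  classical
  obtain ⟨a | _ | _, hx⟩ := x
  · obtain ⟨a' | _ | _, hx'⟩ := x'
    · obtain ⟨b | b, hy⟩ := y
      · obtain ⟨f, ha, hb, h1, -, h3, h4⟩ := h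
        obtain ⟨f', ha', hb', h1', -, h3', h4'⟩ := h'
        obtain rfl : f = f' := hb.symm.trans hb'
        have : (L f).height i (⟨a, ha⟩, true) = (L f).height i (⟨a', ha'⟩, true) := by
          rcases lt_trichotomy ((L f).height i (⟨a, ha⟩, true))
            ((L f).height i (⟨a', ha'⟩, true)) with h | h | h
          · exact absurd h3' (not_lt.2 (h4 _ h1' h))
          · exact h
          · exact absurd h3 (not_lt.2 (h4' _ h1 h))
        have := (L f).height_inj i _ _ h1 h1' this
        simp only [Prod.mk.injEq, Subtype.mk.injEq] at this
        exact Subtype.ext (congrArg Sum.inl this.1)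
      · obtain ⟨ha, h1⟩ := h
        obtain ⟨ha', h1'⟩ := h'
        have hc := crosses_cycle_true ha hx
        have hc' := crosses_cycle_true ha' hx'
        have := (L G.outer).height_inj i _ _ hc hc' ((h1' _ hc).antisymm (h1 _ hc'))
        simp only [Prod.mk.injEq, Subtype.mk.injEq] at this
        exact Subtype.ext (congrArg Sum.inl this.1)
    · exact absurd hx' not_crosses_withLine_false
    · obtain ⟨b | b, hy⟩ := y
      · obtain ⟨f, ha, hb, h1, -, h3, -⟩ := h
        obtain ⟨hb', h1'⟩ := h'
        obtain rfl : f = G.outer := hb.symm.trans hb'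
        exact absurd h3 (not_lt.2 (h1' _ h1))
      · obtain ⟨ha, -⟩ := h
        exact absurd (crosses_cycle_true ha hx) (h' _)
  · exact absurd hx not_crosses_withLine_false
  · obtain ⟨a' | _ | _, hx'⟩ := x'
    · obtain ⟨b | b, hy⟩ := y
      · obtain ⟨f, ha, hb, h1, -, h3, -⟩ := h'
        obtain ⟨hb', h1'⟩ := h
        obtain rfl : f = G.outer := hb.symm.trans hb'
        exact absurd h3 (not_lt.2 (h1' _ h1))
      · obtain ⟨ha, -⟩ := h'
        exact absurd (crosses_cycle_true ha hx') (h _)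
    · exact absurd hx' not_crosses_withLine_false
    · rfl

section Gluing

variable [Fintype D] (hM : ∀ d, lev d ≤ M)

/-- The next edge above, as a permutation of the edges over an interval. -/
noncomputable def edgeNext (i : ℕ) : Equiv.Perm {x // G.withLine.Crosses (lineLevel lev M) i x} :=
  Equiv.ofBijective (fun x => (exists_edgeAbove L hM x).choose)
    (Finite.injective_iff_bijective.1 fun x y h => by
      have h1 := (exists_edgeAbove L hM x).choose_spec
      have h2 := (exists_edgeAbove L hM y).choose_spec
      rw [h] at h1
      exact edgeAbove_left_unique L h1 h2)

theorem edgeAbove_edgeNext (i : ℕ) (x) : EdgeAbove L i x.1 (edgeNext L hM i x).1 :=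
  (exists_edgeAbove L hM x).choose_spec

theorem edgeNext_eq_iff (i : ℕ) (x y) : edgeNext L hM i x = y ↔ EdgeAbove L i x.1 y.1 := by
  constructor
  · rintro rfl
    exact edgeAbove_edgeNext L hM i x
  · intro h
    obtain ⟨z, rfl⟩ := (edgeNext L hM i).surjective y
    rw [edgeAbove_left_unique L h (edgeAbove_edgeNext L hM i z)]

theorem edgeAbove_edgeNext_symm (i : ℕ) (y) : EdgeAbove L i ((edgeNext L hM i).symm y).1 y.1 := by
  rw [← edgeNext_eq_iff L hM, Equiv.apply_symm_apply]

/-- The face to the left of a dart, where the line above the folding has the outer face on both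
sides. -/
def lineFace (G : FoldingInput D) : D ⊕ Bool → G.Face := Sum.elim G.face fun _ => G.outer

/-- The position of a side of an edge on the rim of a disk, in the layering of the cycle
of its face. The line above the folding lies between the right and the left part of the rim. -/
noncomputable def sidePos (j : ℕ) : D ⊕ Bool → ℤ ×ₗ ℤ
  | Sum.inl d => (G.faceCycle (G.face d)).rimPos (cycleLevel lev (G.face d))
      (L (G.face d)).height j (⟨d, rfl⟩, true)
  | Sum.inr b => if b then toLex (1, 0) else toLex (2, 0)

/-- The position of the side that follows in the disk. -/
noncomputable def turnPos (j : ℕ) : D ⊕ Bool → ℤ ×ₗ ℤ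
  | Sum.inl d => (G.faceCycle (G.face d)).rimPos (cycleLevel lev (G.face d))
      (L (G.face d)).height j
      ((G.faceCycle (G.face d)).turn (cycleLevel lev (G.face d)) j (⟨d, rfl⟩, true))
  | Sum.inr b => if b then toLex (2, 0) else toLex (1, 0)

omit [Fintype D]

theorem sidePos_inl {j : ℕ} {f : G.Face} {d : D} (h : G.face d = f) :
    sidePos L j (Sum.inl d) = (G.faceCycle f).rimPos (cycleLevel lev f) (L f).height j
      (⟨d, h⟩, true) := by
  subst h
  rfl

theorem turnPos_inl {j : ℕ} {f : G.Face} {d : D} (h : G.face d = f) :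
    turnPos L j (Sum.inl d) = (G.faceCycle f).rimPos (cycleLevel lev f) (L f).height j
      ((G.faceCycle f).turn (cycleLevel lev f) j (⟨d, h⟩, true)) := by
  subst h
  rfl

theorem turnPos_eq {j : ℕ} {f : G.Face} {d c : D} (hc : G.face c = f)
    (h : G.turn lev j d = G.opp c) :
    turnPos L j (Sum.inl d) = (G.faceCycle f).rimPos (cycleLevel lev f) (L f).height j
      (⟨c, hc⟩, false) := by
  have hd : G.face d = f := by rw [← G.face_opp_turn (lev := lev) j, h, G.opp_opp, hc]
  rw [turnPos_inl L hd]
  congr 1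
  obtain ⟨h1, h2⟩ := turn_cycle_true (lev := lev) j (⟨d, hd⟩ : {d : D // G.face d = f})
  refine Prod.ext (Subtype.ext ?_) h2
  rw [h1, h, G.opp_opp]

theorem turnPos_cases (hl : G.IsLevel lev) {j : ℕ} {f : G.Face}
    (x : {x // G.withLine.Leaves (lineLevel lev M) j x}) (hx : lineFace G x.1 = f) :
    (∃ e, (G.faceCycle f).Leaves (cycleLevel lev f) j e ∧ turnPos L j x.1 =
      (G.faceCycle f).rimPos (cycleLevel lev f) (L f).height j e) ∨
    turnPos L j x.1 = toLex (1, 0) ∨ turnPos L j x.1 = toLex (2, 0) := by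
  obtain ⟨d | _ | _, h⟩ := x
  · left
    refine ⟨_, ?_, turnPos_inl L hx⟩
    refine (isLevel_cycleLevel hl).leaves_turn ?_
    rw [leaves_cycle]
    exact h
  · exact Or.inr (Or.inl rfl)
  · exact Or.inr (Or.inr rfl)

theorem rimPos_cases {j : ℕ} {f : G.Face} {e : {d : D // G.face d = f} × Bool}
    (he : (G.faceCycle f).Leaves (cycleLevel lev f) j e) :
    ((G.faceCycle f).Crosses (cycleLevel lev f) (j + 1) e ∧
      (G.faceCycle f).rimPos (cycleLevel lev f) (L f).height j e =
        toLex (0, (L f).height (j + 1) e)) ∨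
    ∃ e', (G.faceCycle f).Crosses (cycleLevel lev f) j e' ∧
      (G.faceCycle f).rimPos (cycleLevel lev f) (L f).height j e =
        toLex (3, -(L f).height j e') := by
  rcases he with he | he
  · exact Or.inl ⟨he, rimPos_right he⟩
  · exact Or.inr ⟨_, he, rimPos_left he⟩

variable [Fintype D] (hl : G.IsLevel lev) {j : ℕ}

/-- Positions on the rim of the disk on the two sides of a gap between consecutive edges. -/
theorem step_of_rimNext_eq (hj : j < M)
    (z y : {x // G.withLine.Leaves (lineLevel lev M) j x}) (hz : z.1 ≠ Sum.inr true)
    (hzy : hl.withLine.turnPerm j y = rimNext (edgeNext L hM) j z) :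
    lineFace G y.1 = lineFace G z.1 ∧
      (y.1 ≠ Sum.inr true → sidePos L j z.1 < turnPos L j y.1 ∧
        ∀ d : {x // G.withLine.Leaves (lineLevel lev M) j x}, lineFace G d.1 = lineFace G z.1 →
          sidePos L j z.1 < turnPos L j d.1 → turnPos L j y.1 ≤ turnPos L j d.1) ∧
      (y.1 = Sum.inr true →
        ∀ d : {x // G.withLine.Leaves (lineLevel lev M) j x}, lineFace G d.1 = lineFace G z.1 →
          turnPos L j d.1 ≤ sidePos L j z.1) := by
  have hzy' := congrArg Subtype.val hzy
  rw [IsLevel.turnPerm_apply] at hzy'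
  obtain ⟨y, hy⟩ := y
  obtain ⟨z, hzl⟩ := z
  dsimp only at hz hzy'
  -- A place that is followed by a given one.
  have hturn : ∀ b : D, G.withLine.turn (lineLevel lev M) j y = Sum.inl (G.opp b) →
      ∃ y₀, y = Sum.inl y₀ ∧ G.turn lev j y₀ = G.opp b ∧ G.face y₀ = G.face b := by
    intro b hb
    rcases y with y₀ | c
    · rw [turn_withLine_inl] at hb
      have hb' := Sum.inl_injective hb
      refine ⟨y₀, rfl, hb', ?_⟩
      rw [← G.face_opp_turn (lev := lev) j, hb', G.opp_opp]
    · rw [turn_withLine_inr hj] at hb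
      exact absurd hb (by simp)
  have hturn' : ∀ b : Bool, G.withLine.turn (lineLevel lev M) j y = Sum.inr b → y = Sum.inr !b := by
    intro b hb
    rcases y with y₀ | c
    · rw [turn_withLine_inl] at hb
      exact absurd hb (by simp)
    · rw [turn_withLine_inr hj] at hb
      rw [← Sum.inr_injective hb, Bool.not_not]
  rcases hzl with hzr | hzr
  · rw [rimNext_right hzr] at hzy'
    have habove := edgeAbove_edgeNext L hM (j + 1) ⟨z, hzr⟩
    generalize edgeNext L hM (j + 1) ⟨z, hzr⟩ = t at hzy' habove
    obtain ⟨t, ht⟩ := t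
    dsimp only at hzy' habove
    rcases z with a | _ | _
    · rcases t with b | _ | _
      · obtain ⟨f, ha, hb, hcons⟩ := habove
        obtain ⟨y₀, rfl, hy₀, hface⟩ := hturn (G.opp b) (by rw [hzy', G.opp_opp])
        have hp : sidePos L j (Sum.inl a) = toLex (0, (L f).height (j + 1) (⟨a, ha⟩, true)) := by
          rw [sidePos_inl L ha, rimPos_right hcons.1]
        have hq : turnPos L j (Sum.inl y₀) =
            toLex (0, (L f).height (j + 1) (⟨G.opp b, hb⟩, false)) := by
          rw [turnPos_eq L hb hy₀, rimPos_right hcons.2.1]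
        refine ⟨hface.trans (hb.trans ha.symm), fun _ => ?_, fun h => absurd h (by simp)⟩
        dsimp only
        rw [hp, hq]
        refine ⟨by simpa [Prod.Lex.toLex_lt_toLex] using hcons.2.2.1, fun d hd hlt => ?_⟩
        rcases turnPos_cases L hl d (hd.trans ha) with ⟨e, he, heq⟩ | heq | heq
        · rw [heq] at hlt ⊢
          rcases rimPos_cases L he with ⟨he', heq'⟩ | ⟨e', he', heq'⟩
          · rw [heq'] at hlt ⊢
            simp only [Prod.Lex.toLex_lt_toLex, lt_irrefl, true_and, false_or] at hlt
            simpa [Prod.Lex.toLex_le_toLex] using hcons.2.2.2 e he' hlt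
          · rw [heq']
            simp [Prod.Lex.toLex_le_toLex]
        · rw [heq]
          simp [Prod.Lex.toLex_le_toLex]
        · rw [heq]
          simp [Prod.Lex.toLex_le_toLex]
      · exact absurd ht not_crosses_withLine_false
      · obtain ⟨ha, htop⟩ := habove
        obtain rfl := hturn' _ hzy'
        have hp : sidePos L j (Sum.inl a) =
            toLex (0, (L G.outer).height (j + 1) (⟨a, ha⟩, true)) := by
          rw [sidePos_inl L ha, rimPos_right (crosses_cycle_true ha hzr)]
        refine ⟨ha.symm, fun _ => ?_, fun h => absurd h (by simp)⟩
        have hq : turnPos L j (Sum.inr (!true) : D ⊕ Bool) = toLex (1, 0) := rfl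
        dsimp only
        rw [hp, hq]
        refine ⟨by simp [Prod.Lex.toLex_lt_toLex], fun d hd hlt => ?_⟩
        rcases turnPos_cases L hl d (hd.trans ha) with ⟨e, he, heq⟩ | heq | heq
        · rw [heq] at hlt ⊢
          rcases rimPos_cases L he with ⟨he', heq'⟩ | ⟨e', he', heq'⟩
          · rw [heq'] at hlt ⊢
            simp only [Prod.Lex.toLex_lt_toLex, lt_irrefl, true_and, false_or] at hlt
            exact absurd hlt (not_lt.2 (htop e he'))
          · rw [heq']
            simp [Prod.Lex.toLex_le_toLex]
        · rw [heq]
        · rw [heq]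
          simp [Prod.Lex.toLex_le_toLex]
    · exact absurd hzr not_crosses_withLine_false
    · exact absurd rfl hz
  · rw [rimNext_left hzr] at hzy'
    have habove := edgeAbove_edgeNext_symm L hM j ⟨G.withLine.opp z, hzr⟩
    generalize (edgeNext L hM j).symm ⟨G.withLine.opp z, hzr⟩ = t at hzy' habove
    obtain ⟨t, ht⟩ := t
    dsimp only at hzy' habove
    rcases z with a | _ | _
    · have haa : ∀ f, ∀ h : G.face (G.opp (G.opp a)) = f, sidePos L j (Sum.inl a) =
          toLex (3, -(L f).height j (⟨G.opp (G.opp a), h⟩, false)) := by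
        intro f h
        have haf : G.face a = f := by rw [← h, G.opp_opp]
        have heq : (⟨G.opp (G.opp a), h⟩ : {d : D // G.face d = f}) = ⟨a, haf⟩ :=
          Subtype.ext (G.opp_opp a)
        rw [heq, sidePos_inl L haf]
        exact rimPos_left (by rw [crosses_cycle]; exact hzr)
      rcases t with c | _ | _
      · obtain ⟨f, hc, hb, hcons⟩ := habove
        obtain ⟨y₀, rfl, hy₀, hface⟩ := hturn c hzy'
        have hq : turnPos L j (Sum.inl y₀) = toLex (3, -(L f).height j (⟨c, hc⟩, true)) := by
          rw [turnPos_eq L hc hy₀]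
          exact rimPos_left hcons.1
        have haf : G.face a = f := by rw [← hb, G.opp_opp]
        refine ⟨hface.trans (hc.trans haf.symm), fun _ => ?_, fun h => absurd h (by simp)⟩
        dsimp only
        rw [haa f hb, hq]
        refine ⟨by simpa [Prod.Lex.toLex_lt_toLex] using hcons.2.2.1, fun d hd hlt => ?_⟩
        rcases turnPos_cases L hl d (hd.trans haf) with ⟨e, he, heq⟩ | heq | heq
        · rw [heq] at hlt ⊢
          rcases rimPos_cases L he with ⟨he', heq'⟩ | ⟨e', he', heq'⟩
          · rw [heq'] at hlt
            simp [Prod.Lex.toLex_lt_toLex] at hlt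
          · rw [heq'] at hlt ⊢
            simp only [Prod.Lex.toLex_lt_toLex, lt_irrefl, true_and, false_or, neg_lt_neg_iff]
              at hlt
            simp only [Prod.Lex.toLex_le_toLex, lt_irrefl, true_and, false_or, neg_le_neg_iff]
            by_contra! hcon
            exact absurd hlt (not_lt.2 (hcons.2.2.2 e' he' hcon))
        · rw [heq] at hlt
          simp [Prod.Lex.toLex_lt_toLex] at hlt
        · rw [heq] at hlt
          simp [Prod.Lex.toLex_lt_toLex] at hlt
      · exact absurd ht not_crosses_withLine_false
      · obtain ⟨hb, hbot⟩ := habove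
        obtain rfl := hturn' _ hzy'
        have haf : G.face a = G.outer := by rw [← hb, G.opp_opp]
        refine ⟨haf.symm, fun h => absurd rfl h, fun _ d hd => ?_⟩
        dsimp only
        rw [haa _ hb]
        rcases turnPos_cases L hl d (hd.trans haf) with ⟨e, he, heq⟩ | heq | heq
        · rw [heq]
          rcases rimPos_cases L he with ⟨he', heq'⟩ | ⟨e', he', heq'⟩
          · rw [heq']
            simp [Prod.Lex.toLex_le_toLex]
          · rw [heq']
            simpa [Prod.Lex.toLex_le_toLex] using hbot e' he'
        · rw [heq]
          simp [Prod.Lex.toLex_le_toLex]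
        · rw [heq]
          simp [Prod.Lex.toLex_le_toLex]
    · have hp : sidePos L j (Sum.inr false : D ⊕ Bool) = toLex (2, 0) := rfl
      rcases t with c | _ | _
      · obtain ⟨hc, htop⟩ := habove
        obtain ⟨y₀, rfl, hy₀, hface⟩ := hturn c hzy'
        have hq : turnPos L j (Sum.inl y₀) = toLex (3, -(L G.outer).height j (⟨c, hc⟩, true)) := by
          rw [turnPos_eq L hc hy₀]
          exact rimPos_left (crosses_cycle_true hc ht)
        refine ⟨hface.trans hc, fun _ => ?_, fun h => absurd h (by simp)⟩
        dsimp only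
        rw [hp, hq]
        refine ⟨by simp [Prod.Lex.toLex_lt_toLex], fun d hd hlt => ?_⟩
        rcases turnPos_cases L hl (f := G.outer) d hd with ⟨e, he, heq⟩ | heq | heq
        · rw [heq] at hlt ⊢
          rcases rimPos_cases L he with ⟨he', heq'⟩ | ⟨e', he', heq'⟩
          · rw [heq'] at hlt
            simp [Prod.Lex.toLex_lt_toLex] at hlt
          · rw [heq']
            simpa [Prod.Lex.toLex_le_toLex] using htop e' he'
        · rw [heq] at hlt
          simp [Prod.Lex.toLex_lt_toLex] at hlt
        · rw [heq] at hlt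
          simp at hlt
      · exact absurd ht not_crosses_withLine_false
      · obtain rfl := hturn' _ hzy'
        refine ⟨rfl, fun h => absurd rfl h, fun _ d hd => ?_⟩
        dsimp only
        rw [hp]
        rcases turnPos_cases L hl (f := G.outer) d hd with ⟨e, he, heq⟩ | heq | heq
        · rw [heq]
          rcases rimPos_cases L he with ⟨he', heq'⟩ | ⟨e', he', heq'⟩
          · rw [heq']
            simp [Prod.Lex.toLex_le_toLex]
          · exact absurd he' (habove e')
        · rw [heq]
          simp [Prod.Lex.toLex_le_toLex]
        · rw [heq]
    · exact absurd hzr (by simpa using not_crosses_withLine_false)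

end Gluing

end FoldingInput


/-! ### Gluing: the angles at the vertices -/

namespace FoldingInput

open EmbeddedGraph

variable {D : Type*} [Fintype D] {G : FoldingInput D} {lev : D → ℕ} {M : ℕ}
  (L : ∀ f, Layering (G.faceCycle f) (cycleLevel lev f))

omit [Fintype D] in
theorem rimPos_ne {j : ℕ} {f : G.Face} {e : {d : D // G.face d = f} × Bool}
    (he : (G.faceCycle f).Leaves (cycleLevel lev f) j e) :
    (G.faceCycle f).rimPos (cycleLevel lev f) (L f).height j e ≠ toLex (1, 0) ∧
      (G.faceCycle f).rimPos (cycleLevel lev f) (L f).height j e ≠ toLex (2, 0) := by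
  rcases rimPos_cases L he with ⟨-, heq⟩ | ⟨e', -, heq⟩ <;> rw [heq] <;> simp

omit [Fintype D] in
theorem leaves_side {j : ℕ} {f : G.Face} {d : D} (hd : G.face d = f) (h : G.Leaves lev j d) :
    (G.faceCycle f).Leaves (cycleLevel lev f) j (⟨d, hd⟩, true) := by
  rwa [leaves_cycle]

/-- In each orbit that belongs to the gaps between consecutive edges, at most one side goes
forward. -/
theorem eq_of_forward (hl : G.IsLevel lev) (hM : ∀ d, lev d ≤ M) {j : ℕ} (hj : j < M)
    {x y : {x // G.withLine.Leaves (lineLevel lev M) j x}}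
    (hx : sidePos L j x.1 < turnPos L j x.1) (hy : sidePos L j y.1 < turnPos L j y.1)
    (hxy : ((hl.withLine.turnPerm j)⁻¹ * rimNext (edgeNext L hM) j).SameCycle x y) : x = y := by
  have hstep : ∀ z, hl.withLine.turnPerm j
      ((((hl.withLine.turnPerm j)⁻¹ * rimNext (edgeNext L hM) j :) : Equiv.Perm _) z) =
        rimNext (edgeNext L hM) j z := fun z => by simp
  have htl : ∀ {f : G.Face} {d : D} (hd : G.face d = f), G.Leaves lev j d →
      (G.faceCycle f).Leaves (cycleLevel lev f) j
        ((G.faceCycle f).turn (cycleLevel lev f) j (⟨d, hd⟩, true)) := fun hd h =>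
    (isLevel_cycleLevel hl).leaves_turn (leaves_side hd h)
  refine eq_of_sameCycle_of_forward (p := fun z => sidePos L j z.1) (q := fun z => turnPos L j z.1)
    (fc := fun z => lineFace G z.1) (w := ⟨Sum.inr true, Or.inl (crosses_withLine_true.2 hj)⟩)
    (fun z hz => (step_of_rimNext_eq L hM hl hj z _ (fun h => hz (Subtype.ext h)) (hstep z)).1)
    ?_ ?_
    (fun z hz hz' => (step_of_rimNext_eq L hM hl hj z _ (fun h => hz (Subtype.ext h))
      (hstep z)).2.1 fun h => hz' (Subtype.ext h))
    (fun z hz hz' => (step_of_rimNext_eq L hM hl hj z _ (fun h => hz (Subtype.ext h))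
      (hstep z)).2.2 (congrArg Subtype.val hz'))
    ?_ hx hy hxy
  · rintro ⟨a | a, ha⟩ ⟨b | b, hb⟩ hf h <;> dsimp only at hf h
    · rw [sidePos_inl L rfl, sidePos_inl L hf.symm] at h
      have := (L _).rimPos_injective (leaves_side rfl ha) (leaves_side _ hb) h
      exact Subtype.ext (congrArg Sum.inl (congrArg (fun e => (e.1 : D)) this))
    · rw [sidePos_inl L rfl] at h
      have := rimPos_ne L (leaves_side rfl ha)
      cases b
      · exact absurd h this.2
      · exact absurd h this.1
    · rw [sidePos_inl L rfl] at h
      have := rimPos_ne L (leaves_side rfl hb)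
      cases a
      · exact absurd h.symm this.2
      · exact absurd h.symm this.1
    · cases a <;> cases b <;> simp [sidePos] at h ⊢
  · rintro ⟨a | a, ha⟩ ⟨b | b, hb⟩ hf h <;> dsimp only at hf h
    · rw [turnPos_inl L rfl, turnPos_inl L hf.symm] at h
      have h1 := (L _).rimPos_injective (htl rfl ha) (htl _ hb) h
      have := (isLevel_cycleLevel hl).turn_injective (leaves_side _ ha) (leaves_side _ hb) h1
      exact Subtype.ext (congrArg Sum.inl (congrArg (fun e => (e.1 : D)) this))
    · rw [turnPos_inl L rfl] at h
      have := rimPos_ne L (htl rfl ha)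
      cases b
      · exact absurd h this.1
      · exact absurd h this.2
    · rw [turnPos_inl L rfl] at h
      have := rimPos_ne L (htl rfl hb)
      cases a
      · exact absurd h.symm this.1
      · exact absurd h.symm this.2
    · cases a <;> cases b <;> simp [turnPos] at h ⊢
  · rintro ⟨a | a, ha⟩ ⟨b | b, hb⟩ hf h1 h2 <;> dsimp only at hf h1 h2 ⊢
    · rw [turnPos_inl L hf.symm] at h1 h2
      rw [sidePos_inl L hf.symm]
      rw [sidePos_inl L rfl] at h1 ⊢
      rw [turnPos_inl L rfl] at h2 ⊢
      refine noncrossing_orbit ((L _).noncrossing' j) (x := ⟨_, leaves_side rfl ha⟩)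
        (y := ⟨_, htl hf.symm hb⟩) (z := ⟨_, leaves_side hf.symm hb⟩) ?_ h1 h2
      exact (Equiv.Perm.sameCycle_apply_left (f := (L (G.face a)).isLevel.turnPerm j)
        (x := ⟨_, leaves_side hf.symm hb⟩)).2 (Equiv.Perm.SameCycle.refl _ _)
    · -- The step passes from the right side to the left side, over the line.
      rw [sidePos_inl L rfl] at h1 ⊢
      rw [turnPos_inl L rfl] at h2 ⊢
      rcases rimPos_cases L (leaves_side rfl ha) with ⟨-, e1⟩ | ⟨e', -, e1⟩ <;>
        rcases rimPos_cases L (htl rfl ha) with ⟨-, e2⟩ | ⟨e'', -, e2⟩ <;>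
        rw [e1] at h1 ⊢ <;> rw [e2] at h2 ⊢ <;>
        cases b <;> simp [sidePos, turnPos, Prod.Lex.toLex_lt_toLex] at h1 h2 ⊢
    · rw [turnPos_inl L rfl] at h1 h2
      rcases rimPos_cases L (htl rfl hb) with ⟨-, e2⟩ | ⟨e'', -, e2⟩ <;>
        rw [e2] at h1 h2 <;>
        cases a <;> simp [sidePos, turnPos, Prod.Lex.toLex_lt_toLex] at h1 h2
    · cases a <;> cases b <;> simp [sidePos, turnPos, Prod.Lex.toLex_lt_toLex] at h1 h2 ⊢

omit [Fintype D] in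
include L in
theorem angle_flat_iff (d : D) : G.angle d = .flat ↔
    ¬ (lev d < lev (G.opp d) ↔ lev (G.rot d) < lev (G.opp (G.rot d))) := by
  have h := (L (G.face d)).flat_iff (⟨d, rfl⟩, true)
  unfold cycleLevel at h
  rw [outDart_opp, outDart_opp, outDart_rot_true, outDart_true] at h
  exact h

omit [Fintype D] in
theorem angle_valley_iff {j : ℕ} {d : D} (hd : lev d = j + 1)
    (hside : lev d < lev (G.opp d) ↔ lev (G.rot d) < lev (G.opp (G.rot d))) :
    G.angle d = .valley ↔ sidePos L j (Sum.inl d) < turnPos L j (Sum.inl d) := by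
  have h := (L (G.face d)).valley_iff j (⟨d, rfl⟩, true) hd (by
    unfold cycleLevel
    rw [outDart_opp, outDart_opp, outDart_rot_true, outDart_true]
    exact hside)
  rw [sidePos_inl L rfl, turnPos_inl L rfl]
  unfold turn
  rw [if_pos (show cycleLevel lev (G.face d) (⟨d, rfl⟩, true) = j + 1 from hd)]
  exact h

omit [Fintype D] in
theorem forward_of_right_of_left {j : ℕ} {d : D}
    (hd : G.Crosses lev (j + 1) d) (h : G.Crosses lev j (G.opp (G.turn lev j d))) :
    sidePos L j (Sum.inl d) < turnPos L j (Sum.inl d) := by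
  rw [sidePos_inl L rfl, turnPos_inl L rfl, rimPos_right (crosses_cycle_true rfl hd),
    rimPos_left (by rwa [crosses_cycle, outDart_opp, outDart_turn_true])]
  simp [Prod.Lex.toLex_lt_toLex]

/-- In each component of a disk, at most one side does not go forward. -/
theorem eq_of_not_forward (hcons : G.Consistent) (hl : G.IsLevel lev) {j : ℕ} (hj : j < M)
    {x y : {x // G.withLine.Leaves (lineLevel lev M) j x}}
    (hx : ¬ sidePos L j x.1 < turnPos L j x.1) (hy : ¬ sidePos L j y.1 < turnPos L j y.1)
    (hxy : (hl.withLine.turnPerm j).SameCycle x y) : x = y := by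
  classical
  obtain ⟨a | b, ha⟩ := x
  · change G.Leaves lev j a at ha
    by_cases hlev : lev a = j + 1
    · obtain ⟨b, hyb, hb⟩ := of_sameCycle (s := hl.withLine.turnPerm j)
        (S := fun z => ∃ c, z.1 = Sum.inl c ∧ G.rot.SameCycle a c) (by
          rintro ⟨z, hz⟩ ⟨c, rfl, hc⟩
          refine ⟨G.rot c, ?_, Equiv.Perm.sameCycle_apply_right.2 hc⟩
          have : lev c = j + 1 := by
            rw [← hlev]
            exact (SameCycle.apply_eq hl.rot hc).symm
          rw [IsLevel.turnPerm_apply, turn_withLine_inl, turn, if_pos this]) hxy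
        ⟨a, rfl, Equiv.Perm.SameCycle.refl _ _⟩
      obtain ⟨y, hyl⟩ := y
      dsimp only at hyb
      subst hyb
      by_contra hne
      have hab : a ≠ b := fun h => hne (by subst h; rfl)
      have hlevb : lev b = j + 1 := by
        rw [← hlev]
        exact (SameCycle.apply_eq hl.rot hb).symm
      have hsum := hcons (G.vertex a)
      have hmem : ∀ c, G.rot.SameCycle a c →
          c ∈ Finset.univ.filter fun d => G.vertex d = G.vertex a := fun c hc => by
        rw [Finset.mem_filter]
        exact ⟨Finset.mem_univ _, Quotient.sound hc.symm⟩
      -- A place that does not go forward has a mountain or is a flat one that goes to the right.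
      have hcase : ∀ c, lev c = j + 1 →
          ¬ sidePos L j (Sum.inl c) < turnPos L j (Sum.inl c) →
          G.angle c = .mountain ∨ G.angle c = .flat ∧ ¬ lev c < lev (G.opp c) ∧
            lev (G.rot c) < lev (G.opp (G.rot c)) := by
        intro c hc hnf
        by_cases hside : lev c < lev (G.opp c) ↔ lev (G.rot c) < lev (G.opp (G.rot c))
        · left
          have h1 := (angle_valley_iff L hc hside).not.2 hnf
          have h2 := (angle_flat_iff L c).not.2 (not_not.2 hside)
          cases hang : G.angle c <;> simp_all
        · right
          refine ⟨(angle_flat_iff L c).2 hside, ?_⟩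
          by_cases h1 : lev c < lev (G.opp c)
          · exfalso
            have h2 : ¬ lev (G.rot c) < lev (G.opp (G.rot c)) := by tauto
            refine hnf (forward_of_right_of_left L ⟨hc.le, by omega⟩ ?_)
            have h3 := hl.ne (G.rot c)
            have h4 := hl.rot c
            unfold Crosses turn
            rw [if_pos hc, G.opp_opp]
            omega
          · exact ⟨h1, by tauto⟩
      have hpair : (G.angle a).degrees + (G.angle b).degrees ≤ 360 := by
        rw [← hsum, ← Finset.sum_pair hab (f := fun d => (G.angle d).degrees)]
        refine Finset.sum_le_sum_of_subset ?_
        intro c hc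
        rcases Finset.mem_insert.1 hc with rfl | hc
        · exact hmem _ (Equiv.Perm.SameCycle.refl _ _)
        · rw [Finset.mem_singleton.1 hc]
          exact hmem _ hb
      rcases hcase a hlev hx with h1 | ⟨h1, h1l, h1r⟩ <;>
        rcases hcase b hlevb hy with h2 | ⟨h2, h2l, h2r⟩ <;>
        rw [h1, h2] at hpair <;> simp [FoldAngle.degrees] at hpair
      -- Two flat angles that go to the right are compensated by a third one.
      obtain ⟨z, hz, hzr, hzl⟩ := exists_exit (s := G.rot) (fun d => lev d < lev (G.opp d))
        (x := G.rot a) (y := a)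
        (Equiv.Perm.sameCycle_apply_left.2 (Equiv.Perm.SameCycle.refl _ _)) h1r h1l
      have hz' : G.rot.SameCycle a z := Equiv.Perm.sameCycle_apply_left.1 hz
      have hza : z ≠ a := by rintro rfl; exact h1l hzr
      have hzb : z ≠ b := by rintro rfl; exact h2l hzr
      have hzflat : G.angle z = .flat := (angle_flat_iff L z).2 (by tauto)
      have htriple : ∑ d ∈ {z, a, b}, (G.angle d).degrees ≤ 360 := by
        rw [← hsum]
        refine Finset.sum_le_sum_of_subset ?_
        intro c hc
        simp only [Finset.mem_insert, Finset.mem_singleton] at hc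
        rcases hc with rfl | rfl | rfl
        · exact hmem _ hz'
        · exact hmem _ (Equiv.Perm.SameCycle.refl _ _)
        · exact hmem _ hb
      rw [Finset.sum_insert (by simp [hza, hzb]), Finset.sum_pair hab, h1, h2, hzflat] at htriple
      simp [FoldAngle.degrees] at htriple
    · -- An edge that passes through the disk goes forward on its lower side.
      have hpass : ∀ c, (c = a ∨ c = G.opp a) → G.Leaves lev j c → lev c ≠ j + 1 ∧
          (¬ sidePos L j (Sum.inl c) < turnPos L j (Sum.inl c) → G.Crosses lev j (G.opp c)) := by
        intro c hc hcl
        have h1 : lev c ≠ j + 1 := by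
          rcases hc with rfl | rfl
          · exact hlev
          · unfold Leaves Crosses at ha
            rw [G.opp_opp] at ha
            omega
        refine ⟨h1, fun hnf => hcl.resolve_left fun hr => hnf ?_⟩
        refine forward_of_right_of_left L hr ?_
        rw [turn, if_neg h1, G.opp_opp]
        exact ⟨by have := hr.1; omega, by have := hr.2; omega⟩
      obtain ⟨b, hyb, hb⟩ := of_sameCycle (s := hl.withLine.turnPerm j)
        (S := fun z => ∃ c, z.1 = Sum.inl c ∧ (c = a ∨ c = G.opp a)) (by
          rintro ⟨z, hz⟩ ⟨c, rfl, hc⟩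
          refine ⟨G.opp c, ?_, ?_⟩
          · rw [IsLevel.turnPerm_apply, turn_withLine_inl, turn, if_neg (hpass c hc hz).1]
          · rcases hc with rfl | rfl
            · exact Or.inr rfl
            · exact Or.inl (G.opp_opp _)) hxy
        ⟨a, rfl, Or.inl rfl⟩
      obtain ⟨y, hyl⟩ := y
      dsimp only at hyb
      subst hyb
      have h1 := (hpass a (Or.inl rfl) ha).2 hx
      have h2 := (hpass b hb hyl).2 hy
      rcases hb with rfl | rfl
      · rfl
      · rw [G.opp_opp] at h2
        exact absurd h2 (not_crosses_of_crosses_opp h1)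
  · have h1 : ∀ (c : Bool), ¬ sidePos L j (Sum.inr c : D ⊕ Bool) < turnPos L j (Sum.inr c) →
        c = false := by
      intro c hc
      cases c
      · rfl
      · simp [sidePos, turnPos, Prod.Lex.toLex_lt_toLex] at hc
    obtain ⟨c, hyc⟩ := of_sameCycle (s := hl.withLine.turnPerm j)
      (S := fun z => ∃ c, z.1 = Sum.inr c) (by
        rintro ⟨z, hz⟩ ⟨c, rfl⟩
        exact ⟨!c, by rw [IsLevel.turnPerm_apply, turn_withLine_inr hj]⟩) hxy ⟨b, rfl⟩
    obtain ⟨y, hyl⟩ := y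
    dsimp only at hyc
    subst hyc
    obtain rfl := h1 b hx
    obtain rfl := h1 c hy
    rfl

/-- The stacking of the edges given by layerings of all face cycles. -/
noncomputable def faceStacking (hcons : G.Consistent) (hl : G.IsLevel lev) (hM : ∀ d, lev d ≤ M) :
    Stacking G.withLine (lineLevel lev M) (Sum.inr true) M where
  isLevel := hl.withLine
  lev_left := rfl
  lev_right := rfl
  next := edgeNext L hM
  fwd j x := sidePos L j x.1 < turnPos L j x.1
  unique_fwd _ hj _ _ hx hy h := eq_of_forward L hl hM hj hx hy h
  unique_not_fwd _ hj _ _ hx hy h := eq_of_not_forward L hcons hl hj hx hy h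
  fwd_right := by
    rintro j ⟨x, hx⟩ rfl
    simp [sidePos, turnPos, Prod.Lex.toLex_lt_toLex]

omit [Fintype D] in
theorem isLevel_of_faceCycles (L : ∀ f, Layering (G.faceCycle f) (cycleLevel lev f)) :
    G.IsLevel lev where
  rot d := by
    have := (L (G.face d)).isLevel.rot (⟨d, rfl⟩, true)
    unfold cycleLevel at this
    rwa [outDart_rot_true, outDart_true] at this
  ne d := (L (G.face d)).isLevel.ne (⟨d, rfl⟩, true)

/-- Layerings of all face cycles with the same levels are induced by a layering of the graph. -/
theorem exists_layering (hG : G.Connected) (hcons : G.Consistent)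
    (L : ∀ f, Layering (G.faceCycle f) (cycleLevel lev f)) :
    ∃ L' : Layering G lev, ∀ i a b, L'.Consecutive i a b ↔
      ∃ (f : G.Face) (ha : G.face a = f) (hb : G.face (G.opp b) = f),
        (L f).Consecutive i (⟨a, ha⟩, true) (⟨G.opp b, hb⟩, false) := by
  classical
  have hl := isLevel_of_faceCycles L
  have hpos : ∀ d, 0 < lev d := fun d => (L (G.face d)).pos (⟨d, rfl⟩, true)
  obtain ⟨M, hM⟩ : ∃ M, ∀ d, lev d ≤ M :=
    ⟨Finset.univ.sup lev, fun d => Finset.le_sup (Finset.mem_univ d)⟩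
  let S := faceStacking L hcons hl hM
  -- Over an interval that meets the outer face, the line has an edge next to it.
  obtain ⟨i, d, hd, hreach⟩ : ∃ i d, G.Crosses lev i d ∧ S.Reached i (Sum.inl d) := by
    obtain ⟨d, hd⟩ := Quotient.exists_rep G.outer
    change G.face d = G.outer at hd
    obtain ⟨i, e, he⟩ : ∃ i e,
        (G.faceCycle G.outer).Crosses (cycleLevel lev G.outer) i e := by
      rcases lt_or_gt_of_ne (hl.ne d) with h | h
      · refine ⟨lev (G.opp d), (⟨d, hd⟩, false), ?_⟩
        rw [crosses_cycle, outDart_false]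
        exact ⟨le_rfl, by rwa [G.opp_opp]⟩
      · exact ⟨lev d, (⟨d, hd⟩, true), crosses_cycle_true hd ⟨le_rfl, h⟩⟩
    have hi : i ≤ M := (lt_of_crosses hM ((crosses_cycle i e).1 he)).le
    have habove := edgeAbove_edgeNext L hM i ⟨Sum.inr true, S.crosses hi⟩
    rcases hn : edgeNext L hM i ⟨Sum.inr true, S.crosses hi⟩ with ⟨y | _ | _, hy⟩
    · refine ⟨i, y, hy, hi, hy, ?_⟩
      rw [← hn]
      exact Equiv.Perm.sameCycle_apply_right.2 (Equiv.Perm.SameCycle.refl _ _)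
    · exact absurd hy not_crosses_withLine_false
    · rw [hn] at habove
      exact absurd he (habove e)
  have hS := S.total hG hl hpos hM hd hreach
  refine ⟨Layering.ofStacking hS hl hpos hM (angle_flat_iff L)
    (fun j d hd hside h => angle_valley_iff L hd hside) ?_ ?_, fun i a b => ?_⟩
  · intro i d h h' hn
    exact ((edgeNext_eq_iff L hM i _ _).1 hn).choose
  · intro i d h h' hn
    exact ((edgeNext_eq_iff L hM i _ _).1 hn).choose
  · refine (Layering.consecutive_ofStacking i a b).trans ?_
    constructor
    · rintro ⟨ha, hb, hn⟩
      exact (edgeNext_eq_iff L hM i _ _).1 hn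
    · intro h
      obtain ⟨f, ha, hb, hcons⟩ := id h
      have ha' := hcons.1
      have hb' := hcons.2.1
      rw [crosses_cycle] at ha' hb'
      rw [outDart_false, G.opp_opp] at hb'
      exact ⟨ha', hb', (edgeNext_eq_iff L hM i _ _).2 h⟩

end FoldingInput


/-! ### Shifting functions on the faces of a plane graph -/

namespace EmbeddedGraph

variable {D : Type*} [Fintype D] {G : EmbeddedGraph D}

theorem sameCycle_opp_iff (d e : D) : G.opp.SameCycle d e ↔ e = d ∨ e = G.opp d := by
  constructor
  · intro h
    refine of_sameCycle (S := fun e => e = d ∨ e = G.opp d) ?_ h (Or.inl rfl)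
    rintro y (rfl | rfl)
    · exact Or.inr rfl
    · exact Or.inl (G.opp_opp d)
  · rintro (rfl | rfl)
    · exact Equiv.Perm.SameCycle.refl _ _
    · exact Equiv.Perm.sameCycle_apply_right.2 (Equiv.Perm.SameCycle.refl _ _)

theorem card_darts (G : EmbeddedGraph D) : Fintype.card D = 2 * Nat.card G.Edge := by
  classical
  have := Fintype.ofFinite G.Edge
  have h : ∀ q : G.Edge,
      (Finset.univ.filter fun d : D => (Quotient.mk _ d : G.Edge) = q).card = 2 := by
    intro q
    obtain ⟨d, rfl⟩ := Quotient.exists_rep q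
    have : (Finset.univ.filter fun e : D => (Quotient.mk _ e : G.Edge) = Quotient.mk _ d) =
        {d, G.opp d} := by
      ext e
      simp only [Finset.mem_filter, Finset.mem_univ, true_and, Finset.mem_insert,
        Finset.mem_singleton]
      rw [← sameCycle_opp_iff]
      exact ⟨fun h => (Quotient.exact h).symm, fun h => Quotient.sound h.symm⟩
    rw [this, Finset.card_pair (G.opp_ne d).symm]
  rw [← Finset.card_univ, Finset.card_eq_sum_card_fiberwise
    (f := fun d : D => (Quotient.mk _ d : G.Edge)) (t := Finset.univ) (fun _ _ => by simp),
    Finset.sum_congr rfl fun q _ => h q]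
  simp [mul_comm]

theorem IsPlane.numCycles_eq (h : G.IsPlane) :
    numCycles G.rot + numCycles G.opp + numCycles (G.opp * G.rot) = Fintype.card D + 2 := by
  have h1 : G.opp * G.rot = G.faceNext⁻¹ := by
    rw [eq_inv_iff_mul_eq_one]
    ext d
    simp [faceNext, G.opp_opp]
  have h2 : numCycles (G.opp * G.rot) = Nat.card G.Face := by
    rw [h1]
    unfold numCycles
    exact Nat.card_congr (Quotient.congr (Equiv.refl D) fun a b => by
      exact Equiv.Perm.sameCycle_inv)
  have h3 : numCycles G.rot = Nat.card G.Vertex := rfl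
  have h4 : numCycles G.opp = Nat.card G.Edge := rfl
  have h5 := h.2
  rw [h2, h3, h4, card_darts G]
  omega

/-- In a plane graph, an antisymmetric function of the darts whose sum around each vertex is zero is
the difference of a function of the faces. -/
theorem IsPlane.exists_faceShift {K : Type*} [Field K] [Nonempty D] (h : G.IsPlane) (m : D → K)
    (hopp : ∀ d, m (G.opp d) = -m d)
    (hrot : ∀ u : D → K, (∀ d, u (G.rot d) = u d) → ∑ d, u d * m d = 0) :
    ∃ c : G.Face → K, ∀ d, m d = c (G.face d) - c (G.face (G.opp d)) := by
  classical
  have h2 : ∀ u : D → K, (∀ d, u (G.opp d) = u d) → ∑ d, u d * m d = 0 := fun u hu => by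
    refine Finset.sum_involution (fun d _ => G.opp d) (fun d _ => ?_) (fun d _ _ => G.opp_ne d)
      (fun _ _ => Finset.mem_univ _) fun d _ => G.opp_opp d
    rw [hu, hopp]
    ring
  obtain ⟨c, hc, hm⟩ := exists_invariant_sub h.1 h.numCycles_eq m hrot h2
  have hc' : ∀ d, c (G.faceNext d) = c d := fun d => by
    rw [← hc (G.faceNext d)]
    simp [faceNext, G.opp_opp]
  exact ⟨Quotient.lift c fun _ _ h => SameCycle.apply_eq hc' h, hm⟩

end EmbeddedGraph

/-! ### Placing the face cycles on a common line -/

namespace FoldingInput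

open EmbeddedGraph

variable {D : Type*} [Fintype D] {G : FoldingInput D}

open Classical in
theorem sum_mul_flat (hcons : G.Consistent) {u : D → ZMod 2} (hu : ∀ d, u (G.rot d) = u d) :
    ∑ d, u d * (if G.angle d = .flat then 1 else 0) = 0 := by
  classical
  have := Fintype.ofFinite G.Vertex
  rw [← Finset.sum_fiberwise Finset.univ G.vertex]
  refine Finset.sum_eq_zero fun v _ => ?_
  obtain ⟨d₀, rfl⟩ := Quotient.exists_rep v
  have h1 : ∀ d ∈ Finset.univ.filter (fun d => G.vertex d = Quotient.mk _ d₀),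
      u d * (if G.angle d = .flat then 1 else 0) =
        u d₀ * (if G.angle d = .flat then 1 else 0) := fun d hd => by
    rw [SameCycle.apply_eq hu (Quotient.exact (Finset.mem_filter.1 hd).2)]
  rw [Finset.sum_congr rfl h1, ← Finset.mul_sum]
  have h2 : ∀ a : FoldAngle, ∃ k : ℕ, a.degrees = 180 * k ∧
      (k : ZMod 2) = if a = .flat then 1 else 0 := by
    rintro (_ | _ | _)
    · exact ⟨0, rfl, by simp⟩
    · exact ⟨1, rfl, by simp⟩
    · exact ⟨2, rfl, by simp; rfl⟩
  choose k hk hk2 using h2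
  have h3 := hcons (Quotient.mk _ d₀)
  simp only [hk, ← hk2] at h3 ⊢
  rw [← Finset.mul_sum] at h3
  rw [← Nat.cast_sum, show ∑ d with G.vertex d = Quotient.mk _ d₀, k (G.angle d) = 2 by
    refine Nat.eq_of_mul_eq_mul_left (show 0 < 180 by norm_num) ?_
    convert h3]
  simp
  right
  rfl

variable (Φ : ∀ f, FlatFolding (G.faceCycle f))

open Classical in
/-- Whether a side of an edge goes to the right in the flat folding of its face cycle. -/
noncomputable def sideSign (d : D) : ZMod 2 :=
  if (Φ (G.face d)).GoesRight (⟨d, rfl⟩, true) then 1 else 0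

open Classical in
omit [Fintype D] in
theorem sideSign_eq {f : G.Face} {d : D} (h : G.face d = f) :
    sideSign Φ d = if (Φ f).GoesRight (⟨d, h⟩, true) then 1 else 0 := by
  subst h
  rfl

omit [Fintype D] in
theorem face_opp_rot (d : D) : G.face (G.opp (G.rot d)) = G.face d := by
  rw [← G.face_faceNext (G.opp (G.rot d))]
  simp [faceNext, G.opp_opp]

open Classical in
theorem sideSign_opp_rot (d : D) :
    sideSign Φ (G.opp (G.rot d)) = sideSign Φ d + (if G.angle d = .flat then 1 else 0) + 1 := by
  classical
  have hf := face_opp_rot (G := G) d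
  have heq : (G.boundaryNext (G.face d)).symm ⟨d, rfl⟩ = ⟨G.opp (G.rot d), hf⟩ :=
    Subtype.ext (G.opp.injective (by rw [opp_boundaryNext_symm, G.opp_opp]))
  rw [sideSign_eq Φ hf, sideSign_eq Φ rfl]
  have h1 := (Φ (G.face d)).toLayering.flat_iff (⟨d, rfl⟩, true)
  have h2 : (G.faceCycle (G.face d)).angle (⟨d, rfl⟩, true) = G.angle d := rfl
  rw [h2, faceCycle_rot_true, heq] at h1
  have h3 := (Φ (G.face d)).level_opp_ne (⟨G.opp (G.rot d), hf⟩, true)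
  unfold LineConfiguration.GoesRight
  rw [faceCycle_opp] at h1 h3 ⊢
  simp only [add_lt_add_iff_right, faceCycle_opp, Bool.not_true, Bool.not_false] at h1 h3 ⊢
  have h4 : (1 : ZMod 2) + 1 = 0 := rfl
  by_cases h5 : (Φ (G.face d)).level (⟨d, rfl⟩, true) < (Φ (G.face d)).level (⟨d, rfl⟩, false) <;>
    by_cases h6 : (Φ (G.face d)).level (⟨G.opp (G.rot d), hf⟩, true) <
      (Φ (G.face d)).level (⟨G.opp (G.rot d), hf⟩, false) <;>
    by_cases h7 : G.angle d = .flat <;> simp [h5, h6, h7, h4] at h1 h3 ⊢ <;> omega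

/-- The flat foldings of the faces can be reflected and translated so that they agree on the
positions of the vertices. -/
theorem exists_placement (hplane : G.IsPlane) (hcons : G.Consistent) :
    ∃ (x : D → ℝ) (e : G.Face → ZMod 2) (c : G.Face → ℝ), ∀ f z,
      x (outDart z) = (if e f = 0 then 1 else -1) * (Φ f).pos ((Φ f).level z) + c f := by
  classical
  have : Nonempty D := by
    obtain ⟨d, -⟩ := Quotient.exists_rep G.outer
    exact ⟨d⟩
  have h2 : (1 : ZMod 2) + 1 = 0 := rfl
  have hself : ∀ a : ZMod 2, a + a = 0 := CharTwo.add_self_eq_zero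
  obtain ⟨e, he⟩ := hplane.exists_faceShift (K := ZMod 2)
    (fun d => sideSign Φ (G.opp d) + sideSign Φ d + 1)
    (fun d => by rw [G.opp_opp, CharTwo.neg_eq]; ring) (fun u hu => by
      have h3 := sum_mul_flat hcons hu
      have h4 : ∑ d, u d * sideSign Φ (G.opp d) = ∑ d, u d * sideSign Φ (G.opp (G.rot d)) := by
        rw [← Equiv.sum_comp G.rot]
        exact Finset.sum_congr rfl fun d _ => by rw [hu]
      simp only [mul_add, Finset.sum_add_distrib]
      rw [h4]
      simp only [sideSign_opp_rot, mul_add, Finset.sum_add_distrib]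
      rw [h3]
      linear_combination hself (∑ d, u d * sideSign Φ d) + hself (∑ d, u d * 1))
  let sgn : G.Face → ℝ := fun f => if e f = 0 then 1 else -1
  let y : D → Bool → ℝ := fun d b =>
    sgn (G.face d) * (Φ (G.face d)).pos ((Φ (G.face d)).level (⟨d, rfl⟩, b))
  have hy : ∀ {f : G.Face} {d : D} (h : G.face d = f) (b : Bool),
      y d b = sgn f * (Φ f).pos ((Φ f).level (⟨d, h⟩, b)) := by
    rintro f d rfl b
    rfl
  let τ : D → ℝ := fun d => if sideSign Φ d + e (G.face d) = 1 then 1 else -1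
  have hτ : ∀ d, τ (G.opp d) = -τ d := by
    intro d
    have h3 : sideSign Φ (G.opp d) + e (G.face (G.opp d)) =
        sideSign Φ d + e (G.face d) + 1 := by
      linear_combination he d - hself (sideSign Φ d) -
        h2
    have h4 : ∀ a : ZMod 2, (if a + 1 = 1 then (1 : ℝ) else -1) = -if a = 1 then 1 else -1 := by
      intro a
      have h5 : a = 0 ∨ a = 1 := by revert a; decide
      rcases h5 with rfl | rfl
      · rw [if_pos (by decide), if_neg (by decide), neg_neg]
      · rw [if_neg (by decide), if_pos rfl]
    simp only [τ]
    rw [h3, h4]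
  have hstep : ∀ d, y d false = y d true + τ d * G.length d := by
    intro d
    have h3 := (Φ (G.face d)).length_eq (⟨d, rfl⟩, true)
    have h4 := sideSign_eq Φ (rfl : G.face d = _)
    have h5 := (Φ (G.face d)).level_opp_ne (⟨d, rfl⟩, true)
    change |_| = G.length d at h3
    unfold LineConfiguration.GoesRight at h4
    simp only [faceCycle_opp, Bool.not_true] at h3 h4 h5
    have h6 : ∀ a : ZMod 2, a = 0 ∨ a = 1 := by decide
    simp only [y, τ, sgn]
    rw [h4]
    by_cases hlt : (Φ (G.face d)).level (⟨d, rfl⟩, true) < (Φ (G.face d)).level (⟨d, rfl⟩, false)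
    · have h7 := (Φ (G.face d)).pos_lt _ _ hlt ((Φ (G.face d)).level_le _)
      rw [abs_of_pos (by linarith)] at h3
      rw [if_pos hlt, ← h3]
      rcases h6 (e (G.face d)) with h8 | h8 <;> rw [h8]
      · simp
      · rw [if_neg (by decide), if_neg (by decide)]
        ring
    · have h7 := (Φ (G.face d)).pos_lt _ _ (lt_of_le_of_ne (not_lt.1 hlt) h5)
        ((Φ (G.face d)).level_le _)
      rw [abs_of_neg (by linarith)] at h3
      rw [if_neg hlt, ← h3]
      rcases h6 (e (G.face d)) with h8 | h8 <;> rw [h8]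
      · simp
      · rw [if_neg (by decide), if_pos (by decide)]
        ring
  have hrot : ∀ d, y (G.opp (G.rot d)) false = y d true := by
    intro d
    have hf := face_opp_rot (G := G) d
    have heq : (G.boundaryNext (G.face d)).symm ⟨d, rfl⟩ = ⟨G.opp (G.rot d), hf⟩ :=
      Subtype.ext (G.opp.injective (by rw [opp_boundaryNext_symm, G.opp_opp]))
    rw [hy hf, ← heq, ← faceCycle_rot_true, (Φ (G.face d)).level_rot]
  have hm : ∀ d, y (G.opp d) true - y d false = y (G.opp d) false - y d true := by
    intro d
    have h3 := hstep (G.opp d)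
    rw [hτ, G.length_opp] at h3
    linarith [hstep d]
  obtain ⟨c, hc⟩ := hplane.exists_faceShift (K := ℝ) (fun d => y (G.opp d) true - y d false)
    (fun d => by
      have h3 := hm (G.opp d)
      rw [G.opp_opp] at h3 ⊢
      linarith) (fun u hu => by
      simp only [hm, mul_sub, Finset.sum_sub_distrib]
      rw [sub_eq_zero, ← Equiv.sum_comp G.rot]
      exact Finset.sum_congr rfl fun d _ => by rw [hu, hrot])
  refine ⟨fun d => y d true + c (G.face d), e, c, ?_⟩
  rintro f ⟨⟨d, rfl⟩, _ | _⟩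
  · rw [outDart_false]
    have := hc d
    have h3 : y d false = sgn (G.face d) * (Φ (G.face d)).pos
        ((Φ (G.face d)).level (⟨d, rfl⟩, false)) := rfl
    change y (G.opp d) true + c (G.face (G.opp d)) = sgn (G.face d) * _ + _
    linarith
  · rfl

end FoldingInput


/-! ### Common levels -/

section Levels

open Classical in
/-- The number of points of a finite set that are at most `t`. -/
noncomputable def countLE (Z : Finset ℝ) (t : ℝ) : ℕ := (Z.filter (· ≤ t)).card

variable {Z : Finset ℝ}

theorem countLE_lt {s t : ℝ} (hst : s < t) (ht : t ∈ Z) : countLE Z s < countLE Z t := by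
  classical
  refine Finset.card_lt_card ⟨?_, fun h => ?_⟩
  · exact Finset.monotone_filter_right Z fun z _ hz => hz.trans hst.le
  · have := h (Finset.mem_filter.2 ⟨ht, le_rfl⟩)
    exact absurd (Finset.mem_filter.1 this).2 (not_le.2 hst)

theorem countLE_pos {t : ℝ} (ht : t ∈ Z) : 0 < countLE Z t := by
  classical
  exact Finset.card_pos.2 ⟨t, Finset.mem_filter.2 ⟨ht, le_rfl⟩⟩

theorem countLE_le (t : ℝ) : countLE Z t ≤ Z.card := by
  classical
  exact Finset.card_filter_le _ _

theorem countLE_injOn : Set.InjOn (countLE Z) Z := by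
  intro s hs t ht h
  rcases lt_trichotomy s t with hst | hst | hst
  · exact absurd h (countLE_lt hst ht).ne
  · exact hst
  · exact absurd h (countLE_lt hst hs).ne'

open Classical in
/-- The point of `Z` with a given number from `1` to `Z.card` in increasing order; zero
otherwise. -/
noncomputable def nthPoint (Z : Finset ℝ) (k : ℕ) : ℝ :=
  if h : ∃ z ∈ Z, countLE Z z = k then h.choose else 0

theorem nthPoint_countLE {z : ℝ} (hz : z ∈ Z) : nthPoint Z (countLE Z z) = z := by
  have h : ∃ y ∈ Z, countLE Z y = countLE Z z := ⟨z, hz, rfl⟩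
  rw [nthPoint, dif_pos h]
  exact countLE_injOn h.choose_spec.1 hz h.choose_spec.2

theorem exists_countLE_eq {k : ℕ} (h1 : 1 ≤ k) (hk : k ≤ Z.card) : ∃ z ∈ Z, countLE Z z = k := by
  classical
  have himage : Z.image (countLE Z) = Finset.Icc 1 Z.card := by
    refine Finset.eq_of_subset_of_card_le (fun k hk => ?_) ?_
    · obtain ⟨z, hz, rfl⟩ := Finset.mem_image.1 hk
      exact Finset.mem_Icc.2 ⟨countLE_pos hz, countLE_le z⟩
    · rw [Finset.card_image_of_injOn countLE_injOn]
      simp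
  exact Finset.mem_image.1 (himage ▸ Finset.mem_Icc.2 ⟨h1, hk⟩)

theorem nthPoint_lt {i j : ℕ} (hij : i < j) (hi : 1 ≤ i) (hj : j ≤ Z.card) :
    nthPoint Z i < nthPoint Z j := by
  obtain ⟨y, hy, rfl⟩ := exists_countLE_eq hi (hij.le.trans hj)
  obtain ⟨z, hz, rfl⟩ := exists_countLE_eq (hi.trans hij.le) hj
  rw [nthPoint_countLE hy, nthPoint_countLE hz]
  by_contra! hle
  rcases hle.lt_or_eq with h | h
  · exact absurd hij (not_lt.2 (countLE_lt h hy).le)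
  · rw [h] at hij
    exact lt_irrefl _ hij

theorem exists_forall_le_iff {ρ : ℕ → ℕ} (hρ : StrictMono ρ) (h0 : ρ 0 = 0) :
    ∃ κ : ℕ → ℕ, ∀ k i, ρ k ≤ i ↔ k ≤ κ i := by
  refine ⟨fun i => Nat.findGreatest (fun k => ρ k ≤ i) i, fun k i => ⟨fun h => ?_, fun h => ?_⟩⟩
  · exact Nat.le_findGreatest ((hρ.id_le k).trans h) h
  · refine (hρ.monotone h).trans ?_
    exact Nat.findGreatest_spec (P := fun k => ρ k ≤ i) (Nat.zero_le i)
      (by rw [h0]; exact i.zero_le)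

/-- A layering can be moved to the levels given by the points of a finite set on the line. -/
theorem Layering.exists_countLE {D : Type*} {G : FoldingInput D} {lev lev' : D → ℕ}
    (L : Layering G lev) (N : ℕ) (hN : ∀ d, lev d ≤ N) (Q : ℕ → ℝ)
    (hQ : ∀ k, 1 ≤ k → k < N → Q k < Q (k + 1)) (hZ : ∀ k, 1 ≤ k → k ≤ N → Q k ∈ Z)
    (hlev : ∀ d, lev' d = countLE Z (Q (lev d))) :
    ∃ L' : Layering G lev', ∀ a b, L'.Touching a b ↔ L.Touching a b := by
  let ρ : ℕ → ℕ := fun k =>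
    if k = 0 then 0 else if k ≤ N then countLE Z (Q k) else countLE Z (Q N) + (k - N)
  have hρ : StrictMono ρ := by
    refine strictMono_nat_of_lt_succ fun k => ?_
    simp only [ρ, Nat.succ_ne_zero, if_false]
    rcases Nat.eq_zero_or_pos k with rfl | hk
    · rw [if_pos rfl]
      split_ifs with h
      · exact countLE_pos (hZ _ le_rfl h)
      · omega
    · rw [if_neg hk.ne']
      rcases lt_trichotomy k N with h | rfl | h
      · rw [if_pos h.le, if_pos (Nat.succ_le_of_lt h)]
        exact countLE_lt (hQ k hk h) (hZ _ (by omega) h)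
      · rw [if_pos le_rfl, if_neg (by omega)]
        omega
      · rw [if_neg (by omega), if_neg (by omega)]
        omega
  obtain ⟨κ, hκ⟩ := exists_forall_le_iff hρ (by simp [ρ])
  obtain rfl : lev' = fun d => ρ (lev d) := by
    funext d
    simp only [ρ]
    rw [if_neg (L.pos d).ne', if_pos (hN d), hlev]
  exact ⟨L.refine hρ hκ, L.touching_refine hρ hκ⟩

end Levels

/-! ### Flat foldings of the graph and of its face cycles -/

namespace FoldingInput

open EmbeddedGraph

variable {D : Type*} [Fintype D] {G : FoldingInput D}

theorem exists_faceCycle_folding (hG : G.Connected) (Ψ : FlatFolding G) (f : G.Face) :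
    Nonempty (FlatFolding (G.faceCycle f)) := by
  have : Nonempty ({d : D // G.face d = f} × Bool) := ⟨⟨⟨f.out, Quotient.out_eq f⟩, true⟩⟩
  obtain ⟨F, -⟩ := (Ψ.toLayering.split hG f).exists_flatFolding (G.faceCycle_connected f)
    (fun k => Ψ.pos (k - 1)) (Ψ.n + 1) (fun i j hij hi hj => Ψ.pos_lt _ _ (by omega) (by omega))
    (fun z => Nat.succ_le_succ (Ψ.level_le _)) (by
      rintro ⟨⟨d, hd⟩, _ | _⟩
      · have := Ψ.length_eq (G.opp d)
        rw [G.opp_opp, G.length_opp] at this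
        exact this
      · exact Ψ.length_eq d)
  exact ⟨F⟩

/-- Flat foldings of the face cycles are induced by a flat folding of the graph. -/
theorem exists_flatFolding (hplane : G.IsPlane) (hcons : G.Consistent)
    (Φ : ∀ f, FlatFolding (G.faceCycle f)) :
    ∃ Ψ : FlatFolding G, ∀ a b : D, Ψ.Touching a b ↔
      ∃ (f : G.Face) (ha : G.face a = f) (hb : G.face b = f),
        (Φ f).Touching (⟨a, ha⟩, true) (⟨b, hb⟩, true) := by
  classical
  have : Nonempty D := by
    obtain ⟨d, -⟩ := Quotient.exists_rep G.outer
    exact ⟨d⟩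
  have := Fintype.ofFinite G.Face
  obtain ⟨x, e, c, hx⟩ := exists_placement Φ hplane hcons
  let Q : G.Face → ℕ → ℝ := fun f k => (if e f = 0 then 1 else -1) * (Φ f).pos k + c f
  let Z : Finset ℝ := Finset.univ.biUnion fun f => (Finset.range ((Φ f).n + 1)).image (Q f)
  have hZ : ∀ f k, k ≤ (Φ f).n → Q f k ∈ Z := fun f k hk =>
    Finset.mem_biUnion.2 ⟨f, Finset.mem_univ f,
      Finset.mem_image_of_mem _ (Finset.mem_range.2 (Nat.lt_succ_of_le hk))⟩
  let lev : D → ℕ := fun d => countLE Z (x d)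
  have hface : ∀ f, ∃ L : Layering (G.faceCycle f) (cycleLevel lev f), ∀ a b,
      L.Touching a b ↔ (Φ f).Touching a b := by
    intro f
    by_cases he : e f = 0
    · have hQ : ∀ k, Q f k = (Φ f).pos k + c f := fun k => by simp [Q, he]
      obtain ⟨L, hL⟩ := (Φ f).toLayering.exists_countLE (Z := Z) (lev' := cycleLevel lev f)
        ((Φ f).n + 1) (fun z => Nat.succ_le_succ ((Φ f).level_le z)) (fun k => Q f (k - 1))
        (fun k h1 h2 => by
          have := (Φ f).pos_lt (k - 1) (k + 1 - 1) (by omega) (by omega)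
          rw [hQ, hQ]
          linarith)
        (fun k h1 h2 => hZ f _ (by omega))
        (fun z => congrArg (countLE Z) (hx f z))
      exact ⟨L, fun a b => (hL a b).trans ((Φ f).toLayering_touching a b)⟩
    · have hQ : ∀ k, Q f k = -(Φ f).pos k + c f := fun k => by simp [Q, he]
      have hle : ∀ z, (Φ f).level z + 1 ≤ (Φ f).n + 1 := fun z =>
        Nat.succ_le_succ ((Φ f).level_le z)
      obtain ⟨L, hL⟩ := ((Φ f).toLayering.flip ((Φ f).n + 1) hle).exists_countLE (Z := Z)
        (lev' := cycleLevel lev f) ((Φ f).n + 1) (fun z => by omega)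
        (fun k => Q f ((Φ f).n + 1 - k))
        (fun k h1 h2 => by
          have := (Φ f).pos_lt ((Φ f).n + 1 - (k + 1)) ((Φ f).n + 1 - k) (by omega) (by omega)
          rw [hQ, hQ]
          linarith)
        (fun k h1 h2 => hZ f _ (by omega))
        (fun z => by
          have h1 := (Φ f).level_le z
          have h2 : (Φ f).n + 1 - ((Φ f).n + 1 + 1 - ((Φ f).level z + 1)) = (Φ f).level z := by
            omega
          rw [h2]
          exact congrArg (countLE Z) (hx f z))
      exact ⟨L, fun a b => (hL a b).trans
        (((Φ f).toLayering.touching_flip _ _ a b).trans ((Φ f).toLayering_touching a b))⟩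
  choose L hL using hface
  obtain ⟨L', hL'⟩ := exists_layering hplane.1 hcons L
  have hxZ : ∀ d, x d ∈ Z := fun d => by
    have := hx (G.face d) (⟨d, rfl⟩, true)
    rw [outDart_true] at this
    rw [this]
    exact hZ _ _ ((Φ _).level_le _)
  obtain ⟨Ψ, hΨ⟩ := L'.exists_flatFolding hplane.1 (nthPoint Z) Z.card
    (fun i j hij hi hj => nthPoint_lt hij hi hj) (fun d => countLE_le _) (fun d => by
      rw [nthPoint_countLE (hxZ _), nthPoint_countLE (hxZ _)]
      have h1 := hx (G.face d) (⟨d, rfl⟩, true)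
      have h2 := hx (G.face d) (⟨d, rfl⟩, false)
      have h3 : |_| = G.length d := (Φ (G.face d)).length_eq (⟨d, rfl⟩, true)
      rw [outDart_true] at h1
      rw [outDart_false] at h2
      rw [faceCycle_opp, Bool.not_true] at h3
      rw [h1, h2, ← h3]
      split_ifs
      · congr 1
        ring
      · rw [← abs_neg]
        congr 1
        ring)
  have hside : ∀ i a b, L'.Consecutive i a (G.opp b) ↔
      ∃ (f : G.Face) (ha : G.face a = f) (hb : G.face b = f),
        (L f).Consecutive i (⟨a, ha⟩, true) ((G.faceCycle f).opp (⟨b, hb⟩, true)) := by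
    intro i a b
    rw [hL']
    simp only [G.opp_opp]
    rfl
  refine ⟨Ψ, fun a b => (hΨ a b).trans ?_⟩
  constructor
  · rintro ⟨i, h | h⟩
    · obtain ⟨f, ha, hb, h⟩ := (hside i a b).1 h
      exact ⟨f, ha, hb, (hL f _ _).1 ⟨i, Or.inl h⟩⟩
    · obtain ⟨f, hb, ha, h⟩ := (hside i b a).1 h
      exact ⟨f, ha, hb, (hL f _ _).1 ⟨i, Or.inr h⟩⟩
  · rintro ⟨f, ha, hb, h⟩
    obtain ⟨i, h | h⟩ := (hL f _ _).2 h
    · exact ⟨i, Or.inl ((hside i a b).2 ⟨f, ha, hb, h⟩)⟩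
    · exact ⟨i, Or.inr ((hside i b a).2 ⟨f, hb, ha, h⟩)⟩

end FoldingInput

theorem theorem1 {D : Type*} [Fintype D] (G : FoldingInput D)
    (hplane : G.IsPlane) (hcons : G.Consistent) :
    (Nonempty (FlatFolding G) ↔ ∀ f : G.Face, Nonempty (FlatFolding (G.faceCycle f))) ∧
    ∀ Φ : (f : G.Face) → FlatFolding (G.faceCycle f),
      ∃ Ψ : FlatFolding G, ∀ a b : D, Ψ.Touching a b ↔
        ∃ (f : G.Face) (ha : G.face a = f) (hb : G.face b = f),
          (Φ f).Touching (⟨a, ha⟩, true) (⟨b, hb⟩, true) := by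
  refine ⟨⟨fun ⟨Ψ⟩ f => FoldingInput.exists_faceCycle_folding hplane.1 Ψ f, fun h => ?_⟩,
    FoldingInput.exists_flatFolding hplane hcons⟩
  obtain ⟨Ψ, -⟩ := FoldingInput.exists_flatFolding hplane hcons fun f => (h f).some
  exact ⟨Ψ⟩
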